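/- **Conventions.** An NFA $\mathcal A=(Q,E,\Sigma,s,F)$ has a finite set $Q$ of states, edges $E\subseteq Q\times Q\times\Sigma$, one initial state $s$ and final states $F\subseteq Q$; $\Sigma$ is a finite nonempty totally ordered alphabet, $\sigma=|\Sigma|\ge 1$. NFAs are assumed to satisfy the following: every character of $\Sigma$ labels at least one edge; all edges entering the same state $u$ carry the same label, written $\lambda(u)$; $s$ has no incoming edges, and $\lambda(s)=\#$, where $\#$ is smaller than every character; every state is reachable from $s$ and can reach a final state. A *co-lexicographic order* of $\mathcal A$ is a partial order $\le$ on $Q$ such that (1) $\lambda(u)<\lambda(v)$ implies $u<v$, and (2) for all edges $(u',u),(v',v)$ with $\lambda(u)=\lambda(v)$ and $u<v$ one has $u'\le v'$. $\mathcal A$ is *$p$-sortable* if, for some co-lexicographic order $\le$, the set $Q$ can be partitioned into exactly $p$ nonempty $\le$-chains; the *co-lexicographic width* of $\mathcal A$ is the least such $p$. An automaton is given as the list of its edges and of its final states (in any order, together with the number of states, the initial state and $\sigma$), with states and characters numbered from $0$ (characters in increasing order). Time is counted on a word RAM with unit-cost arithmetic, bitwise, shift, comparison and memory instructions on $w$-bit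 words, with initially zero memory outside the input. **Statement.** There are one word RAM program, which receives neither $p$ nor $w$ as input, and a constant $c$ such that the following hold. 1. There is a constant $C$ such that for all $p,n,\sigma$ with $\sigma\ge1$, all $p$-sortable NFAs $\mathcal A,\mathcal B$ with at most $n$ states each over the same alphabet of size $\sigma$, and every word size $w\ge c\,(p+\lfloor\log_2 n\rfloor)$, the program decides whether $\mathcal L(\mathcal A)=\mathcal L(\mathcal B)$ in at most $C\cdot 2^p(n-p+1)\,n^2\,\sigma$ steps. 2. In particular, NFA equivalence is fixed-parameter tractable with respect to the co-lexicographic width: there are constants $K,k$ such that for all NFAs $\mathcal A,\mathcal B$ over the same alphabet of size $\sigma\ge 1$, with $p$ the maximum of their co-lexicographic widths, $n$ the maximum of their numbers of states and every word size $w\ge c\,(p+\lfloor\log_2 n\rfloor)$, the program decides whether $\mathcal L(\mathcal A)=\mathcal L(\mathcal B)$ in at most $K\cdot 2^p\cdot L^k$ steps, where $L$ is the number of words of the input. -/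

import Mathlib

/-! ## Word RAM with unit-cost instructions -/

namespace WordRAM

/-- The arithmetic, bitwise and shift instructions on words. -/
inductive Op where
  | add | sub | mul | div | mod | band | bor | bxor | shl | shr

/-- The value of an instruction on two `w`-bit words, truncated to `w` bits. -/
def Op.eval (w : ℕ) : Op → ℕ → ℕ → ℕ
  | .add, x, y => (x + y) % 2 ^ w
  | .sub, x, y => (x + 2 ^ w - y) % 2 ^ w
  | .mul, x, y => (x * y) % 2 ^ w
  | .div, x, y => (x / y) % 2 ^ w
  | .mod, x, y => (x % y) % 2 ^ w
  | .band, x, y => (x &&& y) % 2 ^ w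
  | .bor, x, y => (x ||| y) % 2 ^ w
  | .bxor, x, y => (x ^^^ y) % 2 ^ w
  | .shl, x, y => (x <<< y) % 2 ^ w
  | .shr, x, y => (x >>> y) % 2 ^ w

/-- Comparisons of two registers. -/
inductive Test where
  | eq (a b : ℕ)
  | lt (a b : ℕ)

/-- Programs. A program is a finite syntactic object, so it uses finitely many registers and
constants, and it does not depend on the word size or on the input. -/
inductive Cmd where
  /-- `reg d := k` -/
  | const (d k : ℕ)
  /-- `reg d := reg a` -/
  | move (d a : ℕ)
  /-- `reg d := o (reg a) (reg b)` -/
  | op (o : Op) (d a b : ℕ)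
  /-- `reg d := mem (reg a)` -/
  | load (d a : ℕ)
  /-- `mem (reg a) := reg b` -/
  | store (a b : ℕ)
  | skip
  | seq (c₁ c₂ : Cmd)
  | ite (b : Test) (c₁ c₂ : Cmd)
  | loop (b : Test) (c : Cmd)

/-- Machine states: registers, and random access memory addressed by words. -/
structure State where
  reg : ℕ → ℕ
  mem : ℕ → ℕ

def Test.holds : Test → State → Prop
  | .eq a b, s => s.reg a = s.reg b
  | .lt a b, s => s.reg a < s.reg b

def State.setReg (s : State) (d x : ℕ) : State := { s with reg := Function.update s.reg d x }

def State.setMem (s : State) (a x : ℕ) : State := { s with mem := Function.update s.mem a x }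

/-- The start state: the input occupies the memory cells `0, 1, 2, …`, truncated to words; all
other cells and all registers are zero. -/
def State.init (w : ℕ) (input : List ℕ) : State where
  reg := fun _ => 0
  mem := fun i => input.getD i 0 % 2 ^ w

/-- `Exec w c s s' t`: with word size `w`, the program `c` started in state `s` halts in state `s'`
after exactly `t` steps. Every executed instruction costs one step, and so does every evaluation of
the test of a branch or of a loop (including the last one). -/
inductive Exec (w : ℕ) : Cmd → State → State → ℕ → Prop
  | const (d k : ℕ) (s : State) : Exec w (.const d k) s (s.setReg d (k % 2 ^ w)) 1
  | move (d a : ℕ) (s : State) : Exec w (.move d a) s (s.setReg d (s.reg a)) 1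
  | op (o : Op) (d a b : ℕ) (s : State) :
      Exec w (.op o d a b) s (s.setReg d (o.eval w (s.reg a) (s.reg b))) 1
  | load (d a : ℕ) (s : State) : Exec w (.load d a) s (s.setReg d (s.mem (s.reg a))) 1
  | store (a b : ℕ) (s : State) : Exec w (.store a b) s (s.setMem (s.reg a) (s.reg b)) 1
  | skip (s : State) : Exec w .skip s s 1
  | seq {c₁ c₂ : Cmd} {s s₁ s₂ : State} {t₁ t₂ : ℕ} :
      Exec w c₁ s s₁ t₁ → Exec w c₂ s₁ s₂ t₂ → Exec w (.seq c₁ c₂) s s₂ (t₁ + t₂)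
  | ite_true {b : Test} {c₁ c₂ : Cmd} {s s₁ : State} {t : ℕ} :
      b.holds s → Exec w c₁ s s₁ t → Exec w (.ite b c₁ c₂) s s₁ (t + 1)
  | ite_false {b : Test} {c₁ c₂ : Cmd} {s s₁ : State} {t : ℕ} :
      ¬ b.holds s → Exec w c₂ s s₁ t → Exec w (.ite b c₁ c₂) s s₁ (t + 1)
  | loop_done {b : Test} {c : Cmd} {s : State} : ¬ b.holds s → Exec w (.loop b c) s s 1
  | loop_step {b : Test} {c : Cmd} {s s₁ s₂ : State} {t₁ t₂ : ℕ} :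
      b.holds s → Exec w c s s₁ t₁ → Exec w (.loop b c) s₁ s₂ t₂ →
        Exec w (.loop b c) s s₂ (t₁ + t₂ + 1)

/-- The machine is deterministic: final state and running time are determined by the program, the
word size and the start state. -/
theorem Exec.deterministic {w : ℕ} {c : Cmd} {s s₁ s₂ : State} {t₁ t₂ : ℕ}
    (h₁ : Exec w c s s₁ t₁) (h₂ : Exec w c s s₂ t₂) : s₁ = s₂ ∧ t₁ = t₂ := by
  induction h₁ generalizing s₂ t₂ with
  | const | move | op | load | store | skip => cases h₂; exact ⟨rfl, rfl⟩
  | seq _ _ ih₁ ih₂ =>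
    cases h₂ with
    | seq a b =>
      obtain ⟨rfl, rfl⟩ := ih₁ a
      obtain ⟨rfl, rfl⟩ := ih₂ b
      exact ⟨rfl, rfl⟩
  | ite_true hb _ ih =>
    cases h₂ with
    | ite_true _ a => obtain ⟨rfl, rfl⟩ := ih a; exact ⟨rfl, rfl⟩
    | ite_false hb' _ => exact absurd hb hb'
  | ite_false hb _ ih =>
    cases h₂ with
    | ite_true hb' _ => exact absurd hb' hb
    | ite_false _ a => obtain ⟨rfl, rfl⟩ := ih a; exact ⟨rfl, rfl⟩
  | loop_done hb =>
    cases h₂ with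
    | loop_done => exact ⟨rfl, rfl⟩
    | loop_step hb' _ _ => exact absurd hb' hb
  | loop_step hb _ _ ih₁ ih₂ =>
    cases h₂ with
    | loop_done hb' => exact absurd hb hb'
    | loop_step _ a b =>
      obtain ⟨rfl, rfl⟩ := ih₁ a
      obtain ⟨rfl, rfl⟩ := ih₂ b
      exact ⟨rfl, rfl⟩

/-- With word size `w`, the program `c` started on `input` halts within `T` steps, and register `0`
then holds `1` if `P` is true and `0` if `P` is false. -/
def Cmd.DecidesWithin (c : Cmd) (w : ℕ) (input : List ℕ) (P : Prop) (T : ℕ) : Prop :=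
  ∃ (s : State) (t : ℕ), Exec w c (State.init w input) s t ∧ t ≤ T ∧
    (P → s.reg 0 = 1) ∧ (¬ P → s.reg 0 = 0)

end WordRAM

/-! ## Co-lexicographic orders of automata -/

namespace Colex

variable {α Q : Type*}

/-- The standing assumptions on automata: a unique initial state, without incoming edges;
input-consistency (all edges that enter a state have the same label); every state is reachable from
the initial state and can reach a final state; every character labels an edge. -/
structure IsAutomaton (M : NFA α Q) : Prop where
  unique_start : ∃ s, M.start = {s}
  start_no_edge : ∀ s ∈ M.start, ∀ u a, s ∉ M.step u a
  input_consistent : ∀ u u' v a b, v ∈ M.step u a → v ∈ M.step u' b → a = b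
  reachable : ∀ v, ∃ x : List α, v ∈ M.eval x
  coreachable : ∀ v, ∃ x : List α, ∃ f ∈ M.accept, f ∈ M.evalFrom {v} x
  effective : ∀ a, ∃ u v, v ∈ M.step u a

open Classical in
/-- The common label of the edges that enter `v`, and `⊥`, which is smaller than every character,
if there is no such edge. -/
noncomputable def inLabel (M : NFA α Q) (v : Q) : WithBot α :=
  if h : ∃ a u, v ∈ M.step u a then ((h.choose : α) : WithBot α) else ⊥

theorem inLabel_eq {M : NFA α Q} (hM : IsAutomaton M) {u v : Q} {a : α} (h : v ∈ M.step u a) :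
    inLabel M v = (a : WithBot α) := by
  have h' : ∃ a u, v ∈ M.step u a := ⟨a, u, h⟩
  obtain ⟨u', hu'⟩ := h'.choose_spec
  rw [inLabel, dif_pos h', hM.input_consistent _ _ _ _ _ hu' h]

/-- A co-lexicographic order of an automaton. -/
structure IsColexOrder [LinearOrder α] (M : NFA α Q) (le : Q → Q → Prop) : Prop where
  refl : ∀ u, le u u
  antisymm : ∀ u v, le u v → le v u → u = v
  trans : ∀ u v z, le u v → le v z → le u z
  axiom_one : ∀ u v, inLabel M u < inLabel M v → le u v ∧ u ≠ v
  axiom_two : ∀ u' u v' v a b, u ∈ M.step u' a → v ∈ M.step v' b → inLabel M u = inLabel M v →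
    le u v ∧ u ≠ v → le u' v'

/-- Some co-lexicographic order has a decomposition of the states into `p` (nonempty) chains, where
`chain u` is the index of the chain that contains `u`. -/
def Sortable [LinearOrder α] (M : NFA α Q) (p : ℕ) : Prop :=
  ∃ le : Q → Q → Prop, IsColexOrder M le ∧
    ∃ chain : Q → Fin p, Function.Surjective chain ∧ ∀ i, IsChain le {u | chain u = i}

/-- The co-lexicographic width. -/
noncomputable def width [LinearOrder α] (M : NFA α Q) : ℕ := sInf {p | Sortable M p}

end Colex

/-! ## Automata as inputs of a machine -/

namespace Colex

/-- The sequence of words that describes an automaton with states `0, …, m - 1`: the number of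
states, the initial state, the number of edges, the edges (source, target, label), the number of
final states, the final states. -/
def encodeData {m σ : ℕ} (s : Fin m) (es : List (Fin m × Fin m × Fin σ)) (fs : List (Fin m)) :
    List ℕ :=
  [m, (s : ℕ), es.length] ++ es.flatMap (fun e => [(e.1 : ℕ), (e.2.1 : ℕ), (e.2.2 : ℕ)]) ++
    fs.length :: fs.map (fun f => (f : ℕ))

/-- `l` describes `M`; edges and final states are listed without repetition, in any order. -/
def IsEncoding {m σ : ℕ} (M : NFA (Fin σ) (Fin m)) (l : List ℕ) : Prop :=
  ∃ (s : Fin m) (es : List (Fin m × Fin m × Fin σ)) (fs : List (Fin m)),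
    M.start = {s} ∧ es.Nodup ∧ (∀ u v a, (u, v, a) ∈ es ↔ v ∈ M.step u a) ∧
    fs.Nodup ∧ (∀ f, f ∈ fs ↔ f ∈ M.accept) ∧ l = encodeData s es fs

/-- `l` describes a pair of automata over the alphabet `{0, …, σ - 1}`. -/
def IsPairEncoding {m₁ m₂ σ : ℕ} (A : NFA (Fin σ) (Fin m₁)) (B : NFA (Fin σ) (Fin m₂))
    (l : List ℕ) : Prop :=
  ∃ l₁ l₂, IsEncoding A l₁ ∧ IsEncoding B l₂ ∧ l = σ :: (l₁ ++ l₂)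

end Colex

/-!
Let `S` and `T` be the sets of states reached by two words that meet the same chains of the
decomposition, where the word of `S` is co-lexicographically smaller. In each chain no state of `T`
lies below a state of `S` unless both words reach both states. Hence the downward closure of `S`
within the chains is contained in that of `T`, and the upward closure of `T` in that of `S`. A
reached set is the intersection of its two closures, so it is determined by the chains that it
meets and by the difference of the sizes of its closures. This difference takes `2 (m - p) + 1`
values for an automaton with `m` states, so at most `2 ^ p * (2 (m - p) + 1)` sets are reached.

Equivalence of the two power set automata is decided by the method of Hopcroft and Karp: starting
from the two initial sets, the sets reached by the same word are merged in a union-find forest, and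
the successors of a pair are examined only if the pair was not yet merged. Each merge reduces the
number of classes, so fewer pairs are examined than there are reached sets. Binary tries turn a set
of states into a node number in time linear in the number of states.
-/

namespace ColexWidth

open Colex

/-! ### Counting the sets of states reached by a sortable automaton -/

section Parts

variable {Q ι : Type*} {le : Q → Q → Prop} {chain : Q → ι}

/-- The states below a state of `S` in the same chain. -/
def lowerPart (le : Q → Q → Prop) (chain : Q → ι) (S : Set Q) : Set Q :=
  {x | ∃ y ∈ S, chain x = chain y ∧ le x y}

/-- The states above a state of `S` in the same chain. -/
def upperPart (le : Q → Q → Prop) (chain : Q → ι) (S : Set Q) : Set Q :=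
  lowerPart (flip le) chain S

/-- The rank by which the sets of states that meet the same chains are told apart. -/
noncomputable def rank (le : Q → Q → Prop) (chain : Q → ι) (S : Set Q) : ℤ :=
  (lowerPart le chain S).ncard - (upperPart le chain S).ncard

theorem image_lowerPart (hrefl : ∀ u, le u u) (S : Set Q) :
    chain '' lowerPart le chain S = chain '' S := by
  ext i
  constructor
  · rintro ⟨x, ⟨y, hy, hc, -⟩, rfl⟩
    exact ⟨y, hy, hc.symm⟩
  · rintro ⟨y, hy, rfl⟩
    exact ⟨y, ⟨y, hy, rfl, hrefl y⟩, rfl⟩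

theorem image_upperPart (hrefl : ∀ u, le u u) (S : Set Q) :
    chain '' upperPart le chain S = chain '' S :=
  image_lowerPart (le := flip le) hrefl S

theorem ncard_preimage_add_card_le [Fintype Q] [Fintype ι] (hsurj : chain.Surjective)
    (K : Set ι) : (chain ⁻¹' K).ncard + Fintype.card ι ≤ Fintype.card Q + K.ncard := by
  have hpre : (chain ⁻¹' K).ncard + (chain ⁻¹' K)ᶜ.ncard = Fintype.card Q := by
    rw [Set.ncard_add_ncard_compl, Nat.card_eq_fintype_card]
  have hK : K.ncard + Kᶜ.ncard = Fintype.card ι := by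
    rw [Set.ncard_add_ncard_compl, Nat.card_eq_fintype_card]
  have hcompl : Kᶜ.ncard ≤ (chain ⁻¹' K)ᶜ.ncard := by
    rw [← Set.image_preimage_eq Kᶜ hsurj]
    exact Set.ncard_image_le (Set.toFinite _)
  omega

theorem ncard_add_card_le_of_image_eq [Fintype Q] [Fintype ι] (hsurj : chain.Surjective)
    {D U : Set Q} (h : chain '' D = chain '' U) :
    D.ncard + Fintype.card ι ≤ Fintype.card Q + U.ncard := by
  have hD : D.ncard ≤ (chain ⁻¹' (chain '' D)).ncard :=
    Set.ncard_le_ncard (Set.subset_preimage_image _ _) (Set.toFinite _)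
  have hU : (chain '' D).ncard ≤ U.ncard := h ▸ Set.ncard_image_le (Set.toFinite _)
  have := ncard_preimage_add_card_le hsurj (chain '' D)
  omega

theorem rank_mem_Icc [Fintype Q] [Fintype ι] (hrefl : ∀ u, le u u) (hsurj : chain.Surjective)
    (S : Set Q) : rank le chain S ∈ Finset.Icc (-(Fintype.card Q - Fintype.card ι : ℤ))
      (Fintype.card Q - Fintype.card ι) := by
  have h : chain '' lowerPart le chain S = chain '' upperPart le chain S :=
    (image_lowerPart hrefl S).trans (image_upperPart hrefl S).symm
  have := ncard_add_card_le_of_image_eq hsurj h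
  have := ncard_add_card_le_of_image_eq hsurj h.symm
  rw [rank, Finset.mem_Icc]
  omega

end Parts

section Order

variable {α Q : Type*} {M : NFA α Q}

theorem inLabel_eq_bot_of_mem_start (hM : IsAutomaton M) {u : Q} (hu : u ∈ M.start) :
    inLabel M u = ⊥ :=
  dif_neg fun ⟨a, v, h⟩ => hM.start_no_edge u hu v a h

theorem mem_eval_reverse_cons {a : α} {r : List α} {v : Q} :
    v ∈ M.eval (a :: r).reverse ↔ ∃ u ∈ M.eval r.reverse, v ∈ M.step u a := by
  rw [List.reverse_cons, NFA.eval_append_singleton, NFA.mem_stepSet]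

variable [LinearOrder α] {le : Q → Q → Prop}

/-- Words are compared co-lexicographically, that is, by the lexicographic order of their
reversals. -/
theorem not_lt_of_lex (hM : IsAutomaton M) (hle : IsColexOrder M le) {r₁ r₂ : List α}
    (h : List.Lex (· < ·) r₁ r₂) {u v : Q} (hu : u ∈ M.eval r₁.reverse)
    (hv : v ∈ M.eval r₂.reverse) (huv : ¬ (u ∈ M.eval r₂.reverse ∧ v ∈ M.eval r₁.reverse)) :
    ¬ (le v u ∧ v ≠ u) := by
  have not_lt {u v : Q} (hlabel : inLabel M u < inLabel M v) : ¬ (le v u ∧ v ≠ u) :=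
    fun ⟨hvu, hne⟩ => hne (hle.antisymm _ _ hvu (hle.axiom_one u v hlabel).1)
  induction h generalizing u v with
  | nil =>
    obtain ⟨v', -, hvv⟩ := mem_eval_reverse_cons.1 hv
    apply not_lt
    rw [inLabel_eq_bot_of_mem_start hM hu, inLabel_eq hM hvv]
    exact WithBot.bot_lt_coe _
  | cons _ ih =>
    intro hlt
    obtain ⟨u', hu', huu⟩ := mem_eval_reverse_cons.1 hu
    obtain ⟨v', hv', hvv⟩ := mem_eval_reverse_cons.1 hv
    have hlt' := hle.axiom_two v' v u' u _ _ hvv huu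
      ((inLabel_eq hM hvv).trans (inLabel_eq hM huu).symm) hlt
    have huv' : ¬ (u' ∈ M.eval _ ∧ v' ∈ M.eval _) := fun ⟨hu₂, hv₁⟩ =>
      huv ⟨mem_eval_reverse_cons.2 ⟨u', hu₂, huu⟩, mem_eval_reverse_cons.2 ⟨v', hv₁, hvv⟩⟩
    refine ih hu' hv' huv' ⟨hlt', ?_⟩
    rintro rfl
    exact huv' ⟨hv', hu'⟩
  | rel hab =>
    obtain ⟨u', -, huu⟩ := mem_eval_reverse_cons.1 hu
    obtain ⟨v', -, hvv⟩ := mem_eval_reverse_cons.1 hv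
    apply not_lt
    rw [inLabel_eq hM huu, inLabel_eq hM hvv]
    exact WithBot.coe_lt_coe.2 hab

variable {ι : Type*} {chain : Q → ι} {r₁ r₂ : List α}

theorem le_of_lex_of_chain_eq (hM : IsAutomaton M) (hle : IsColexOrder M le)
    (hchain : ∀ i, IsChain le {u | chain u = i}) (h : List.Lex (· < ·) r₁ r₂) {u v : Q}
    (hu : u ∈ M.eval r₁.reverse) (hv : v ∈ M.eval r₂.reverse) (huv : chain u = chain v)
    (hnot : ¬ (u ∈ M.eval r₂.reverse ∧ v ∈ M.eval r₁.reverse)) : le u v := by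
  by_cases heq : u = v
  · exact heq ▸ hle.refl u
  · exact (hchain (chain v) huv rfl heq).resolve_right fun hvu =>
      not_lt_of_lex hM hle h hu hv hnot ⟨hvu, Ne.symm heq⟩

theorem lowerPart_subset_of_lex (hM : IsAutomaton M) (hle : IsColexOrder M le)
    (hchain : ∀ i, IsChain le {u | chain u = i}) (h : List.Lex (· < ·) r₁ r₂)
    (himage : chain '' M.eval r₁.reverse = chain '' M.eval r₂.reverse) :
    lowerPart le chain (M.eval r₁.reverse) ⊆ lowerPart le chain (M.eval r₂.reverse) := by
  rintro x ⟨y, hy, hc, hxy⟩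
  by_cases hy₂ : y ∈ M.eval r₂.reverse
  · exact ⟨y, hy₂, hc, hxy⟩
  · obtain ⟨v, hv, hcv⟩ : chain y ∈ chain '' M.eval r₂.reverse := himage ▸ ⟨y, hy, rfl⟩
    exact ⟨v, hv, hc.trans hcv.symm, hle.trans _ _ _ hxy
      (le_of_lex_of_chain_eq hM hle hchain h hy hv hcv.symm fun hh => hy₂ hh.1)⟩

theorem upperPart_subset_of_lex (hM : IsAutomaton M) (hle : IsColexOrder M le)
    (hchain : ∀ i, IsChain le {u | chain u = i}) (h : List.Lex (· < ·) r₁ r₂)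
    (himage : chain '' M.eval r₁.reverse = chain '' M.eval r₂.reverse) :
    upperPart le chain (M.eval r₂.reverse) ⊆ upperPart le chain (M.eval r₁.reverse) := by
  rintro x ⟨y, hy, hc, hyx⟩
  by_cases hy₁ : y ∈ M.eval r₁.reverse
  · exact ⟨y, hy₁, hc, hyx⟩
  · obtain ⟨v, hv, hcv⟩ : chain y ∈ chain '' M.eval r₁.reverse := himage ▸ ⟨y, hy, rfl⟩
    exact ⟨v, hv, hc.trans hcv.symm, hle.trans _ _ _
      (le_of_lex_of_chain_eq hM hle hchain h hv hy hcv fun hh => hy₁ hh.2) hyx⟩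

theorem lowerPart_inter_upperPart (hM : IsAutomaton M) (hle : IsColexOrder M le) (r : List α) :
    lowerPart le chain (M.eval r.reverse) ∩ upperPart le chain (M.eval r.reverse) =
      M.eval r.reverse := by
  ext z
  constructor
  · rintro ⟨⟨y, hy, -, hzy⟩, x, hx, -, hxz⟩
    by_contra hz
    obtain ⟨word, hword⟩ := hM.reachable z
    rw [← word.reverse_reverse] at hword
    rcases lt_trichotomy r word.reverse with h | rfl | h
    · exact not_lt_of_lex hM hle h hy hword (fun hh => hz hh.2) ⟨hzy, by rintro rfl; exact hz hy⟩
    · exact hz hword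
    · exact not_lt_of_lex hM hle h hword hx (fun hh => hz hh.1) ⟨hxz, by rintro rfl; exact hz hx⟩
  · exact fun hz => ⟨⟨z, hz, rfl, hle.refl z⟩, z, hz, rfl, hle.refl z⟩

theorem eval_eq_of_lex_of_rank_eq [Finite Q] (hM : IsAutomaton M) (hle : IsColexOrder M le)
    (hchain : ∀ i, IsChain le {u | chain u = i}) (h : List.Lex (· < ·) r₁ r₂)
    (himage : chain '' M.eval r₁.reverse = chain '' M.eval r₂.reverse)
    (hrank : rank le chain (M.eval r₁.reverse) = rank le chain (M.eval r₂.reverse)) :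
    M.eval r₁.reverse = M.eval r₂.reverse := by
  have hlower := lowerPart_subset_of_lex hM hle hchain h himage
  have hupper := upperPart_subset_of_lex hM hle hchain h himage
  have hlower_card := Set.ncard_le_ncard hlower
  have hupper_card := Set.ncard_le_ncard hupper
  simp only [rank] at hrank
  rw [← lowerPart_inter_upperPart (chain := chain) hM hle r₁,
    Set.eq_of_subset_of_ncard_le hlower (by omega),
    ← Set.eq_of_subset_of_ncard_le hupper (by omega), lowerPart_inter_upperPart hM hle]

theorem injOn_image_rank [Finite Q] (hM : IsAutomaton M) (hle : IsColexOrder M le)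
    (hchain : ∀ i, IsChain le {u | chain u = i}) :
    Set.InjOn (fun S => (chain '' S, rank le chain S)) (Set.range M.eval) := by
  rintro _ ⟨w₁, rfl⟩ _ ⟨w₂, rfl⟩ heq
  rw [← w₁.reverse_reverse, ← w₂.reverse_reverse] at heq ⊢
  obtain ⟨himage, hrank⟩ := Prod.mk.inj heq
  rcases lt_trichotomy w₁.reverse w₂.reverse with h | h | h
  · exact eval_eq_of_lex_of_rank_eq hM hle hchain h himage hrank
  · rw [h]
  · exact (eval_eq_of_lex_of_rank_eq hM hle hchain h himage.symm hrank.symm).symm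

variable {p : ℕ}

theorem le_card_of_sortable [Fintype Q] (h : Sortable M p) : p ≤ Fintype.card Q := by
  obtain ⟨-, -, chain, hsurj, -⟩ := h
  simpa using Fintype.card_le_of_surjective chain hsurj

theorem pos_of_sortable (hM : IsAutomaton M) (h : Sortable M p) : 0 < p := by
  obtain ⟨-, -, chain, -, -⟩ := h
  obtain ⟨s, -⟩ := hM.unique_start
  exact (chain s).pos

theorem ncard_range_eval_le [Fintype Q] (hM : IsAutomaton M) (hp : Sortable M p) :
    (Set.range M.eval).ncard ≤ 2 ^ p * (2 * (Fintype.card Q - p) + 1) := by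
  have hpQ := le_card_of_sortable hp
  obtain ⟨le, hle, chain, hsurj, hchain⟩ := hp
  let d : ℤ := Fintype.card Q - Fintype.card (Fin p)
  calc (Set.range M.eval).ncard
      ≤ ((Set.univ : Set (Set (Fin p))) ×ˢ (Finset.Icc (-d) d : Set ℤ)).ncard :=
        Set.ncard_le_ncard_of_injOn (fun S => (chain '' S, rank le chain S))
          (fun S _ => ⟨Set.mem_univ _, rank_mem_Icc hle.refl hsurj S⟩)
          (injOn_image_rank hM hle hchain) (Set.toFinite _)
    _ = 2 ^ p * (2 * (Fintype.card Q - p) + 1) := by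
        rw [Set.ncard_prod, Set.ncard_univ, Nat.card_eq_fintype_card, Fintype.card_set,
          Fintype.card_fin, Set.ncard_coe_finset, Int.card_Icc]
        simp only [d, Fintype.card_fin]
        congr 1
        omega

/-- Distinct states are made comparable only if their labels differ, and each state is a chain. -/
theorem sortable_card [Fintype Q] (M : NFA α Q) : Sortable M (Fintype.card Q) := by
  let e := Fintype.equivFin Q
  refine ⟨fun u v => u = v ∨ inLabel M u < inLabel M v, ⟨fun _ => .inl rfl, ?_, ?_, ?_, ?_⟩, e,
    e.surjective, ?_⟩
  · rintro u v (h | h) (h' | h')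
    · exact h
    · exact h
    · exact h'.symm
    · exact absurd h h'.asymm
  · rintro u v z (rfl | h) (rfl | h')
    · exact .inl rfl
    · exact .inr h'
    · exact .inr h
    · exact .inr (h.trans h')
  · exact fun u v h => ⟨.inr h, fun heq => h.ne (congrArg _ heq)⟩
  · rintro u' u v' v a b - - hlabel ⟨h | h, hne⟩
    · exact absurd h hne
    · exact absurd hlabel h.ne
  · exact fun i u hu v hv huv => absurd (e.injective (Eq.trans hu (Eq.symm hv))) huv

theorem sortable_width [Finite Q] (M : NFA α Q) : Sortable M (width M) := by
  have := Fintype.ofFinite Q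
  exact Nat.sInf_mem (s := {p | Sortable M p}) ⟨_, sortable_card M⟩

end Order

end ColexWidth

namespace ArrayLang

/-- States of the array machine: registers named by `V`, unbounded arrays named by `A`, and the
number of steps made so far. -/
structure St (V A : Type*) where
  reg : V → ℕ
  arr : A → ℕ → ℕ
  tick : ℕ

/-- Comparisons of two registers. -/
inductive Cond (V : Type*) where
  | eq (a b : V)
  | lt (a b : V)

/-- Structured programs over registers and arrays, with access to a read-only input. -/
inductive Prog (V A : Type*) where
  | zero (d : V)
  | move (d a : V)
  | inc (d : V)
  | add (d a b : V)
  | input (d a : V)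
  | load (d : V) (k : A) (a : V)
  | store (k : A) (a b : V)
  | seq (c₁ c₂ : Prog V A)
  | ite (b : Cond V) (c₁ c₂ : Prog V A)
  | loop (b : Cond V) (c : Prog V A)

infixr:60 " ;; " => Prog.seq

variable {V A : Type*}

/-- The truth of a comparison in a state. -/
def Cond.holds : Cond V → St V A → Prop
  | .eq a b, s => s.reg a = s.reg b
  | .lt a b, s => s.reg a < s.reg b

namespace St

/-- The initial state: all registers and arrays are zero, as is the clock. -/
def init : St V A := ⟨fun _ => 0, fun _ _ => 0, 0⟩

/-- One step that only evaluates a test. -/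
def tock (s : St V A) : St V A := { s with tick := s.tick + 1 }

/-- One step that assigns to a register. -/
def set [DecidableEq V] (s : St V A) (d : V) (x : ℕ) : St V A :=
  { s with reg := Function.update s.reg d x, tick := s.tick + 1 }

/-- One step that assigns to an entry of an array. -/
def put [DecidableEq A] (s : St V A) (k : A) (i x : ℕ) : St V A :=
  { s with arr := Function.update s.arr k (Function.update (s.arr k) i x), tick := s.tick + 1 }

@[simp] theorem tock_reg (s : St V A) : s.tock.reg = s.reg := rfl

@[simp] theorem tock_arr (s : St V A) : s.tock.arr = s.arr := rfl

@[simp] theorem tock_tick (s : St V A) : s.tock.tick = s.tick + 1 := rfl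

@[simp] theorem set_reg [DecidableEq V] (s : St V A) (d x v) :
    (s.set d x).reg v = if v = d then x else s.reg v :=
  Function.update_apply _ _ _ _

@[simp] theorem set_arr [DecidableEq V] (s : St V A) (d x) : (s.set d x).arr = s.arr := rfl

@[simp] theorem set_tick [DecidableEq V] (s : St V A) (d x) :
    (s.set d x).tick = s.tick + 1 := rfl

@[simp] theorem put_reg [DecidableEq A] (s : St V A) (k i x) : (s.put k i x).reg = s.reg := rfl

@[simp] theorem put_arr [DecidableEq A] (s : St V A) (k i x k') :
    (s.put k i x).arr k' = if k' = k then Function.update (s.arr k) i x else s.arr k' :=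
  Function.update_apply _ _ _ _

@[simp] theorem put_tick [DecidableEq A] (s : St V A) (k i x) :
    (s.put k i x).tick = s.tick + 1 := rfl

end St

variable [DecidableEq V] [DecidableEq A]

/-- Big-step semantics on the input `inp`. Sums must not exceed `B`: this keeps all numbers that
occur in a run of `T` steps below `B + T`. -/
inductive Steps (B : ℕ) (inp : ℕ → ℕ) : Prog V A → St V A → St V A → Prop
  | zero (d s) : Steps B inp (.zero d) s (s.set d 0)
  | move (d a s) : Steps B inp (.move d a) s (s.set d (s.reg a))
  | inc (d s) : Steps B inp (.inc d) s (s.set d (s.reg d + 1))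
  | add (d a b s) : s.reg a + s.reg b ≤ B →
      Steps B inp (.add d a b) s (s.set d (s.reg a + s.reg b))
  | input (d a s) : Steps B inp (.input d a) s (s.set d (inp (s.reg a)))
  | load (d k a s) : Steps B inp (.load d k a) s (s.set d (s.arr k (s.reg a)))
  | store (k a b s) : Steps B inp (.store k a b) s (s.put k (s.reg a) (s.reg b))
  | seq {c₁ c₂ s s₁ s₂} : Steps B inp c₁ s s₁ → Steps B inp c₂ s₁ s₂ →
      Steps B inp (.seq c₁ c₂) s s₂
  | ite_true {b : Cond V} {c₁ c₂ s s₁} : b.holds s → Steps B inp c₁ s.tock s₁ →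
      Steps B inp (.ite b c₁ c₂) s s₁
  | ite_false {b : Cond V} {c₁ c₂ s s₁} : ¬ b.holds s → Steps B inp c₂ s.tock s₁ →
      Steps B inp (.ite b c₁ c₂) s s₁
  | loop_done {b : Cond V} {c s} : ¬ b.holds s → Steps B inp (.loop b c) s s.tock
  | loop_step {b : Cond V} {c s s₁ s₂} : b.holds s → Steps B inp c s.tock s₁ →
      Steps B inp (.loop b c) s₁ s₂ → Steps B inp (.loop b c) s s₂

theorem Steps.tick_le {B : ℕ} {inp : ℕ → ℕ} {c : Prog V A} {s s' : St V A}
    (h : Steps B inp c s s') : s.tick ≤ s'.tick := by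
  induction h with
  | zero | move | inc | add | input | load | store | loop_done => exact Nat.le_succ _
  | seq _ _ ih₁ ih₂ => exact ih₁.trans ih₂
  | ite_true _ _ ih | ite_false _ _ ih => exact (Nat.le_succ _).trans ih
  | loop_step _ _ _ ih₁ ih₂ => exact (Nat.le_succ _).trans (ih₁.trans ih₂)

/-! ### Frames -/

namespace Prog

/-- A syntactic over-approximation of the registers that a run may change, used for framing. -/
def writesVar : Prog V A → V → Bool
  | .zero d, v | .move d _, v | .inc d, v | .add d _ _, v | .input d _, v | .load d _ _, v =>
    decide (v = d)
  | .store _ _ _, _ => false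
  | .seq c₁ c₂, v | .ite _ c₁ c₂, v => c₁.writesVar v || c₂.writesVar v
  | .loop _ c, v => c.writesVar v

/-- A syntactic over-approximation of the arrays that a run may change, used for framing. -/
def writesArr : Prog V A → A → Bool
  | .store k _ _, k' => decide (k' = k)
  | .seq c₁ c₂, k | .ite _ c₁ c₂, k => c₁.writesArr k || c₂.writesArr k
  | .loop _ c, k => c.writesArr k
  | _, _ => false

end Prog

/-- `s'` agrees with `s` on everything that `c` does not write. -/
structure Frame (c : Prog V A) (s s' : St V A) : Prop where
  reg : ∀ v, c.writesVar v = false → s'.reg v = s.reg v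
  arr : ∀ k, c.writesArr k = false → s'.arr k = s.arr k

namespace Frame

variable {c c₁ c₂ : Prog V A} {s s₁ s₂ : St V A}

theorem refl (c : Prog V A) (s : St V A) : Frame c s s := ⟨fun _ _ => rfl, fun _ _ => rfl⟩

theorem trans (h₁ : Frame c s s₁) (h₂ : Frame c s₁ s₂) : Frame c s s₂ :=
  ⟨fun v hv => (h₂.reg v hv).trans (h₁.reg v hv), fun k hk => (h₂.arr k hk).trans (h₁.arr k hk)⟩

theorem of_tock (h : Frame c s.tock s₁) : Frame c s s₁ := ⟨h.reg, h.arr⟩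

theorem mono (h : Frame c₁ s s₁) (hv : ∀ v, c₂.writesVar v = false → c₁.writesVar v = false)
    (hk : ∀ k, c₂.writesArr k = false → c₁.writesArr k = false) : Frame c₂ s s₁ :=
  ⟨fun v h' => h.reg v (hv v h'), fun k h' => h.arr k (hk k h')⟩

theorem set {d : V} (hd : c.writesVar d = true) (s : St V A) (x : ℕ) : Frame c s (s.set d x) :=
  ⟨fun v hv => (St.set_reg _ _ _ _).trans <| if_neg fun h => by simp [← h, hv] at hd,
    fun _ _ => rfl⟩

theorem put {k : A} (hk : c.writesArr k = true) (s : St V A) (i x : ℕ) : Frame c s (s.put k i x) :=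
  ⟨fun _ _ => rfl,
    fun v hv => (St.put_arr _ _ _ _ _).trans <| if_neg fun h => by simp [← h, hv] at hk⟩

theorem seq (h₁ : Frame c₁ s s₁) (h₂ : Frame c₂ s₁ s₂) : Frame (c₁ ;; c₂) s s₂ :=
  (h₁.mono (by simp +contextual [Prog.writesVar]) (by simp +contextual [Prog.writesArr])).trans
    (h₂.mono (by simp +contextual [Prog.writesVar]) (by simp +contextual [Prog.writesArr]))

end Frame

theorem Steps.frame {B : ℕ} {inp : ℕ → ℕ} {c : Prog V A} {s s' : St V A}
    (h : Steps B inp c s s') : Frame c s s' := by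
  induction h with
  | zero | move | inc | add | input | load =>
    exact Frame.set (by simp [Prog.writesVar]) _ _
  | store => exact Frame.put (by simp [Prog.writesArr]) _ _ _
  | seq _ _ h₁ h₂ => exact h₁.seq h₂
  | ite_true _ _ h | ite_false _ _ h =>
    exact h.of_tock.mono (by simp +contextual [Prog.writesVar])
      (by simp +contextual [Prog.writesArr])
  | loop_done => exact (Frame.refl _ _).of_tock
  | loop_step _ _ _ h₁ h₂ =>
    exact Frame.trans ⟨h₁.of_tock.reg, h₁.of_tock.arr⟩ h₂

/-! ### Total correctness -/

/-- Started in `s`, the program `c` halts in a state that satisfies `Q`. -/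
def Runs (B : ℕ) (inp : ℕ → ℕ) (c : Prog V A) (s : St V A) (Q : St V A → Prop) : Prop :=
  ∃ s', Steps B inp c s s' ∧ Q s'

section Runs

variable {B : ℕ} {inp : ℕ → ℕ} {c c₁ c₂ : Prog V A} {s : St V A} {Q Q' : St V A → Prop}

theorem Runs.mono (h : Runs B inp c s Q) (hQ : ∀ s', Frame c s s' → Q s' → Q' s') :
    Runs B inp c s Q' :=
  let ⟨s', h₁, h₂⟩ := h
  ⟨s', h₁, hQ s' h₁.frame h₂⟩

@[simp] theorem runs_zero {d : V} : Runs B inp (.zero d) s Q ↔ Q (s.set d 0) :=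
  ⟨fun ⟨_, h, hq⟩ => by cases h; exact hq, fun h => ⟨_, .zero _ _, h⟩⟩

@[simp] theorem runs_move {d a : V} : Runs B inp (.move d a) s Q ↔ Q (s.set d (s.reg a)) :=
  ⟨fun ⟨_, h, hq⟩ => by cases h; exact hq, fun h => ⟨_, .move _ _ _, h⟩⟩

@[simp] theorem runs_inc {d : V} : Runs B inp (.inc d) s Q ↔ Q (s.set d (s.reg d + 1)) :=
  ⟨fun ⟨_, h, hq⟩ => by cases h; exact hq, fun h => ⟨_, .inc _ _, h⟩⟩

@[simp] theorem runs_add {d a b : V} : Runs B inp (.add d a b) s Q ↔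
    s.reg a + s.reg b ≤ B ∧ Q (s.set d (s.reg a + s.reg b)) :=
  ⟨fun ⟨_, h, hq⟩ => by cases h with | add _ _ _ _ h => exact ⟨h, hq⟩,
    fun h => ⟨_, .add _ _ _ _ h.1, h.2⟩⟩

@[simp] theorem runs_input {d a : V} :
    Runs B inp (.input d a) s Q ↔ Q (s.set d (inp (s.reg a))) :=
  ⟨fun ⟨_, h, hq⟩ => by cases h; exact hq, fun h => ⟨_, .input _ _ _, h⟩⟩

@[simp] theorem runs_load {d a : V} {k : A} :
    Runs B inp (.load d k a) s Q ↔ Q (s.set d (s.arr k (s.reg a))) :=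
  ⟨fun ⟨_, h, hq⟩ => by cases h; exact hq, fun h => ⟨_, .load _ _ _ _, h⟩⟩

@[simp] theorem runs_store {a b : V} {k : A} :
    Runs B inp (.store k a b) s Q ↔ Q (s.put k (s.reg a) (s.reg b)) :=
  ⟨fun ⟨_, h, hq⟩ => by cases h; exact hq, fun h => ⟨_, .store _ _ _ _, h⟩⟩

@[simp] theorem runs_seq :
    Runs B inp (c₁ ;; c₂) s Q ↔ Runs B inp c₁ s fun s' => Runs B inp c₂ s' Q :=
  ⟨fun ⟨_, h, hq⟩ => by cases h with | seq a b => exact ⟨_, a, _, b, hq⟩,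
    fun ⟨_, a, _, b, hq⟩ => ⟨_, .seq a b, hq⟩⟩

theorem runs_ite {b : Cond V} : Runs B inp (.ite b c₁ c₂) s Q ↔
    (b.holds s → Runs B inp c₁ s.tock Q) ∧ (¬ b.holds s → Runs B inp c₂ s.tock Q) := by
  constructor
  · rintro ⟨s', h, hq⟩
    cases h with
    | ite_true hb h => exact ⟨fun _ => ⟨_, h, hq⟩, fun hb' => absurd hb hb'⟩
    | ite_false hb h => exact ⟨fun hb' => absurd hb' hb, fun _ => ⟨_, h, hq⟩⟩
  · rintro ⟨h₁, h₂⟩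
    by_cases hb : b.holds s
    · obtain ⟨s', h, hq⟩ := h₁ hb
      exact ⟨s', .ite_true hb h, hq⟩
    · obtain ⟨s', h, hq⟩ := h₂ hb
      exact ⟨s', .ite_false hb h, hq⟩

@[simp] theorem runs_ite_eq {a b : V} : Runs B inp (.ite (.eq a b) c₁ c₂) s Q ↔
    (s.reg a = s.reg b → Runs B inp c₁ s.tock Q) ∧ (s.reg a ≠ s.reg b → Runs B inp c₂ s.tock Q) :=
  runs_ite

@[simp] theorem runs_ite_lt {a b : V} : Runs B inp (.ite (.lt a b) c₁ c₂) s Q ↔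
    (s.reg a < s.reg b → Runs B inp c₁ s.tock Q) ∧
      (¬ s.reg a < s.reg b → Runs B inp c₂ s.tock Q) :=
  runs_ite

theorem runs_loop {b : Cond V} (I : St V A → Prop) (μ : St V A → ℕ) (h₀ : I s)
    (hstep : ∀ s', Frame c s s' → I s' → b.holds s' →
      Runs B inp c s'.tock fun s'' => I s'' ∧ μ s'' < μ s')
    (hdone : ∀ s', Frame c s s' → I s' → ¬ b.holds s' → Q s'.tock) :
    Runs B inp (.loop b c) s Q := by
  suffices key : ∀ n s', μ s' = n → Frame c s s' → I s' → Runs B inp (.loop b c) s' Q from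
    key _ s rfl (Frame.refl _ _) h₀
  intro n
  induction n using Nat.strong_induction_on with
  | _ n ih =>
    intro s' hn hf hI
    by_cases hb : b.holds s'
    · obtain ⟨s₁, e₁, hI₁, hμ⟩ := hstep s' hf hI hb
      obtain ⟨s₂, e₂, hq⟩ := ih (μ s₁) (hn ▸ hμ) s₁ rfl (hf.trans e₁.frame.of_tock) hI₁
      exact ⟨s₂, .loop_step hb e₁ e₂, hq⟩
    · exact ⟨_, .loop_done hb, hdone s' hf hI hb⟩

/-- `for i := 0, …, n - 1 do c` -/
def Prog.for (i n : V) (c : Prog V A) : Prog V A := .zero i ;; .loop (.lt i n) (c ;; .inc i)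

theorem runs_for {i n : V} {c : Prog V A} (J : ℕ → St V A → Prop) (N : ℕ) (hN : s.reg n = N)
    (hi : c.writesVar i = false) (hn : c.writesVar n = false) (hne : n ≠ i)
    (h₀ : J 0 (s.set i 0))
    (hstep : ∀ k s', k < N → s'.reg i = k → s'.reg n = N → Frame (Prog.for i n c) s s' → J k s' →
      Runs B inp c s'.tock fun s'' => J (k + 1) (s''.set i (k + 1)))
    (hdone : ∀ s', Frame (Prog.for i n c) s s' → J N s' → Q s'.tock) :
    Runs B inp (Prog.for i n c) s Q := by
  have hframe : ∀ s', Frame (c ;; .inc i) (s.set i 0) s' → Frame (Prog.for i n c) s s' :=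
    fun s' h => Frame.seq (Frame.set (c := .zero i) (by simp [Prog.writesVar]) s 0) ⟨h.reg, h.arr⟩
  have hnN : ∀ s', Frame (c ;; .inc i) (s.set i 0) s' → s'.reg n = N := fun s' hf => by
    rw [hf.reg n (by simp [Prog.writesVar, hn, hne]), St.set_reg, if_neg hne, hN]
  rw [Prog.for, runs_seq, runs_zero]
  refine runs_loop (fun s' => s'.reg i ≤ N ∧ J (s'.reg i) s') (fun s' => N - s'.reg i)
    ⟨by simp, by simpa using h₀⟩ ?_ ?_
  · rintro s' hf ⟨-, hJ⟩ hb
    have hlt : s'.reg i < N := hnN s' hf ▸ hb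
    rw [runs_seq]
    refine (hstep _ s' hlt rfl (hnN s' hf) (hframe _ hf) hJ).mono fun s'' hf' hJ' => ?_
    have hi' : s''.reg i = s'.reg i := hf'.reg i hi
    simp only [runs_inc, St.set_reg, if_true, hi']
    exact ⟨⟨hlt, hJ'⟩, by omega⟩
  · rintro s' hf ⟨hle, hJ⟩ hb
    have hiN : s'.reg i = N := le_antisymm hle (not_lt.1 (hnN s' hf ▸ hb))
    exact hdone s' (hframe _ hf) (hiN ▸ hJ)

end Runs

/-! ### Compilation to the word RAM -/

section Compile

open WordRAM

variable {V A : Type*}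

/-- The machine register that implements `v`. The compiled code has two more registers to itself,
`card V` and `card V + 1`. -/
noncomputable def regIdx [Fintype V] (v : V) : ℕ := Fintype.equivFin V v

/-- A number for `k`, which determines the residue class of the offsets of its entries. -/
noncomputable def arrIdx [Fintype A] (k : A) : ℕ := Fintype.equivFin A k

theorem regIdx_lt [Fintype V] (v : V) : regIdx v < Fintype.card V := (Fintype.equivFin V v).isLt

theorem arrIdx_lt [Fintype A] (k : A) : arrIdx k < Fintype.card A := (Fintype.equivFin A k).isLt

theorem regIdx_injective [Fintype V] : Function.Injective (regIdx (V := V)) :=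
  Fin.val_injective.comp (Fintype.equivFin V).injective

theorem arrIdx_injective [Fintype A] : Function.Injective (arrIdx (A := A)) :=
  Fin.val_injective.comp (Fintype.equivFin A).injective

/-- The distance of the entry `i` of the array `k` from the end of the memory; it is positive. -/
noncomputable def offset [Fintype A] (k : A) (i : ℕ) : ℕ := i * Fintype.card A + (arrIdx k + 1)

/-- The arrays are interleaved and fill the memory downwards from its last cell, away from the
input in the first cells. -/
noncomputable def addr [Fintype A] (w : ℕ) (k : A) (i : ℕ) : ℕ := 2 ^ w - offset k i

/-- Computes an address in register `card V + 1`, with register `card V` as scratch space. -/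
noncomputable def addrCmd [Fintype V] [Fintype A] (k : A) (a : V) : Cmd :=
  let scratch := Fintype.card V
  let result := Fintype.card V + 1
  .seq (.const scratch (Fintype.card A)) <| .seq (.op .mul result (regIdx a) scratch) <|
    .seq (.const scratch (arrIdx k + 1)) <| .seq (.op .add result result scratch) <|
      .seq (.const scratch 0) (.op .sub result scratch result)

/-- The machine test that implements a comparison. -/
noncomputable def Cond.compile [Fintype V] : Cond V → Test
  | .eq a b => .eq (regIdx a) (regIdx b)
  | .lt a b => .lt (regIdx a) (regIdx b)

/-- The machine code that implements a program, each instruction by at most seven of the machine. -/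
noncomputable def Prog.compile [Fintype V] [Fintype A] : Prog V A → Cmd
  | .zero d => .const (regIdx d) 0
  | .move d a => .move (regIdx d) (regIdx a)
  | .inc d => .seq (.const (Fintype.card V) 1) (.op .add (regIdx d) (regIdx d) (Fintype.card V))
  | .add d a b => .op .add (regIdx d) (regIdx a) (regIdx b)
  | .input d a => .load (regIdx d) (regIdx a)
  | .load d k a => .seq (addrCmd k a) (.load (regIdx d) (Fintype.card V + 1))
  | .store k a b => .seq (addrCmd k a) (.store (Fintype.card V + 1) (regIdx b))
  | .seq c₁ c₂ => .seq c₁.compile c₂.compile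
  | .ite b c₁ c₂ => .ite b.compile c₁.compile c₂.compile
  | .loop b c => .loop b.compile c.compile

/-- The machine state `s` represents `h`, as far as array indices up to `D` are concerned. -/
structure Represents [Fintype V] [Fintype A] (w D : ℕ) (inp : ℕ → ℕ) (h : St V A) (s : State) :
    Prop where
  reg : ∀ v : V, s.reg (regIdx v) = h.reg v
  arr : ∀ k i, i ≤ D → s.mem (addr w k i) = h.arr k i
  inp : ∀ i ≤ D, s.mem i = inp i

/-- All numbers in `h` are at most `B` plus the number of steps made so far. -/
structure Bounded (B : ℕ) (h : St V A) : Prop where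
  reg : ∀ v, h.reg v ≤ B + h.tick
  arr : ∀ k i, h.arr k i ≤ B + h.tick

section Bounded

variable {B : ℕ} {h : St V A}

theorem Bounded.tock (hb : Bounded B h) : Bounded B h.tock :=
  ⟨fun v => (hb.reg v).trans (Nat.le_succ _), fun k i => (hb.arr k i).trans (Nat.le_succ _)⟩

theorem Bounded.set [DecidableEq V] (hb : Bounded B h) (d : V) {x : ℕ}
    (hx : x ≤ B + h.tick + 1) : Bounded B (h.set d x) := by
  refine ⟨fun v => ?_, fun k i => (hb.arr k i).trans (Nat.le_succ _)⟩
  rw [St.set_reg]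
  split
  · exact hx
  · exact (hb.reg v).trans (Nat.le_succ _)

theorem Bounded.put [DecidableEq A] (hb : Bounded B h) (k : A) (i : ℕ) {x : ℕ}
    (hx : x ≤ B + h.tick + 1) : Bounded B (h.put k i x) := by
  refine ⟨fun v => (hb.reg v).trans (Nat.le_succ _), fun k' i' => ?_⟩
  rw [St.put_arr]
  split
  · rw [Function.update_apply]
    split
    · exact hx
    · exact (hb.arr k i').trans (Nat.le_succ _)
  · exact (hb.arr k' i').trans (Nat.le_succ _)

theorem Steps.bounded [DecidableEq V] [DecidableEq A] {inp : ℕ → ℕ} {c : Prog V A} {h' : St V A}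
    (hst : Steps B inp c h h') (hinp : ∀ i, inp i ≤ B) (hb : Bounded B h) : Bounded B h' := by
  induction hst with
  | zero d h => exact hb.set _ (Nat.zero_le _)
  | move d a h => exact hb.set _ ((hb.reg a).trans (Nat.le_succ _))
  | inc d h => exact hb.set _ (Nat.succ_le_succ (hb.reg d))
  | add d a b h hab => exact hb.set _ (by omega)
  | input d a h => exact hb.set _ ((hinp _).trans (by omega))
  | load d k a h => exact hb.set _ ((hb.arr _ _).trans (Nat.le_succ _))
  | store k a b h => exact hb.put _ _ ((hb.reg _).trans (Nat.le_succ _))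
  | seq _ _ ih₁ ih₂ => exact ih₂ (ih₁ hb)
  | ite_true _ _ ih | ite_false _ _ ih => exact ih hb.tock
  | loop_done => exact hb.tock
  | loop_step _ _ _ ih₁ ih₂ => exact ih₂ (ih₁ hb.tock)

end Bounded

section Offset

variable [Fintype A] {w D : ℕ}

theorem offset_le (k : A) {i : ℕ} (hi : i ≤ D) : offset k i ≤ (D + 1) * Fintype.card A := by
  have := Nat.mul_le_mul_right (Fintype.card A) hi
  have := arrIdx_lt k
  rw [offset, Nat.succ_mul]
  omega

theorem offset_inj {k k' : A} {i i' : ℕ} (h : offset k i = offset k' i') : k = k' ∧ i = i' := by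
  have hpos : 0 < Fintype.card A := (Nat.zero_le _).trans_lt (arrIdx_lt k)
  have h' : arrIdx k + Fintype.card A * i = arrIdx k' + Fintype.card A * i' := by
    rw [offset, offset] at h
    linarith
  refine ⟨arrIdx_injective ?_, ?_⟩
  · simpa [Nat.add_mul_mod_self_left, Nat.mod_eq_of_lt, arrIdx_lt] using
      congrArg (· % Fintype.card A) h'
  · simpa [Nat.add_mul_div_left _ _ hpos, Nat.div_eq_of_lt, arrIdx_lt] using
      congrArg (· / Fintype.card A) h'

theorem addr_inj (hw : (D + 1) * (Fintype.card A + 1) ≤ 2 ^ w) {k k' : A} {i i' : ℕ} (hi : i ≤ D)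
    (hi' : i' ≤ D) (h : addr w k i = addr w k' i') : k = k' ∧ i = i' := by
  have := offset_le k hi
  have := offset_le k' hi'
  rw [Nat.mul_succ] at hw
  rw [addr, addr] at h
  exact offset_inj (by omega)

theorem lt_addr (hw : (D + 1) * (Fintype.card A + 1) ≤ 2 ^ w) (k : A) {i : ℕ} (hi : i ≤ D) :
    D < addr w k i := by
  have := offset_le k hi
  rw [Nat.mul_succ] at hw
  rw [addr]
  omega

end Offset

section Simulation

variable [Fintype V] [Fintype A] {w D B : ℕ} {inp : ℕ → ℕ} {h : St V A} {s : State}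

theorem Represents.tock (hs : Represents w D inp h s) : Represents w D inp h.tock s :=
  ⟨hs.reg, hs.arr, hs.inp⟩

theorem Represents.set [DecidableEq V] (hs : Represents w D inp h s) (d : V) (x : ℕ) :
    Represents w D inp (h.set d x) (s.setReg (regIdx d) x) := by
  refine ⟨fun v => ?_, hs.arr, hs.inp⟩
  simp only [State.setReg, Function.update_apply, St.set_reg, regIdx_injective.eq_iff, hs.reg]

theorem Represents.scratch (hs : Represents w D inp h s) {d : ℕ} (hd : Fintype.card V ≤ d)
    (x : ℕ) : Represents w D inp h (s.setReg d x) := by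
  refine ⟨fun v => ?_, hs.arr, hs.inp⟩
  simp only [State.setReg, Function.update_of_ne ((regIdx_lt v).trans_le hd).ne, hs.reg]

theorem Represents.put [DecidableEq A] (hw : (D + 1) * (Fintype.card A + 1) ≤ 2 ^ w)
    (hs : Represents w D inp h s) (k : A) {i : ℕ} (hi : i ≤ D) (x : ℕ) :
    Represents w D inp (h.put k i x) (s.setMem (addr w k i) x) := by
  refine ⟨hs.reg, fun k' i' hi' => ?_, fun i' hi' => ?_⟩
  · simp only [State.setMem, St.put_arr]
    by_cases hk : k' = k ∧ i' = i
    · rw [hk.1, hk.2, Function.update_self, if_pos rfl, Function.update_self]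
    · rw [Function.update_of_ne fun h => hk (addr_inj hw hi' hi h), hs.arr _ _ hi']
      split
      · next hk' => rw [Function.update_of_ne fun h => hk ⟨hk', h⟩, hk']
      · rfl
  · simp only [State.setMem, Function.update_of_ne (hi'.trans_lt (lt_addr hw k hi)).ne,
      hs.inp _ hi']

theorem Cond.compile_holds (hs : Represents w D inp h s) (b : Cond V) :
    b.compile.holds s ↔ b.holds h := by
  cases b <;> simp [Cond.compile, Cond.holds, Test.holds, hs.reg]

theorem exec_addrCmd (hw : (D + 1) * (Fintype.card A + 1) ≤ 2 ^ w)
    (hs : Represents w D inp h s) (k : A) (a : V) (ha : h.reg a ≤ D) :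
    ∃ s', Exec w (addrCmd k a) s s' 6 ∧ Represents w D inp h s' ∧
      s'.reg (Fintype.card V + 1) = addr w k (h.reg a) := by
  refine ⟨_, .seq (.const _ _ _) (.seq (.op _ _ _ _ _) (.seq (.const _ _ _) (.seq (.op _ _ _ _ _)
    (.seq (.const _ _ _) (.op _ _ _ _ _))))), ?_, ?_⟩
  · refine (((((hs.scratch ?_ _).scratch ?_ _).scratch ?_ _).scratch ?_ _).scratch ?_ _).scratch
      ?_ _ <;> omega
  · have hoff := offset_le k ha
    have hk := arrIdx_lt k
    have hle : Fintype.card A ≤ (D + 1) * Fintype.card A := Nat.le_mul_of_pos_left _ D.succ_pos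
    rw [Nat.mul_succ] at hw
    rw [offset] at hoff
    simp only [State.setReg, Function.update_apply, Op.eval, (regIdx_lt a).ne, if_true, if_false,
      Nat.succ_ne_self, (Nat.succ_ne_self _).symm, hs.reg, addr, offset]
    rw [Nat.mod_eq_of_lt (a := Fintype.card A) (by omega),
      Nat.mod_eq_of_lt (a := arrIdx k + 1) (by omega),
      Nat.mod_eq_of_lt (a := h.reg a * Fintype.card A) (by omega),
      Nat.mod_eq_of_lt (a := h.reg a * Fintype.card A + (arrIdx k + 1)) (by omega),
      Nat.zero_mod, zero_add]
    exact Nat.mod_eq_of_lt (by omega)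

/-- The compiled program turns every representation of `h` into one of `h'`, in at most seven
machine steps for each step of the array machine. -/
def SimulatedBy (w D : ℕ) (inp : ℕ → ℕ) (h h' : St V A) (c : Cmd) : Prop :=
  ∀ s, Represents w D inp h s → ∃ s' t, Exec w c s s' t ∧ Represents w D inp h' s' ∧
    t + 7 * h.tick ≤ 7 * h'.tick

theorem simulatedBy_inc [DecidableEq V] (d : V) (hd : h.reg d + 1 < 2 ^ w) :
    SimulatedBy w D inp h (h.set d (h.reg d + 1)) (Prog.inc (A := A) d).compile := by
  intro s hs
  refine ⟨_, _, .seq (.const _ _ _) (.op _ _ _ _ _), ?_, by simp only [St.set_tick]; omega⟩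
  have hs' := hs.scratch le_rfl (1 % 2 ^ w)
  convert hs'.set d _ using 2
  rw [hs'.reg]
  simp only [Op.eval, State.setReg, Function.update_self]
  rw [Nat.mod_eq_of_lt (a := 1) (by omega), Nat.mod_eq_of_lt hd]

theorem simulatedBy_add [DecidableEq V] (d a b : V) (hab : h.reg a + h.reg b < 2 ^ w) :
    SimulatedBy w D inp h (h.set d (h.reg a + h.reg b)) (Prog.add (A := A) d a b).compile := by
  intro s hs
  refine ⟨_, _, .op _ _ _ _ _, ?_, by simp only [St.set_tick]; omega⟩
  convert hs.set d _ using 2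
  rw [hs.reg, hs.reg, Op.eval, Nat.mod_eq_of_lt hab]

theorem simulatedBy_load [DecidableEq V]
    (hw : (D + 1) * (Fintype.card A + 1) ≤ 2 ^ w) (d : V) (k : A) (a : V)
    (ha : h.reg a ≤ D) :
    SimulatedBy w D inp h (h.set d (h.arr k (h.reg a))) (Prog.load d k a).compile := by
  intro s hs
  obtain ⟨s', e, hs', haddr⟩ := exec_addrCmd hw hs k a ha
  refine ⟨_, _, .seq e (.load _ _ _), ?_, by simp only [St.set_tick]; omega⟩
  convert hs'.set d _ using 2
  rw [haddr, hs'.arr _ _ ha]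

theorem simulatedBy_store [DecidableEq A]
    (hw : (D + 1) * (Fintype.card A + 1) ≤ 2 ^ w) (k : A) (a b : V)
    (ha : h.reg a ≤ D) :
    SimulatedBy w D inp h (h.put k (h.reg a) (h.reg b)) (Prog.store k a b).compile := by
  intro s hs
  obtain ⟨s', e, hs', haddr⟩ := exec_addrCmd hw hs k a ha
  refine ⟨_, _, .seq e (.store _ _ _), ?_, by simp only [St.put_tick]; omega⟩
  rw [haddr, hs'.reg]
  exact hs'.put hw _ ha _

theorem SimulatedBy.seq {h₁ h₂ : St V A} {c₁ c₂ : Cmd} (hc₁ : SimulatedBy w D inp h h₁ c₁)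
    (hc₂ : SimulatedBy w D inp h₁ h₂ c₂) : SimulatedBy w D inp h h₂ (.seq c₁ c₂) := by
  intro s hs
  obtain ⟨s₁, t₁, e₁, hs₁, l₁⟩ := hc₁ s hs
  obtain ⟨s₂, t₂, e₂, hs₂, l₂⟩ := hc₂ s₁ hs₁
  exact ⟨s₂, _, .seq e₁ e₂, hs₂, by omega⟩

theorem SimulatedBy.ite_true {h₁ : St V A} {b : Cond V} {c₁ : Cmd} (hb : b.holds h)
    (hc₁ : SimulatedBy w D inp h.tock h₁ c₁) (c₂ : Cmd) :
    SimulatedBy w D inp h h₁ (.ite b.compile c₁ c₂) := by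
  intro s hs
  obtain ⟨s₁, t₁, e₁, hs₁, l₁⟩ := hc₁ s hs.tock
  exact ⟨s₁, _, .ite_true ((b.compile_holds hs).2 hb) e₁, hs₁, by rw [St.tock_tick] at l₁; omega⟩

theorem SimulatedBy.ite_false {h₁ : St V A} {b : Cond V} {c₂ : Cmd} (hb : ¬ b.holds h) (c₁ : Cmd)
    (hc₂ : SimulatedBy w D inp h.tock h₁ c₂) :
    SimulatedBy w D inp h h₁ (.ite b.compile c₁ c₂) := by
  intro s hs
  obtain ⟨s₁, t₁, e₁, hs₁, l₁⟩ := hc₂ s hs.tock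
  exact ⟨s₁, _, .ite_false (mt (b.compile_holds hs).1 hb) e₁, hs₁,
    by rw [St.tock_tick] at l₁; omega⟩

theorem SimulatedBy.loop_done {b : Cond V} (hb : ¬ b.holds h) (c : Cmd) :
    SimulatedBy w D inp h h.tock (.loop b.compile c) := fun s hs =>
  ⟨s, _, .loop_done (mt (b.compile_holds hs).1 hb), hs.tock, by rw [St.tock_tick]; omega⟩

theorem SimulatedBy.loop_step {h₁ h₂ : St V A} {b : Cond V} {c : Cmd} (hb : b.holds h)
    (hc : SimulatedBy w D inp h.tock h₁ c)
    (hl : SimulatedBy w D inp h₁ h₂ (.loop b.compile c)) :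
    SimulatedBy w D inp h h₂ (.loop b.compile c) := by
  intro s hs
  obtain ⟨s₁, t₁, e₁, hs₁, l₁⟩ := hc s hs.tock
  obtain ⟨s₂, t₂, e₂, hs₂, l₂⟩ := hl s₁ hs₁
  exact ⟨s₂, _, .loop_step ((b.compile_holds hs).2 hb) e₁ e₂, hs₂,
    by rw [St.tock_tick] at l₁; omega⟩

variable [DecidableEq V] [DecidableEq A]

theorem Steps.simulatedBy_compile {T : ℕ} {c : Prog V A} {h' : St V A} (hst : Steps B inp c h h')
    (hinp : ∀ i, inp i ≤ B) (hT : h'.tick ≤ T)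
    (hw : (B + T + 1) * (Fintype.card A + 1) ≤ 2 ^ w) (hb : Bounded B h) :
    SimulatedBy w (B + T) inp h h' c.compile := by
  have hBT : B + T < 2 ^ w := (Nat.le_mul_of_pos_right _ (Nat.succ_pos _)).trans hw
  have address_le {h : St V A} {d : V} (hb : Bounded B h) (ht : h.tick + 1 ≤ T) :
      h.reg d + 1 ≤ B + T :=
    (Nat.succ_le_succ (hb.reg d)).trans (by omega)
  induction hst with
  | zero d h =>
    intro s hs
    refine ⟨_, _, .const _ _ _, ?_, by simp only [St.set_tick]; omega⟩
    rw [Nat.zero_mod]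
    exact hs.set _ _
  | move d a h =>
    intro s hs
    refine ⟨_, _, .move _ _ _, ?_, by simp only [St.set_tick]; omega⟩
    rw [hs.reg]
    exact hs.set _ _
  | inc d h => exact simulatedBy_inc d ((address_le hb hT).trans_lt hBT)
  | add d a b h hab => exact simulatedBy_add d a b (by omega)
  | input d a h =>
    intro s hs
    refine ⟨_, _, .load _ _ _, ?_, by simp only [St.set_tick]; omega⟩
    convert hs.set d _ using 2
    rw [hs.reg, hs.inp _ (Nat.le_of_succ_le (address_le hb hT))]
  | load d k a h => exact simulatedBy_load hw d k a (Nat.le_of_succ_le (address_le hb hT))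
  | store k a b h => exact simulatedBy_store hw k a b (Nat.le_of_succ_le (address_le hb hT))
  | seq h₁ h₂ ih₁ ih₂ =>
    exact (ih₁ (h₂.tick_le.trans hT) hb).seq (ih₂ hT (h₁.bounded hinp hb))
  | ite_true hc _ ih => exact .ite_true hc (ih hT hb.tock) _
  | ite_false hc _ ih => exact .ite_false hc _ (ih hT hb.tock)
  | loop_done hc => exact .loop_done hc _
  | loop_step hc h₁ h₂ ih₁ ih₂ =>
    exact .loop_step hc (ih₁ (h₂.tick_le.trans hT) hb.tock) (ih₂ hT (h₁.bounded hinp hb.tock))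

theorem decidesWithin_compile {T : ℕ} {c : Prog V A} {r : V} {input : List ℕ} {P : Prop}
    (hrun : Runs B (input.getD · 0) c .init fun h =>
      h.tick ≤ T ∧ (P → h.reg r = 1) ∧ (¬ P → h.reg r = 0))
    (hinput : ∀ x ∈ input, x ≤ B) (hlen : input.length ≤ B + T)
    (hw : (B + T + 1) * (Fintype.card A + 1) ≤ 2 ^ w) :
    Cmd.DecidesWithin (.seq c.compile (.move 0 (regIdx r))) w input P (7 * T + 1) := by
  have hBT : B + T < 2 ^ w := (Nat.le_mul_of_pos_right _ (Nat.succ_pos _)).trans hw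
  have hinp (i : ℕ) : input.getD i 0 ≤ B := by
    rcases lt_or_ge i input.length with hi | hi
    · rw [List.getD_eq_getElem _ _ hi]
      exact hinput _ (List.getElem_mem hi)
    · rw [List.getD_eq_default _ _ hi]
      exact B.zero_le
  have hinit : Represents w (B + T) (input.getD · 0) (.init : St V A) (State.init w input) := by
    refine ⟨fun _ => rfl, fun k i hi => ?_, fun i _ => Nat.mod_eq_of_lt (by have := hinp i; omega)⟩
    simp only [State.init, St.init, List.getD_eq_default _ _ (hlen.trans (lt_addr hw k hi).le),
      Nat.zero_mod]
  obtain ⟨h, hsteps, hT, hP, hnP⟩ := hrun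
  obtain ⟨s, t, hexec, hs, ht⟩ := hsteps.simulatedBy_compile hinp hT hw
    ⟨fun _ => Nat.zero_le _, fun _ _ => Nat.zero_le _⟩ _ hinit
  have hres : (s.setReg 0 (s.reg (regIdx r))).reg 0 = h.reg r := by
    simp only [State.setReg, Function.update_self, hs.reg]
  exact ⟨_, _, .seq hexec (.move _ _ _), by omega, fun h' => hres.trans (hP h'),
    fun h' => hres.trans (hnP h')⟩

end Simulation

end Compile

/-! ### Merging equivalent states -/

/-- The idea of Hopcroft and Karp: `r` need not be a bisimulation, it suffices that its steps stay
in the equivalence relation that it generates. -/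
theorem evalFrom_mem_accept_iff_of_eqvGen {α S : Type*} {M : DFA α S} {r : S → S → Prop}
    (hacc : ∀ x y, r x y → (x ∈ M.accept ↔ y ∈ M.accept))
    (hstep : ∀ x y, r x y → ∀ a, Relation.EqvGen r (M.step x a) (M.step y a)) {x y : S}
    (h : Relation.EqvGen r x y) (w : List α) :
    M.evalFrom x w ∈ M.accept ↔ M.evalFrom y w ∈ M.accept := by
  have hstep' : ∀ {x y}, Relation.EqvGen r x y → ∀ a,
      Relation.EqvGen r (M.step x a) (M.step y a) := by
    intro x y h a
    induction h with
    | rel _ _ h => exact hstep _ _ h a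
    | refl => exact .refl _
    | symm _ _ _ ih => exact .symm _ _ ih
    | trans _ _ _ _ _ ih₁ ih₂ => exact .trans _ _ _ ih₁ ih₂
  induction w generalizing x y with
  | nil =>
    induction h with
    | rel _ _ h => exact hacc _ _ h
    | refl => rfl
    | symm _ _ _ ih => exact ih.symm
    | trans _ _ _ _ _ ih₁ ih₂ => exact ih₁.trans ih₂
  | cons a _ ih => exact ih (hstep' h a)

/-! ### Binary tries -/

open Classical in
/-- The characteristic sequence of `S` on `0, …, n - 1`, last element first. -/
noncomputable def bits (n : ℕ) (S : Set ℕ) : List Bool :=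
  ((List.range n).map fun j => decide (j ∈ S)).reverse

theorem bits_zero (S : Set ℕ) : bits 0 S = [] := rfl

theorem bits_succ {n : ℕ} {S : Set ℕ} {b : Bool} (hb : b ↔ n ∈ S) :
    bits (n + 1) S = b :: bits n S := by
  simp [bits, List.range_succ, ← hb]

theorem bits_eq_bits_iff {n : ℕ} {S T : Set ℕ} :
    bits n S = bits n T ↔ ∀ j < n, (j ∈ S ↔ j ∈ T) := by
  simp [bits, List.map_inj_left]

theorem eq_of_bits_eq {n : ℕ} {S T : Set ℕ} (h : bits n S = bits n T) (hS : S ⊆ Set.Iio n)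
    (hT : T ⊆ Set.Iio n) : S = T :=
  Set.ext fun j => ⟨fun hj => (bits_eq_bits_iff.1 h j (hS hj)).1 hj,
    fun hj => (bits_eq_bits_iff.1 h j (hT hj)).2 hj⟩

/-- The sequence `l`, last element first, leads from the root `0` to `t` in the trie in which
`child b u` is the child of `u` along `b`, and is `0` if there is none. -/
def IsPath (child : Bool → ℕ → ℕ) : List Bool → ℕ → Prop
  | [], t => t = 0
  | b :: l, t => ∃ u, IsPath child l u ∧ child b u = t ∧ t ≠ 0

/-- `child` is a trie whose nodes are smaller than `fresh`. -/
structure Trie (fresh : ℕ) (child : Bool → ℕ → ℕ) : Prop where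
  fresh_pos : 0 < fresh
  lt_fresh : ∀ b t, child b t ≠ 0 → t < fresh ∧ child b t < fresh
  child_inj : ∀ b t b' t', child b t = child b' t' → child b t ≠ 0 → b = b' ∧ t = t'

section Trie

variable {child child' : Bool → ℕ → ℕ} {l l' : List Bool} {fresh t t' : ℕ}

theorem IsPath.unique (h : IsPath child l t) (h' : IsPath child l t') : t = t' := by
  induction l generalizing t t' with
  | nil => exact h.trans h'.symm
  | cons b l ih =>
    obtain ⟨u, hu, rfl, -⟩ := h
    obtain ⟨u', hu', rfl, -⟩ := h'
    rw [ih hu hu']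

theorem IsPath.mono (hc : ∀ b t, child b t ≠ 0 → child' b t = child b t) (h : IsPath child l t) :
    IsPath child' l t := by
  induction l generalizing t with
  | nil => exact h
  | cons b l ih =>
    obtain ⟨u, hu, rfl, h0⟩ := h
    exact ⟨u, ih hu, hc b u h0, h0⟩

theorem IsPath.lt_fresh (h : IsPath child l t) (hT : Trie fresh child) : t < fresh := by
  cases l with
  | nil => exact lt_of_eq_of_lt h hT.fresh_pos
  | cons b l =>
    obtain ⟨u, -, rfl, h0⟩ := h
    exact (hT.lt_fresh b u h0).2

theorem Trie.path_unique (hT : Trie fresh child) (h : IsPath child l t)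
    (h' : IsPath child l' t) : l = l' := by
  induction l generalizing l' t with
  | nil =>
    cases l' with
    | nil => rfl
    | cons b l' =>
      obtain ⟨-, -, -, h0⟩ := h'
      exact absurd h h0
  | cons b l ih =>
    cases l' with
    | nil =>
      obtain ⟨-, -, -, h0⟩ := h
      exact absurd h' h0
    | cons b' l' =>
      obtain ⟨u, hu, rfl, h0⟩ := h
      obtain ⟨u', hu', hc, -⟩ := h'
      obtain ⟨rfl, rfl⟩ := hT.child_inj _ _ _ _ hc.symm h0
      rw [ih hu hu']

/-- The trie `child` with a new node `fresh` below `t`. -/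
def addChild (child : Bool → ℕ → ℕ) (fresh : ℕ) (b : Bool) (t : ℕ) : Bool → ℕ → ℕ :=
  Function.update child b (Function.update (child b) t fresh)

theorem addChild_apply (child : Bool → ℕ → ℕ) (fresh : ℕ) (b : Bool) (t : ℕ) (b' : Bool) (t' : ℕ) :
    addChild child fresh b t b' t' = if b' = b ∧ t' = t then fresh else child b' t' := by
  by_cases hb : b' = b
  · subst hb
    simp [addChild, Function.update_apply]
  · simp [addChild, hb]

theorem addChild_of_ne_zero {b : Bool} (h0 : child b t = 0) (b' : Bool) (t' : ℕ)
    (h : child b' t' ≠ 0) : addChild child fresh b t b' t' = child b' t' := by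
  rw [addChild_apply, if_neg]
  rintro ⟨rfl, rfl⟩
  exact h h0

theorem Trie.addChild (hT : Trie fresh child) (b : Bool) (ht : t < fresh) :
    Trie (fresh + 1) (addChild child fresh b t) := by
  refine ⟨fresh.succ_pos, fun b' t' => ?_, fun b₁ t₁ b₂ t₂ => ?_⟩
  · rw [addChild_apply]
    split_ifs with h
    · exact fun _ => ⟨by omega, by omega⟩
    · intro h0
      have := hT.lt_fresh _ _ h0
      omega
  · have lt_fresh (b' t') (h0 : child b' t' ≠ 0) : child b' t' < fresh := (hT.lt_fresh b' t' h0).2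
    rw [addChild_apply, addChild_apply]
    split_ifs with h₁ h₂ h₂
    · exact fun _ _ => ⟨h₁.1.trans h₂.1.symm, h₁.2.trans h₂.2.symm⟩
    · intro h h0
      exact absurd (lt_fresh b₂ t₂ (h ▸ h0)) h.symm.not_lt
    · intro h h0
      exact absurd (lt_fresh b₁ t₁ h0) h.not_lt
    · exact hT.child_inj _ _ _ _

end Trie

/-! ### Union-find forests -/

/-- The nodes among `1, …, cnt` without parent; `0` stands for the missing parent. -/
def roots (cnt : ℕ) (par : ℕ → ℕ) : Finset ℕ := {x ∈ Finset.Icc 1 cnt | par x = 0}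

theorem mem_roots {cnt x : ℕ} {par : ℕ → ℕ} :
    x ∈ roots cnt par ↔ x ∈ Set.Icc 1 cnt ∧ par x = 0 := by
  simp [roots]

/-- A forest with union by size on the nodes `1, …, cnt`, made from single nodes by `links` unions.
The parent of a root is `0`, all other parents are related by `r`; `wt x` is the number of nodes
below `x` (it is frozen once `x` is no longer a root). -/
structure Forest (r : ℕ → ℕ → Prop) (cnt links : ℕ) (par wt : ℕ → ℕ) : Prop where
  mem : ∀ x, par x ≠ 0 → x ∈ Set.Icc 1 cnt ∧ par x ∈ Set.Icc 1 cnt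
  rel : ∀ x, par x ≠ 0 → r x (par x)
  two_mul_le : ∀ x, par x ≠ 0 → 2 * wt x ≤ wt (par x)
  wt_mem : ∀ x ∈ Set.Icc 1 cnt, wt x ∈ Set.Icc 1 cnt
  sum_roots : ∑ x ∈ roots cnt par, wt x = cnt
  card_roots : links + (roots cnt par).card = cnt

namespace Forest

variable {r r' : ℕ → ℕ → Prop} {cnt links : ℕ} {par wt : ℕ → ℕ}

theorem empty : Forest r 0 0 (fun _ => 0) wt :=
  ⟨by simp, by simp, by simp, by simp, by simp [roots], by simp [roots]⟩

theorem mono (h : Forest r cnt links par wt)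
    (hr : ∀ x ∈ Set.Icc 1 cnt, ∀ y ∈ Set.Icc 1 cnt, r x y → r' x y) :
    Forest r' cnt links par wt :=
  { h with rel := fun x hx => hr _ (h.mem x hx).1 _ (h.mem x hx).2 (h.rel x hx) }

theorem roots_succ (h : Forest r cnt links par wt) :
    roots (cnt + 1) par = insert (cnt + 1) (roots cnt par) := by
  have h0 : par (cnt + 1) = 0 := by
    by_contra h0
    exact (Nat.lt_succ_self cnt).not_ge (h.mem _ h0).1.2
  rw [roots, ← Finset.insert_Icc_right_eq_Icc_add_one (by omega), Finset.filter_insert, if_pos h0,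
    roots]

theorem notMem_roots_succ : cnt + 1 ∉ roots cnt par := by simp [roots]

theorem push (h : Forest r cnt links par wt) :
    Forest r (cnt + 1) links par (Function.update wt (cnt + 1) 1) := by
  have hwt : ∀ {x}, x ∈ Set.Icc 1 cnt → Function.update wt (cnt + 1) 1 x = wt x := fun hx =>
    Function.update_of_ne (Nat.lt_succ_of_le hx.2).ne _ _
  have hsub : Set.Icc 1 cnt ⊆ Set.Icc 1 (cnt + 1) := Set.Icc_subset_Icc_right (Nat.le_succ _)
  refine ⟨fun x hx => (h.mem x hx).imp (@hsub _) (@hsub _), h.rel, fun x hx => ?_, fun x hx => ?_,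
    ?_, ?_⟩
  · obtain ⟨hx', hpx⟩ := h.mem x hx
    rw [hwt hx', hwt hpx]
    exact h.two_mul_le x hx
  · rcases eq_or_ne x (cnt + 1) with rfl | hne
    · rw [Function.update_self]
      exact ⟨le_rfl, by omega⟩
    · have hx' : x ∈ Set.Icc 1 cnt := ⟨hx.1, by have := hx.2; omega⟩
      rw [hwt hx']
      exact hsub (h.wt_mem x hx')
  · rw [h.roots_succ, Finset.sum_insert notMem_roots_succ, Function.update_self,
      Finset.sum_congr rfl fun x hx => hwt (mem_roots.1 hx).1, h.sum_roots, add_comm]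
  · rw [h.roots_succ, Finset.card_insert_of_notMem notMem_roots_succ, ← add_assoc, h.card_roots]

variable {x y : ℕ}

theorem roots_link (hx : x ∈ roots cnt par) (hy : y ≠ 0) :
    roots cnt (Function.update par x y) = (roots cnt par).erase x := by
  ext z
  rcases eq_or_ne z x with rfl | hz
  · simp [mem_roots, hy]
  · simp [mem_roots, hz]

theorem wt_add_wt_le (h : Forest r cnt links par wt) (hx : x ∈ roots cnt par)
    (hy : y ∈ roots cnt par) (hxy : x ≠ y) : wt x + wt y ≤ cnt := by
  calc wt x + wt y = ∑ z ∈ {x, y}, wt z := (Finset.sum_pair hxy).symm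
    _ ≤ ∑ z ∈ roots cnt par, wt z :=
      Finset.sum_le_sum_of_subset (by simp [Finset.insert_subset_iff, hx, hy])
    _ = cnt := h.sum_roots

theorem link (h : Forest r cnt links par wt) (hx : x ∈ roots cnt par) (hy : y ∈ roots cnt par)
    (hxy : x ≠ y) (hwt : wt x ≤ wt y) (hr : r x y) :
    Forest r cnt (links + 1) (Function.update par x y)
      (Function.update wt y (wt x + wt y)) := by
  obtain ⟨hx', -⟩ := mem_roots.1 hx
  obtain ⟨hy', hpy⟩ := mem_roots.1 hy
  have hle := h.wt_add_wt_le hx hy hxy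
  have hy0 : y ≠ 0 := (Nat.lt_of_lt_of_le Nat.one_pos hy'.1).ne'
  have hy_erase : y ∈ (roots cnt par).erase x := Finset.mem_erase.2 ⟨hxy.symm, hy⟩
  refine ⟨fun z hz => ?_, fun z hz => ?_, fun z hz => ?_, fun z hz => ?_, ?_, ?_⟩
  · rcases eq_or_ne z x with rfl | hne
    · rw [Function.update_self]
      exact ⟨hx', hy'⟩
    · rw [Function.update_of_ne hne] at hz ⊢
      exact h.mem z hz
  · rcases eq_or_ne z x with rfl | hne
    · rwa [Function.update_self]
    · rw [Function.update_of_ne hne] at hz ⊢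
      exact h.rel z hz
  · rcases eq_or_ne z x with rfl | hne
    · rw [Function.update_self, Function.update_self, Function.update_of_ne hxy]
      omega
    · rw [Function.update_of_ne hne] at hz ⊢
      have hzy : z ≠ y := fun h => hz (h ▸ hpy)
      have := h.two_mul_le z hz
      rw [Function.update_of_ne hzy, Function.update_apply]
      split_ifs with hpz
      · rw [hpz] at this
        omega
      · exact this
  · have := h.wt_mem z hz
    rw [Function.update_apply]
    split_ifs
    · exact ⟨(h.wt_mem y hy').1.trans (Nat.le_add_left _ _), hle⟩
    · exact this
  · have hsum := Finset.add_sum_erase _ wt hx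
    rw [h.sum_roots, ← Finset.add_sum_erase _ _ hy_erase] at hsum
    rw [roots_link hx hy0, ← Finset.add_sum_erase _ _ hy_erase, Function.update_self,
      Finset.sum_congr rfl fun z hz => Function.update_of_ne (Finset.ne_of_mem_erase hz) _ _]
    omega
  · have := h.card_roots
    have := Finset.card_erase_add_one hx
    rw [roots_link hx hy0]
    omega

end Forest

end ArrayLang

namespace EquivProg

open ArrayLang

/-! ### The program -/

/-- The registers of the program. Those that depend on a Boolean exist for both automata. -/
inductive Var where
  | result | zero | one | alphabet | numStates | numEdges
  | start (b : Bool) | inputPtr | size | edgeCount | finalCount | index | source | target | label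
  | pos | bit | trie | child | fresh | top | numNodes
  | edge | letter | rowPtr | head | tail | differ
  | node (b : Bool) | flag (b : Bool) | root (b : Bool) | weight (b : Bool) | up | total | unused
  deriving DecidableEq, Fintype

/-- The arrays of the program. -/
inductive Arr where
  | source | target | label | final
  | next | child (b : Bool) | leaf | rowStart | row
  | parent | weight | queue (b : Bool)
  deriving DecidableEq, Fintype

/-- States of the array machine with the registers and arrays of the equivalence test. -/
abbrev State := St Var Arr

/-- Programs over the registers and arrays of the equivalence test. -/
abbrev Prog := ArrayLang.Prog Var Arr

open ArrayLang.Prog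

/-- Does nothing but write to a register that is never read. -/
def skip : Prog := .zero .unused

/-- Moves from the trie node `trie` to its child `b`, which is created if it is missing. -/
def descendInto (b : Bool) : Prog :=
  .load .child (.child b) .trie ;;
  .ite (.eq .child .zero)
    (.move .child .fresh ;; .store (.child b) .trie .child ;; .inc .fresh)
    skip ;;
  .move .trie .child

/-- Moves to the child of the node `trie` that is selected by bit `pos` of the set in `next`. -/
def descend : Prog :=
  .load .bit .next .pos ;; .ite (.eq .bit .zero) (descendInto false) (descendInto true)

/-- Appends bit `pos` of the set in `next` to the rows of bits in `row`. -/
def copyBit : Prog := .load .bit .next .pos ;; .store .row .top .bit ;; .inc .top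

/-- Creates a node for the set in `next`, as a one-element tree of the union-find forest, and labels
the current leaf of the trie by it. -/
def newNode (b : Bool) : Prog :=
  .inc .numNodes ;; .move (.node b) .numNodes ;; .store .leaf .trie (.node b) ;;
  .store .rowStart (.node b) .top ;; .store .weight (.node b) .one ;;
  .for .pos .numStates copyBit

/-- Walks down the trie along the bits of the set in `next`. -/
def walk : Prog := .zero .trie ;; .for .pos .numStates descend

/-- Sets `node b` to the unique node for the set in `next`. -/
def intern (b : Bool) : Prog :=
  walk ;; .load (.node b) .leaf .trie ;;
  .ite (.eq (.node b) .zero) (newNode b) skip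

/-- Raises `flag b` if the state `pos` is final and belongs to the set in `next`. -/
def checkState (b : Bool) : Prog :=
  .load .bit .next .pos ;;
  .ite (.eq .bit .zero) skip
    (.load .bit .final .pos ;; .ite (.eq .bit .zero) skip (.move (.flag b) .one))

/-- Sets `flag b` to whether the set in `next` contains a final state. -/
def checkAccept (b : Bool) : Prog :=
  .zero (.flag b) ;; .for .pos .numStates (checkState b)

/-- Adds the target of `edge` to `next` if its label is `letter` and its source belongs to the set
whose row of bits starts at `rowPtr`. -/
def followEdge : Prog :=
  .load .label .label .edge ;;
  .ite (.eq .label .letter)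
    (.load .source .source .edge ;; .add .source .rowPtr .source ;; .load .bit .row .source ;;
      .ite (.eq .bit .zero) skip (.load .target .target .edge ;; .store .next .target .one))
    skip

/-- Sets `next` to the successor under `letter` of the set of the node `index`. -/
def expand : Prog :=
  .load .rowPtr .rowStart .index ;; .for .pos .numStates (.store .next .pos .zero) ;;
  .for .edge .numEdges followEdge

/-- Sets `root b` to the root of the tree of `node b`; roots have parent `0`. -/
def findRoot (b : Bool) : Prog :=
  .move (.root b) (.node b) ;; .load .up .parent (.root b) ;;
  .loop (.lt .zero .up) (.move (.root b) .up ;; .load .up .parent (.root b))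

/-- Finds the roots of both nodes. -/
def findRoots : Prog := findRoot false ;; findRoot true

/-- Records a difference between the two flags. -/
def compareFlags : Prog :=
  .ite (.eq (.flag false) (.flag true)) skip (.move .differ .one)

/-- Hangs the tree of `root b` below the other root. -/
def link (b : Bool) : Prog :=
  .store .parent (.root b) (.root !b) ;; .store .weight (.root !b) .total

/-- Appends the pair of current nodes to the queue. -/
def enqueue : Prog :=
  .store (.queue false) .tail (.node false) ;; .store (.queue true) .tail (.node true) ;; .inc .tail

/-- Unites the trees of the two roots, the lighter one below the heavier one. -/
def join : Prog :=
  .load (.weight false) .weight (.root false) ;; .load (.weight true) .weight (.root true) ;;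
  .add .total (.weight false) (.weight true) ;;
  .ite (.lt (.weight false) (.weight true)) (link false) (link true)

/-- Processes the pair of current nodes: compares acceptance and, if they are not yet in the same
class, enqueues the pair and unites their classes. -/
def merge : Prog :=
  compareFlags ;; findRoots ;;
  .ite (.eq (.root false) (.root true)) skip (enqueue ;; join)

/-- Finds the node of the set in `next` and whether that set is accepting. -/
def record (b : Bool) : Prog := intern b ;; checkAccept b

/-- Records the successor under `letter` of component `b` of the first pair in the queue. -/
def successor (b : Bool) : Prog := .load .index (.queue b) .head ;; expand ;; record b

/-- Merges the two successors under `letter` of the first pair in the queue. -/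
def mergeSuccessors : Prog := successor false ;; successor true ;; merge

/-- Records the singleton of the initial state of the automaton `b`, leaving `next` empty. -/
def seed (b : Bool) : Prog :=
  .store .next (.start b) .one ;; record b ;; .store .next (.start b) .zero

/-- Processes the queue, merging the successors of each pair under all letters. -/
def explore : Prog :=
  .loop (.lt .head .tail) (.for .letter .alphabet mergeSuccessors ;; .inc .head)

/-- Records both initial states. The first `inc` makes the root of the trie, `0`, different from all
nodes created later, so that `0` can stand for a missing child. -/
def seeds : Prog := .inc .fresh ;; seed false ;; seed true

/-- The equivalence test for automata whose edges and final states have been read. -/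
def equivalence : Prog :=
  seeds ;; merge ;; explore ;;
  .ite (.eq .differ .zero) (.move .result .one) (.zero .result)

/-- Reads the next number of the input. -/
def readNext (d : Var) : Prog := .input d .inputPtr ;; .inc .inputPtr

/-- Reads a state, shifted by the number of states of the automata read before. -/
def readState (d : Var) : Prog := readNext d ;; .add d .numStates d

/-- Appends the next edge of the input to the table of edges. -/
def readEdge : Prog :=
  readState .source ;; .store .source .numEdges .source ;;
  readState .target ;; .store .target .numEdges .target ;;
  readNext .label ;; .store .label .numEdges .label ;; .inc .numEdges

/-- Marks the next state of the input as final. -/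
def readFinal : Prog := readState .target ;; .store .final .target .one

/-- Reads the list of edges, preceded by its length. -/
def readEdges : Prog := readNext .edgeCount ;; .for .index .edgeCount readEdge

/-- Reads the list of final states, preceded by its length. -/
def readFinals : Prog := readNext .finalCount ;; .for .index .finalCount readFinal

/-- Reads the automaton `b` and adds its states to those read before. -/
def readAutomaton (b : Bool) : Prog :=
  readNext .size ;; readState (.start b) ;; readEdges ;; readFinals ;;
  .add .numStates .numStates .size

/-- Reads the alphabet size and the disjoint union of the two automata. -/
def readInput : Prog := .inc .one ;; readNext .alphabet ;; readAutomaton false ;; readAutomaton true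

/-- The complete program: the equivalence test of Hopcroft and Karp on the determinization of the
disjoint union of the two automata, constructed on the fly. -/
def nfaEquivalence : Prog := readInput ;; equivalence

/-! ### Interning sets of states -/

/-- The set of automaton states stored in the array `next`. -/
def bufferSet (n : ℕ) (s : State) : Set ℕ := {j | j < n ∧ s.arr .next j ≠ 0}

/-- The set of automaton states that the node `x` stands for. -/
def nodeSet (n : ℕ) (s : State) (x : ℕ) : Set ℕ :=
  {j | j < n ∧ s.arr .row (s.arr .rowStart x + j) ≠ 0}

/-- The nodes created so far; `0` stands for no node. -/
def nodes (s : State) : Set ℕ := Set.Icc 1 (s.reg .numNodes)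

/-- The child relation of the trie; the value `0` means that there is no child. -/
def children (s : State) (b : Bool) : ℕ → ℕ := s.arr (.child b)

@[simp] theorem children_tock (s : State) : children s.tock = children s := rfl

@[simp] theorem children_set (s : State) (d x) : children (s.set d x) = children s := rfl

theorem children_put (s : State) (b : Bool) (t x : ℕ) :
    children (s.put (.child b) t x) = addChild (children s) x b t := by
  funext b'
  simp only [children, St.put_arr, addChild, Function.update_apply, Arr.child.injEq]

/-- The nodes are stored in a trie, whose leaves are labelled by nodes, according to the sets of
automaton states that they stand for; in particular different nodes stand for different sets. -/
structure Dictionary (n : ℕ) (s : State) : Prop where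
  trie : Trie (s.reg .fresh) (children s)
  leaf : ∀ t, s.arr .leaf t ≠ 0 →
    s.arr .leaf t ∈ nodes s ∧ IsPath (children s) (bits n (nodeSet n s (s.arr .leaf t))) t
  exists_leaf : ∀ x ∈ nodes s, ∃ t, s.arr .leaf t = x
  row_le : ∀ x ∈ nodes s, s.arr .rowStart x + n ≤ s.reg .top
  top_eq : s.reg .top = s.reg .numNodes * n

theorem nodeSet_subset (n : ℕ) (s : State) (x : ℕ) : nodeSet n s x ⊆ Set.Iio n := fun _ h => h.1

theorem Dictionary.injOn {n : ℕ} {s : State} (h : Dictionary n s) :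
    Set.InjOn (nodeSet n s) (nodes s) := by
  intro x hx y hy hxy
  obtain ⟨t, rfl⟩ := h.exists_leaf x hx
  obtain ⟨t', rfl⟩ := h.exists_leaf y hy
  have path := (h.leaf t (Nat.one_le_iff_ne_zero.1 hx.1)).2
  have path' := (h.leaf t' (Nat.one_le_iff_ne_zero.1 hy.1)).2
  rw [← hxy] at path'
  rw [path.unique path']

section Dictionary

variable {n : ℕ} {s s' : State}

theorem Dictionary.of_trie (h : Dictionary n s) (hT : Trie (s'.reg .fresh) (children s'))
    (hext : ∀ b t, children s b t ≠ 0 → children s' b t = children s b t)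
    (hreg : ∀ v ∈ [Var.numNodes, .top], s'.reg v = s.reg v)
    (harr : ∀ k ∈ [Arr.leaf, .rowStart, .row], s'.arr k = s.arr k) : Dictionary n s' := by
  simp only [List.forall_mem_cons, List.not_mem_nil, false_implies, implies_true, and_true]
    at hreg harr
  obtain ⟨hcnt, htop⟩ := hreg
  obtain ⟨hleaf, hstart, hrow⟩ := harr
  have hnodes : nodes s' = nodes s := by rw [nodes, nodes, hcnt]
  have hset : nodeSet n s' = nodeSet n s := by
    funext x
    rw [nodeSet, nodeSet, hstart, hrow]
  refine ⟨hT, fun t ht => ?_, ?_, ?_, ?_⟩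
  · rw [hleaf] at ht ⊢
    rw [hnodes, hset]
    exact (h.leaf t ht).imp_right (·.mono hext)
  · simpa only [hnodes, hleaf] using h.exists_leaf
  · simpa only [hnodes, hstart, htop] using h.row_le
  · rw [htop, hcnt, h.top_eq]

theorem Dictionary.congr (h : Dictionary n s)
    (hreg : ∀ v ∈ [Var.fresh, .numNodes, .top], s'.reg v = s.reg v)
    (harr : ∀ k ∈ [Arr.child false, .child true, .leaf, .rowStart, .row], s'.arr k = s.arr k) :
    Dictionary n s' := by
  have hchildren : children s' = children s := funext fun b => harr _ (by cases b <;> decide)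
  refine h.of_trie ?_ (fun b t _ => by rw [hchildren]) (fun v hv => hreg v (by simp_all))
    fun k hk => harr k (by simp_all)
  rw [hchildren, hreg _ (by decide)]
  exact h.trie

variable {T : Set ℕ} {t x : ℕ}

theorem Dictionary.nodeSet_push (h : Dictionary n s) (hx : x = s.reg .numNodes + 1)
    (hT : T ⊆ Set.Iio n)
    (hstart : s'.arr .rowStart = Function.update (s.arr .rowStart) x (s.reg .top))
    (hnew : ∀ j < n, (s'.arr .row (s.reg .top + j) ≠ 0 ↔ j ∈ T))
    (hold : ∀ i < s.reg .top, s'.arr .row i = s.arr .row i) :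
    nodeSet n s' x = T ∧ ∀ y ∈ nodes s, nodeSet n s' y = nodeSet n s y := by
  refine ⟨Set.ext fun j => ?_, fun y hy => Set.ext fun j => ?_⟩
  · simp only [nodeSet, hstart, Function.update_self, Set.mem_ofPred_eq]
    exact ⟨fun hj => (hnew j hj.1).1 hj.2, fun hj => ⟨hT hj, (hnew j (hT hj)).2 hj⟩⟩
  · have hyx : y ≠ x := by
      have := hy.2
      omega
    simp only [nodeSet, hstart, Function.update_of_ne hyx, Set.mem_ofPred_eq]
    refine and_congr_right fun hj => ?_
    have := h.row_le y hy
    rw [hold _ (by omega)]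

theorem Dictionary.push (h : Dictionary n s) (hx : x = s.reg .numNodes + 1)
    (hpath : IsPath (children s) (bits n T) t) (ht : s.arr .leaf t = 0)
    (hset_x : nodeSet n s' x = T) (hset : ∀ y ∈ nodes s, nodeSet n s' y = nodeSet n s y)
    (hfresh : s'.reg .fresh = s.reg .fresh) (hchildren : children s' = children s)
    (hcnt : s'.reg .numNodes = x) (htop : s'.reg .top = s.reg .top + n)
    (hleaf : s'.arr .leaf = Function.update (s.arr .leaf) t x)
    (hstart : s'.arr .rowStart = Function.update (s.arr .rowStart) x (s.reg .top)) :
    Dictionary n s' := by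
  have hnodes : nodes s' = insert x (nodes s) := by
    ext y
    simp only [nodes, hcnt, hx, Set.mem_Icc, Set.mem_insert_iff]
    omega
  refine ⟨by rw [hfresh, hchildren]; exact h.trie, fun u hu => ?_, ?_, ?_, ?_⟩
  · rw [hnodes, hchildren, hleaf]
    rw [hleaf] at hu
    rcases eq_or_ne u t with rfl | hut
    · rw [Function.update_self, hset_x]
      exact ⟨Set.mem_insert _ _, hpath⟩
    · rw [Function.update_of_ne hut] at hu ⊢
      obtain ⟨hmem, hu⟩ := h.leaf u hu
      rw [hset _ hmem]
      exact ⟨Set.mem_insert_of_mem _ hmem, hu⟩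
  · rw [hnodes, Set.forall_mem_insert, hleaf]
    refine ⟨⟨t, Function.update_self _ _ _⟩, fun y hy => ?_⟩
    obtain ⟨u, rfl⟩ := h.exists_leaf y hy
    refine ⟨u, Function.update_of_ne ?_ _ _⟩
    rintro rfl
    exact absurd hy.1 (by rw [ht]; exact Nat.not_succ_le_zero 0)
  · rw [hnodes, Set.forall_mem_insert, hstart, htop, Function.update_self]
    refine ⟨le_rfl, fun y hy => ?_⟩
    have hyx : y ≠ x := by
      have := hy.2
      omega
    rw [Function.update_of_ne hyx]
    exact (h.row_le y hy).trans (Nat.le_add_right _ _)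
  · rw [htop, hcnt, hx, h.top_eq, Nat.succ_mul]

/-- In `s'` the node `x` stands for `T`; all other nodes are those of `s`, unchanged, and `x` is
either one of these or a new singleton of the union-find forest. -/
structure Interned (n : ℕ) (T : Set ℕ) (x : ℕ) (s s' : State) : Prop where
  dictionary : Dictionary n s'
  mem : x ∈ nodes s'
  nodeSet_self : nodeSet n s' x = T
  numNodes_le : s.reg .numNodes ≤ s'.reg .numNodes
  mem_or_eq : ∀ y ∈ nodes s', y ∈ nodes s ∨ y = x
  nodeSet_eq : ∀ y ∈ nodes s, nodeSet n s' y = nodeSet n s y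
  forest : ∀ r links, Forest r (s.reg .numNodes) links (s.arr .parent) (s.arr .weight) →
    Forest r (s'.reg .numNodes) links (s'.arr .parent) (s'.arr .weight)

theorem Dictionary.interned (h : Dictionary n s) (hx : x = s.reg .numNodes + 1)
    (hT : T ⊆ Set.Iio n) (hpath : IsPath (children s) (bits n T) t) (ht : s.arr .leaf t = 0)
    (hfresh : s'.reg .fresh = s.reg .fresh) (hcnt : s'.reg .numNodes = x)
    (htop : s'.reg .top = s.reg .top + n) (hchildren : children s' = children s)
    (hleaf : s'.arr .leaf = Function.update (s.arr .leaf) t x)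
    (hstart : s'.arr .rowStart = Function.update (s.arr .rowStart) x (s.reg .top))
    (hnew : ∀ j < n, (s'.arr .row (s.reg .top + j) ≠ 0 ↔ j ∈ T))
    (hold : ∀ i < s.reg .top, s'.arr .row i = s.arr .row i)
    (hparent : s'.arr .parent = s.arr .parent)
    (hweight : s'.arr .weight = Function.update (s.arr .weight) x 1) :
    Interned n T x s s' := by
  obtain ⟨hset_x, hset⟩ := h.nodeSet_push hx hT hstart hnew hold
  refine ⟨h.push hx hpath ht hset_x hset hfresh hchildren hcnt htop hleaf hstart,
    ⟨by omega, hcnt.ge⟩, hset_x, by omega, fun y hy => ?_, hset, fun r links hF => ?_⟩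
  · obtain ⟨hy₁, hy₂⟩ := hy
    rcases eq_or_ne y x with rfl | hyx
    · exact .inr rfl
    · exact .inl ⟨hy₁, by omega⟩
  · rw [hcnt, hparent, hweight, hx]
    exact hF.push

theorem Dictionary.interned_self (h : Dictionary n s) (hx : x ∈ nodes s) :
    Interned n (nodeSet n s x) x s s :=
  ⟨h, hx, rfl, le_rfl, fun _ => .inl, fun _ _ => rfl, fun _ _ => id⟩

theorem Interned.of_eq {s₁ : State} (h : Interned n T x s₁ s')
    (hcnt : s₁.reg .numNodes = s.reg .numNodes)
    (harr : ∀ k ∈ [Arr.rowStart, .row, .parent, .weight], s₁.arr k = s.arr k) :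
    Interned n T x s s' := by
  have hnodes : nodes s₁ = nodes s := by rw [nodes, nodes, hcnt]
  have hset : nodeSet n s₁ = nodeSet n s := by
    funext y
    rw [nodeSet, nodeSet, harr _ (by decide), harr _ (by decide)]
  exact ⟨h.dictionary, h.mem, h.nodeSet_self, hcnt ▸ h.numNodes_le, hnodes ▸ h.mem_or_eq,
    hnodes ▸ hset ▸ h.nodeSet_eq, by
      simpa only [hcnt, harr _ (by decide : Arr.parent ∈ _), harr _ (by decide : Arr.weight ∈ _)]
        using h.forest⟩

end Dictionary

section Intern

variable {B : ℕ} {inp : ℕ → ℕ} {n : ℕ} {s : State}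

theorem runs_descendInto {b : Bool} {l : List Bool} (hzero : s.reg .zero = 0)
    (hT : Trie (s.reg .fresh) (children s)) (hl : IsPath (children s) l (s.reg .trie)) :
    Runs B inp (descendInto b) s fun s' => Trie (s'.reg .fresh) (children s') ∧
      IsPath (children s') (b :: l) (s'.reg .trie) ∧
      (∀ b' t, children s b' t ≠ 0 → children s' b' t = children s b' t) ∧
      s'.tick ≤ s.tick + 6 := by
  have ht := hl.lt_fresh hT
  have hchild : s.arr (.child b) (s.reg .trie) = children s b (s.reg .trie) := rfl
  simp only [descendInto, skip, runs_seq, runs_load, runs_ite_eq, runs_move, runs_store, runs_inc,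
    runs_zero, St.set_reg, St.set_tick, St.tock_reg, St.tock_tick, St.put_reg, St.put_tick,
    children_set, children_tock, hzero, hchild, reduceCtorEq, if_true, if_false]
  refine ⟨fun h0 => ?_, fun h0 => ⟨hT, ⟨_, hl, rfl, h0⟩, fun _ _ _ => trivial, by omega⟩⟩
  have hext := addChild_of_ne_zero (fresh := s.reg .fresh) h0
  simp only [children_put, children_set, children_tock]
  refine ⟨hT.addChild b ht, ⟨_, hl.mono hext, ?_, hT.fresh_pos.ne'⟩, hext, by omega⟩
  rw [addChild_apply, if_pos ⟨rfl, rfl⟩]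

theorem runs_descend {l : List Bool} (hzero : s.reg .zero = 0)
    (hT : Trie (s.reg .fresh) (children s)) (hl : IsPath (children s) l (s.reg .trie)) :
    Runs B inp descend s fun s' => Trie (s'.reg .fresh) (children s') ∧
      IsPath (children s') (decide (s.arr .next (s.reg .pos) ≠ 0) :: l) (s'.reg .trie) ∧
      (∀ b t, children s b t ≠ 0 → children s' b t = children s b t) ∧
      s'.tick ≤ s.tick + 8 := by
  have descend_to (b : Bool) (s' : State) (hs : s' = (s.set .bit (s.arr .next (s.reg .pos))).tock) :
      Runs B inp (descendInto b) s' fun s'' => Trie (s''.reg .fresh) (children s'') ∧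
        IsPath (children s'') (b :: l) (s''.reg .trie) ∧
        (∀ b t, children s b t ≠ 0 → children s'' b t = children s b t) ∧
        s''.tick ≤ s.tick + 8 := by
    subst hs
    exact runs_descendInto (by simpa using hzero) (by simpa using hT) (by simpa using hl)
  simp only [descend, runs_seq, runs_load, runs_ite_eq, St.set_reg, hzero, reduceCtorEq, if_true,
    if_false]
  refine ⟨fun h0 => ?_, fun h0 => ?_⟩
  · simpa [h0] using descend_to false _ rfl
  · simpa [h0] using descend_to true _ rfl

theorem runs_walk (hzero : s.reg .zero = 0) (hn : s.reg .numStates = n) (hD : Dictionary n s) :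
    Runs B inp walk s fun s' => Dictionary n s' ∧
      IsPath (children s') (bits n (bufferSet n s)) (s'.reg .trie) ∧
      s'.tick ≤ s.tick + (10 * n + 3) := by
  rw [walk, runs_seq, runs_zero]
  refine runs_for (fun k s' => Trie (s'.reg .fresh) (children s') ∧
      IsPath (children s') (bits k (bufferSet n s)) (s'.reg .trie) ∧
      (∀ b t, children s b t ≠ 0 → children s' b t = children s b t) ∧
      s'.tick ≤ s.tick + (10 * k + 2)) n (by simpa using hn) (by decide) (by decide) (by decide)
    ⟨by simpa using hD.trie, by simp [bits_zero, IsPath], fun _ _ _ => rfl, by simp⟩ ?_ ?_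
  · rintro k s' hk hpos - hf ⟨hT, hpath, hext, htick⟩
    have hnext : s'.arr .next = s.arr .next := hf.arr .next (by decide)
    have hz : s'.reg .zero = 0 := (hf.reg .zero (by decide)).trans (by simpa using hzero)
    refine (runs_descend (s := s'.tock) hz hT hpath).mono fun s'' _ ⟨hT', hpath', hext', ht⟩ => ?_
    have hbit : decide (s.arr .next k ≠ 0) ↔ k ∈ bufferSet n s := by simp [bufferSet, hk]
    simp only [St.tock_arr, St.tock_reg, hpos, hnext, ← bits_succ hbit] at hpath'
    simp only [children_tock, St.tock_tick] at hext' ht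
    refine ⟨hT', hpath', fun b t h0 => ?_, ?_⟩
    · have := hext b t h0
      exact (hext' b t (this ▸ h0)).trans this
    · simp only [St.set_tick]
      omega
  · rintro s' hf ⟨hT, hpath, hext, htick⟩
    refine ⟨hD.of_trie hT hext ?_ ?_, hpath, by simp only [St.tock_tick]; omega⟩
    · exact fun v hv => (hf.reg v (by revert v; decide)).trans (by revert v; simp)
    · exact fun k hk => hf.arr k (by revert k; decide)

theorem runs_copyBuffer (hn : s.reg .numStates = n) :
    Runs B inp (.for .pos .numStates copyBit) s fun s' => s'.reg .top = s.reg .top + n ∧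
      (∀ j < n, s'.arr .row (s.reg .top + j) = s.arr .next j) ∧
      (∀ i < s.reg .top, s'.arr .row i = s.arr .row i) ∧ s'.tick ≤ s.tick + (5 * n + 2) := by
  refine runs_for (fun k s' => s'.reg .top = s.reg .top + k ∧
      (∀ j < k, s'.arr .row (s.reg .top + j) = s.arr .next j) ∧
      (∀ i < s.reg .top, s'.arr .row i = s.arr .row i) ∧ s'.tick ≤ s.tick + (5 * k + 1)) n hn
    (by decide) (by decide) (by decide) (by simp) ?_ ?_
  · rintro k s' hk hpos - hf ⟨htop, hnew, hold, htick⟩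
    have hnext : s'.arr .next = s.arr .next := hf.arr .next (by decide)
    simp only [copyBit, runs_seq, runs_load, runs_store, runs_inc, St.set_reg, St.set_arr,
      St.set_tick, St.put_reg, St.put_arr, St.put_tick, St.tock_reg, St.tock_arr, St.tock_tick,
      reduceCtorEq, if_true, if_false, hpos, hnext, htop]
    refine ⟨by omega, fun j hj => ?_, fun i hi => ?_, by omega⟩
    · rcases Nat.lt_succ_iff_lt_or_eq.1 hj with hj | rfl
      · rw [Function.update_of_ne (by omega), hnew j hj]
      · rw [Function.update_self]
    · rw [Function.update_of_ne (by omega), hold i hi]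
  · rintro s' - ⟨htop, hnew, hold, htick⟩
    exact ⟨htop, hnew, hold, by simp only [St.tock_tick]; omega⟩

theorem runs_newNode {b : Bool} (hone : s.reg .one = 1) (hn : s.reg .numStates = n)
    (hD : Dictionary n s) (hpath : IsPath (children s) (bits n (bufferSet n s)) (s.reg .trie))
    (hleaf : s.arr .leaf (s.reg .trie) = 0) :
    Runs B inp (newNode b) s fun s' =>
      Interned n (bufferSet n s) (s'.reg (.node b)) s s' ∧ s'.tick ≤ s.tick + (5 * n + 7) := by
  simp only [newNode, runs_seq, runs_inc, runs_move, runs_store, St.set_reg, St.put_reg,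
    reduceCtorEq, if_true, if_false]
  refine (runs_copyBuffer (n := n) (by simpa using hn)).mono fun s' hf ⟨htop, hnew, hold, ht⟩ => ?_
  simp only [St.set_reg, St.set_arr, St.set_tick, St.put_reg, St.put_arr, St.put_tick, reduceCtorEq,
    if_false] at htop hnew hold ht
  have hnode : s'.reg (.node b) = s.reg .numNodes + 1 :=
    (hf.reg (.node b) (by cases b <;> decide)).trans (by simp)
  have hchildren : children s' = children s := funext fun b =>
    (hf.arr (.child b) (by cases b <;> decide)).trans (by simp [children])
  have harr (k : Arr) (hk : k ≠ .row) : s'.arr k = _ := hf.arr k (by revert k; decide)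
  refine ⟨hnode ▸ hD.interned rfl (fun j hj => hj.1) hpath hleaf
    ((hf.reg .fresh (by decide)).trans (by simp)) ((hf.reg .numNodes (by decide)).trans (by simp))
    htop hchildren ((harr .leaf (by decide)).trans (by simp))
    ((harr .rowStart (by decide)).trans (by simp))
    (fun j hj => by simp [hnew j hj, bufferSet, hj]) hold
    ((harr .parent (by decide)).trans (by simp))
    ((harr .weight (by decide)).trans (by simp [hone])), by omega⟩

theorem runs_intern {b : Bool} (hzero : s.reg .zero = 0) (hone : s.reg .one = 1)
    (hn : s.reg .numStates = n) (hD : Dictionary n s) :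
    Runs B inp (intern b) s fun s' =>
      Interned n (bufferSet n s) (s'.reg (.node b)) s s' ∧ s'.tick ≤ s.tick + (15 * n + 12) := by
  rw [intern, runs_seq]
  refine (runs_walk hzero hn hD).mono fun s₁ hf ⟨hD₁, hpath, _⟩ => ?_
  have hreg (v : Var) (hv : v ∈ [Var.zero, .one, .numStates, .numNodes]) : s₁.reg v = s.reg v :=
    hf.reg v (by revert v; decide)
  have harr (k : Arr) (hk : k ∈ [Arr.rowStart, .row, .parent, .weight]) : s₁.arr k = s.arr k :=
    hf.arr k (by revert k; decide)
  have hz : s₁.reg .zero = 0 := (hreg _ (by decide)).trans hzero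
  have hbuffer : bufferSet n s₁ = bufferSet n s := by
    rw [bufferSet, bufferSet, hf.arr .next (by decide)]
  simp only [skip, runs_seq, runs_load, runs_ite_eq, runs_zero, St.set_reg, if_true, if_false,
    reduceCtorEq, hz]
  refine ⟨fun h0 => ?_, fun h0 => ?_⟩
  · refine (runs_newNode (n := n) (s := (s₁.set (.node b) _).tock)
      ((hreg .one (by decide)).trans hone) ((hreg .numStates (by decide)).trans hn)
      (hD₁.congr (by simp) (by simp)) (hbuffer ▸ hpath) h0).mono fun s' _ ⟨h, ht⟩ => ⟨?_, ?_⟩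
    · exact (hbuffer ▸ h).of_eq (hreg _ (by decide)) harr
    · simp only [St.set_tick, St.tock_tick] at ht
      omega
  · obtain ⟨hmem, hpath'⟩ := hD₁.leaf _ h0
    have hset : nodeSet n s₁ _ = bufferSet n s := eq_of_bits_eq
      (hD₁.trie.path_unique hpath' hpath) (nodeSet_subset _ _ _) fun _ h => h.1
    simp only [St.set_tick, St.tock_tick, St.tock_reg, St.set_reg, if_true]
    refine ⟨?_, by omega⟩
    have hD₂ : Dictionary n ((s₁.set (.node b) (s₁.arr .leaf (s₁.reg .trie))).tock.set .unused 0) :=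
      hD₁.congr (by simp) (by simp)
    exact ((show nodeSet n _ _ = bufferSet n s from hset) ▸ hD₂.interned_self hmem).of_eq
      (hreg _ (by decide)) harr

end Intern

/-! ### Transitions and acceptance -/

/-- The automaton `U`, whose states are among `0, …, n - 1`, is stored as a list of `e` edges and
as the characteristic function of its set of accepting states. -/
structure Loaded {σ : ℕ} (U : NFA (Fin σ) ℕ) (n e : ℕ) (s : State) : Prop where
  zero : s.reg .zero = 0
  one : s.reg .one = 1
  alphabet : s.reg .alphabet = σ
  numStates : s.reg .numStates = n
  numEdges : s.reg .numEdges = e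
  source_lt : ∀ k < e, s.arr .source k < n
  target_lt : ∀ k < e, s.arr .target k < n
  mem_step : ∀ u a v, v ∈ U.step u a ↔
    ∃ k < e, s.arr .source k = u ∧ s.arr .target k = v ∧ s.arr .label k = a
  mem_accept : ∀ v < n, v ∈ U.accept ↔ s.arr .final v ≠ 0

@[simp] theorem bufferSet_tock (n : ℕ) (s : State) : bufferSet n s.tock = bufferSet n s := rfl

@[simp] theorem bufferSet_set (n : ℕ) (s : State) (d x) :
    bufferSet n (s.set d x) = bufferSet n s := rfl

theorem bufferSet_put {n v x : ℕ} (s : State) (hv : v < n) (hx : x ≠ 0) :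
    bufferSet n (s.put .next v x) = insert v (bufferSet n s) := by
  ext j
  rcases eq_or_ne j v with rfl | hj
  · simp [bufferSet, hv, hx]
  · simp [bufferSet, hj]

section Expand

variable {σ n e B : ℕ} {U : NFA (Fin σ) ℕ} {inp : ℕ → ℕ} {s : State}

theorem Loaded.of_frame {c : Prog} {s' : State} (h : Loaded U n e s) (hf : Frame c s s')
    (hv : ∀ v ∈ [Var.zero, .one, .alphabet, .numStates, .numEdges], c.writesVar v = false)
    (hk : ∀ k ∈ [Arr.source, .target, .label, .final], c.writesArr k = false) :
    Loaded U n e s' := by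
  have hreg (v : Var) (h : v ∈ [Var.zero, .one, .alphabet, .numStates, .numEdges]) :=
    hf.reg v (hv v h)
  have harr (k : Arr) (h : k ∈ [Arr.source, .target, .label, .final]) := hf.arr k (hk k h)
  constructor
  · exact (hreg _ (by decide)).trans h.zero
  · exact (hreg _ (by decide)).trans h.one
  · exact (hreg _ (by decide)).trans h.alphabet
  · exact (hreg _ (by decide)).trans h.numStates
  · exact (hreg _ (by decide)).trans h.numEdges
  · simpa only [harr .source (by decide)] using h.source_lt
  · simpa only [harr .target (by decide)] using h.target_lt
  · simpa only [harr .source (by decide), harr .target (by decide), harr .label (by decide)]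
      using h.mem_step
  · simpa only [harr .final (by decide)] using h.mem_accept

theorem runs_clearBuffer (hzero : s.reg .zero = 0) (hn : s.reg .numStates = n) :
    Runs B inp (.for .pos .numStates (.store .next .pos .zero)) s fun s' =>
      bufferSet n s' = ∅ ∧ s'.tick ≤ s.tick + (3 * n + 2) := by
  refine runs_for (fun k s' => (∀ j < k, s'.arr .next j = 0) ∧ s'.tick ≤ s.tick + (3 * k + 1)) n hn
    (by decide) (by decide) (by decide) (by simp) ?_ ?_
  · rintro k s' - hpos - hf ⟨hnext, htick⟩
    have hz : s'.reg .zero = 0 := (hf.reg .zero (by decide)).trans hzero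
    simp only [runs_store, St.set_arr, St.set_tick, St.put_arr, St.put_tick, St.tock_reg,
      St.tock_arr, St.tock_tick, if_true, hpos, hz]
    refine ⟨fun j hj => ?_, by omega⟩
    rcases Nat.lt_succ_iff_lt_or_eq.1 hj with hj | rfl
    · rw [Function.update_of_ne hj.ne, hnext j hj]
    · rw [Function.update_self]
  · rintro s' - ⟨hnext, htick⟩
    exact ⟨Set.eq_empty_of_forall_notMem fun j hj => hj.2 (hnext j hj.1),
      by simp only [St.tock_tick]; omega⟩

variable {x : ℕ}

theorem runs_followEdge (hL : Loaded U n e s) (hk : s.reg .edge < e)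
    (hrow : s.reg .rowPtr = s.arr .rowStart x) (hB : s.arr .rowStart x + n ≤ B) :
    Runs B inp followEdge s fun s' => bufferSet n s' = bufferSet n s ∪
        {v | s.arr .label (s.reg .edge) = s.reg .letter ∧
          s.arr .source (s.reg .edge) ∈ nodeSet n s x ∧ s.arr .target (s.reg .edge) = v} ∧
      s'.tick ≤ s.tick + 8 := by
  have hsrc := hL.source_lt _ hk
  have htgt := hL.target_lt _ hk
  simp only [followEdge, skip, runs_seq, runs_load, runs_ite_eq, runs_add, runs_store, runs_zero,
    St.set_reg, St.set_arr, St.set_tick, St.put_tick, St.tock_reg, St.tock_arr, St.tock_tick,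
    reduceCtorEq, if_true, if_false, hL.zero, hL.one, hrow, bufferSet_set, bufferSet_tock]
  refine ⟨fun hlab => ⟨by omega, fun h0 => ⟨?_, by omega⟩, fun h0 => ⟨?_, by omega⟩⟩,
    fun hlab => ⟨by simp [hlab], by omega⟩⟩
  · simp [nodeSet, h0]
  · rw [bufferSet_put _ htgt one_ne_zero, Set.insert_eq, Set.union_comm]
    simp [nodeSet, h0, hlab, hsrc]

theorem runs_followEdges {a : Fin σ} (hL : Loaded U n e s) (ha : s.reg .letter = a)
    (hrow : s.reg .rowPtr = s.arr .rowStart x) (hB : s.arr .rowStart x + n ≤ B) :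
    Runs B inp (.for .edge .numEdges followEdge) s fun s' =>
      bufferSet n s' = bufferSet n s ∪ U.stepSet (nodeSet n s x) a ∧
      s'.tick ≤ s.tick + (10 * e + 2) := by
  refine runs_for (fun k s' => bufferSet n s' = bufferSet n s ∪ {v | ∃ i < k,
      s.arr .label i = a ∧ s.arr .source i ∈ nodeSet n s x ∧ s.arr .target i = v} ∧
    s'.tick ≤ s.tick + (10 * k + 1)) e hL.numEdges (by decide) (by decide) (by decide) (by simp)
    ?_ ?_
  · rintro k s' hk hedge - hf ⟨hset, ht⟩
    have harr (k : Arr) (hk : k ≠ .next) : s'.arr k = s.arr k := hf.arr k (by revert k; decide)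
    have hstart : s'.arr .rowStart = s.arr .rowStart := harr _ (by decide)
    have hrow' : s'.reg .rowPtr = s.arr .rowStart x := (hf.reg .rowPtr (by decide)).trans hrow
    have hletter : s'.reg .letter = a := (hf.reg .letter (by decide)).trans ha
    have hnode : nodeSet n s'.tock x = nodeSet n s x := by
      rw [nodeSet, nodeSet, St.tock_arr, hstart, harr .row (by decide)]
    refine (runs_followEdge (s := s'.tock) (x := x)
      (hL.of_frame ⟨hf.reg, hf.arr⟩ (by decide) (by decide)) (hedge.trans_lt hk)
      (by rw [St.tock_reg, St.tock_arr, hrow', hstart]) (by rwa [St.tock_arr, hstart])).mono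
      fun s'' _ ⟨hset', ht'⟩ => ?_
    simp only [St.tock_tick] at ht'
    refine ⟨?_, by simp only [St.set_tick]; omega⟩
    rw [bufferSet_set, hset', bufferSet_tock, hset, hnode, Set.union_assoc]
    congr 1
    ext v
    simp only [Set.mem_union, Set.mem_ofPred_eq, St.tock_reg, St.tock_arr, hedge, hletter,
      harr .label (by decide), harr .source (by decide), harr .target (by decide),
      Nat.exists_lt_succ_right]
  · rintro s' - ⟨hset, ht⟩
    refine ⟨?_, by simp only [St.tock_tick]; omega⟩
    rw [bufferSet_tock, hset]
    congr 1
    ext v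
    simp only [NFA.mem_stepSet, hL.mem_step, Set.mem_ofPred_eq]
    constructor
    · rintro ⟨i, hi, hlab, hsrc, htgt⟩
      exact ⟨_, hsrc, i, hi, rfl, htgt, hlab⟩
    · rintro ⟨_, hsrc, i, hi, rfl, htgt, hlab⟩
      exact ⟨i, hi, hlab, hsrc, htgt⟩

theorem runs_expand {a : Fin σ} (hL : Loaded U n e s) (ha : s.reg .letter = a)
    (hB : s.arr .rowStart (s.reg .index) + n ≤ B) :
    Runs B inp expand s fun s' => bufferSet n s' = U.stepSet (nodeSet n s (s.reg .index)) a ∧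
      s'.tick ≤ s.tick + (3 * n + 10 * e + 5) := by
  rw [expand, runs_seq, runs_load, runs_seq]
  refine (runs_clearBuffer (n := n) (s := s.set .rowPtr _) hL.zero hL.numStates).mono
    fun s₁ hf ⟨hempty, htick⟩ => ?_
  have harr (k : Arr) (hk : k ≠ .next) : s₁.arr k = s.arr k := hf.arr k (by revert k; decide)
  have hstart : s₁.arr .rowStart = s.arr .rowStart := harr _ (by decide)
  have hnode : nodeSet n s₁ = nodeSet n s := by
    funext x
    rw [nodeSet, nodeSet, hstart, harr .row (by decide)]
  have hrow : s₁.reg .rowPtr = s.arr .rowStart (s.reg .index) := hf.reg .rowPtr (by decide)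
  refine (runs_followEdges (x := s.reg .index) (hL.of_frame (c := expand)
    ((Frame.set (by decide) s _).trans (hf.mono (by decide) (by decide))) (by decide) (by decide))
    ((hf.reg .letter (by decide)).trans ha) (by rw [hrow, hstart]) (by rwa [hstart])).mono
    fun s' _ ⟨hset, _⟩ => ?_
  simp only [St.set_tick] at htick
  rw [hset, hempty, Set.empty_union, hnode]
  exact ⟨rfl, by omega⟩

open Classical in
theorem runs_checkAccept {b : Bool} (hL : Loaded U n e s) :
    Runs B inp (checkAccept b) s fun s' =>
      s'.reg (.flag b) = (if bufferSet n s ∈ U.toDFA.accept then 1 else 0) ∧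
      s'.tick ≤ s.tick + (7 * n + 3) := by
  rw [checkAccept, runs_seq, runs_zero]
  refine runs_for (fun k s' => s'.reg (.flag b) =
      (if ∃ j < k, j ∈ bufferSet n s ∧ j ∈ U.accept then 1 else 0) ∧
    s'.tick ≤ s.tick + (7 * k + 2)) n (by simpa using hL.numStates) (by cases b <;> decide)
    (by cases b <;> decide) (by decide) (by simp) ?_ ?_
  · rintro k s' hk hpos - hf ⟨hflag, htick⟩
    have harr (k : Arr) : s'.arr k = s.arr k := hf.arr k (by cases b <;> revert k <;> decide)
    have hreg (v : Var) (hv : v ∈ [Var.zero, .one]) : s'.reg v = s.reg v :=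
      (hf.reg v (by cases b <;> revert v <;> decide)).trans (by revert v; simp)
    have hz : s'.reg .zero = 0 := (hreg _ (by decide)).trans hL.zero
    have hone : s'.reg .one = 1 := (hreg _ (by decide)).trans hL.one
    simp only [checkState, skip, runs_seq, runs_load, runs_ite_eq, runs_move, runs_zero, St.set_reg,
      St.set_arr, St.set_tick, St.tock_reg, St.tock_arr, St.tock_tick, reduceCtorEq, if_true,
      if_false, hpos, hz, hone, harr, hflag]
    have haccept := hL.mem_accept k hk
    refine ⟨fun h0 => ⟨?_, by omega⟩, fun h0 => ⟨fun h1 => ⟨?_, by omega⟩,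
      fun h1 => ⟨?_, by omega⟩⟩⟩
    · exact if_congr (by simp only [bufferSet, Nat.exists_lt_succ_right, h0, Set.mem_ofPred_eq,
        ne_eq, not_true, and_false, false_and, or_false]) rfl rfl
    · exact if_congr (by simp only [Nat.exists_lt_succ_right, haccept, h1, ne_eq, not_true,
        and_false, or_false]) rfl rfl
    · exact (if_pos ⟨k, k.lt_succ_self, ⟨hk, h0⟩, haccept.2 h1⟩).symm
  · rintro s' - ⟨hflag, htick⟩
    refine ⟨hflag.trans (if_congr ⟨?_, ?_⟩ rfl rfl), by simp only [St.tock_tick]; omega⟩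
    · exact fun ⟨j, _, hj⟩ => ⟨j, hj⟩
    · exact fun ⟨j, hj⟩ => ⟨j, hj.1.1, hj⟩

end Expand

/-! ### Finding roots -/

theorem runs_findRoot {B : ℕ} {inp : ℕ → ℕ} {r : ℕ → ℕ → Prop} {cnt links : ℕ} {b : Bool}
    {s : State} (hzero : s.reg .zero = 0) (hr : Equivalence r)
    (hF : Forest r cnt links (s.arr .parent) (s.arr .weight))
    (hx : s.reg (.node b) ∈ Set.Icc 1 cnt) :
    Runs B inp (findRoot b) s fun s' => s'.reg (.root b) ∈ roots cnt (s.arr .parent) ∧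
      r (s.reg (.node b)) (s'.reg (.root b)) ∧ s'.tick ≤ s.tick + (3 + 3 * Nat.log 2 cnt) := by
  simp only [findRoot, runs_seq, runs_move, runs_load]
  refine runs_loop (fun s' => s'.reg (.root b) ∈ Set.Icc 1 cnt ∧
      s'.reg .up = s.arr .parent (s'.reg (.root b)) ∧ r (s.reg (.node b)) (s'.reg (.root b)) ∧
      ∃ k, 2 ^ k ≤ s.arr .weight (s'.reg (.root b)) ∧ s'.tick ≤ s.tick + 2 + 3 * k)
    (fun s' => cnt - s.arr .weight (s'.reg (.root b))) ?_ ?_ ?_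
  · have hwt := (hF.wt_mem _ hx).1
    simpa [hr.refl] using ⟨hx, 0, by simpa using hwt⟩
  all_goals
    rintro s' hf ⟨hmem, hup, hrel, k, hk, htick⟩ hb
    have hz : s'.reg .zero = 0 :=
      (hf.reg .zero (by cases b <;> decide)).trans (by simpa using hzero)
    have hpar : s'.arr .parent = s.arr .parent := hf.arr .parent (by cases b <;> decide)
    simp only [Cond.holds, hz, hup] at hb
  · have hb' := hb.ne'
    have hmem' := (hF.mem _ hb').2
    have hdouble := hF.two_mul_le _ hb'
    have hle := (hF.wt_mem _ hmem').2
    have hpos := (hF.wt_mem _ hmem).1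
    simp only [runs_seq, runs_move, runs_load, St.set_reg, St.set_arr, St.set_tick, St.tock_reg,
      St.tock_arr, St.tock_tick, reduceCtorEq, if_true, if_false, hup, hpar]
    refine ⟨⟨hmem', trivial, hr.trans hrel (hF.rel _ hb'), k + 1, ?_, ?_⟩, ?_⟩
    · rw [pow_succ]
      omega
    · omega
    · omega
  · refine ⟨mem_roots.2 ⟨hmem, by simpa using hb⟩, hrel, ?_⟩
    have hlog : k ≤ Nat.log 2 cnt :=
      Nat.le_log_of_pow_le one_lt_two (hk.trans (hF.wt_mem _ hmem).2)
    simp only [St.tock_tick]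
    omega

open Relation

/-! ### The invariant -/

section Invariant

variable {α : Type*} {D : DFA α (Set ℕ)} {S : Bool → Set ℕ} {n N : ℕ} {s s₁ s' : State}

/-- The states of `D` that are reached from one of its two starting states `S`. -/
def reached {T : Type*} (D : DFA α T) (S : Bool → T) : Set T :=
  ⋃ b, Set.range (D.evalFrom (S b))

/-- The pair consisting of `T` and `T'` has been entered into the queue. -/
def Merged (n : ℕ) (s : State) (T T' : Set ℕ) : Prop :=
  ∃ i < s.reg .tail, nodeSet n s (s.arr (.queue false) i) = T ∧
    nodeSet n s (s.arr (.queue true) i) = T'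

/-- The nodes `x` and `y` are equivalent as a consequence of the pairs entered into the queue. -/
def Joined (n : ℕ) (s : State) (x y : ℕ) : Prop :=
  EqvGen (Merged n s) (nodeSet n s x) (nodeSet n s y)

theorem joined_equivalence (n : ℕ) (s : State) : Equivalence (Joined n s) :=
  ⟨fun _ => .refl _, .symm _ _, .trans _ _ _⟩

/-- The invariant of the exploration of the states of `D` reached from `S false` and `S true`:
the trees of the union-find forest are the classes of the equivalence relation generated by the
queue, and each pair in the queue is the pair of states reached by reading some word. -/
structure Inv (D : DFA α (Set ℕ)) (S : Bool → Set ℕ) (n : ℕ) (s : State) : Prop where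
  dictionary : Dictionary n s
  forest : Forest (Joined n s) (s.reg .numNodes) (s.reg .tail) (s.arr .parent) (s.arr .weight)
  nodeSet_mem : ∀ x ∈ nodes s, nodeSet n s x ∈ reached D S
  queue : ∀ i < s.reg .tail, ∃ w, ∀ b, s.arr (.queue b) i ∈ nodes s ∧
    nodeSet n s (s.arr (.queue b) i) = D.evalFrom (S b) w
  of_differ_ne : s.reg .differ ≠ 0 →
    ∃ w, ¬(D.evalFrom (S false) w ∈ D.accept ↔ D.evalFrom (S true) w ∈ D.accept)
  of_differ_eq : s.reg .differ = 0 → ∀ T T', Merged n s T T' → (T ∈ D.accept ↔ T' ∈ D.accept)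

theorem Inv.congr (h : Inv D S n s)
    (hreg : ∀ v ∈ [Var.fresh, .numNodes, .top, .tail, .differ], s'.reg v = s.reg v)
    (harr : ∀ k ∈ [Arr.child false, .child true, .leaf, .rowStart, .row, .parent, .weight,
      .queue false, .queue true], s'.arr k = s.arr k) : Inv D S n s' := by
  have hdict : Dictionary n s' :=
    h.dictionary.congr (fun v hv => hreg v (by revert v; decide))
      fun k hk => harr k (by revert k; decide)
  have hqueue (b : Bool) : s'.arr (.queue b) = s.arr (.queue b) := harr _ (by cases b <;> decide)
  simp only [List.forall_mem_cons, List.not_mem_nil, false_implies, implies_true, and_true]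
    at hreg harr
  obtain ⟨-, hcnt, -, htail, hdiffer⟩ := hreg
  obtain ⟨-, -, -, hstart, hrow, hparent, hweight, -⟩ := harr
  have hnodes : nodes s' = nodes s := by rw [nodes, nodes, hcnt]
  have hset : nodeSet n s' = nodeSet n s := by
    funext x
    rw [nodeSet, nodeSet, hstart, hrow]
  have hmerged : Merged n s' = Merged n s := by
    funext T T'
    simp only [Merged, hset, htail, hqueue]
  have hjoined : Joined n s' = Joined n s := by
    funext x y
    rw [Joined, Joined, hset, hmerged]
  obtain ⟨-, hforest, hmem, hq, hne, heq⟩ := h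
  refine ⟨hdict, ?_, ?_, ?_, ?_, ?_⟩ <;> simp only [hnodes, hset, hmerged, hjoined, hcnt, htail,
    hdiffer, hparent, hweight, hqueue] <;> assumption

theorem Inv.of_frame {c : Prog} (h : Inv D S n s) (hf : Frame c s s')
    (hv : ∀ v ∈ [Var.fresh, .numNodes, .top, .tail, .differ], c.writesVar v = false)
    (hk : ∀ k ∈ [Arr.child false, .child true, .leaf, .rowStart, .row, .parent, .weight,
      .queue false, .queue true], c.writesArr k = false) : Inv D S n s' :=
  h.congr (fun v h => hf.reg v (hv v h)) fun k h => hf.arr k (hk k h)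

theorem Inv.numNodes_le (h : Inv D S n s) (hN : (reached D S).encard ≤ N) :
    s.reg .numNodes ≤ N := by
  have himage : nodeSet n s '' nodes s ⊆ reached D S := Set.image_subset_iff.2 h.nodeSet_mem
  have hle := (Set.encard_le_encard himage).trans hN
  rw [h.dictionary.injOn.encard_image, nodes, ← Finset.coe_Icc, Set.encard_coe_eq_coe_finsetCard,
    Nat.card_Icc, Nat.add_sub_cancel] at hle
  exact_mod_cast hle

theorem Inv.tail_le (h : Inv D S n s) : s.reg .tail ≤ s.reg .numNodes :=
  (Nat.le_add_right _ _).trans_eq h.forest.card_roots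

/-- The nodes and the queue of `s` are kept in `s'`. -/
structure Grows (n : ℕ) (s s' : State) : Prop where
  nodes_subset : nodes s ⊆ nodes s'
  nodeSet_eq : ∀ x ∈ nodes s, nodeSet n s' x = nodeSet n s x
  tail_le : s.reg .tail ≤ s'.reg .tail
  queue_eq : ∀ b, ∀ i < s.reg .tail, s'.arr (.queue b) i = s.arr (.queue b) i

namespace Grows

theorem trans (h : Grows n s s₁) (h' : Grows n s₁ s') : Grows n s s' where
  nodes_subset := h.nodes_subset.trans h'.nodes_subset
  nodeSet_eq x hx := (h'.nodeSet_eq x (h.nodes_subset hx)).trans (h.nodeSet_eq x hx)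
  tail_le := h.tail_le.trans h'.tail_le
  queue_eq b i hi := (h'.queue_eq b i (hi.trans_le h.tail_le)).trans (h.queue_eq b i hi)

theorem congr (hreg : ∀ v ∈ [Var.numNodes, .tail], s'.reg v = s.reg v)
    (harr : ∀ k ∈ [Arr.rowStart, .row, .queue false, .queue true], s'.arr k = s.arr k) :
    Grows n s s' := by
  refine ⟨?_, fun x _ => ?_, (hreg _ (by decide)).ge, fun b i _ => ?_⟩
  · rw [nodes, nodes, hreg _ (by decide)]
  · rw [nodeSet, nodeSet, harr _ (by decide), harr _ (by decide)]
  · rw [harr _ (by cases b <;> decide)]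

theorem of_frame {c : Prog} (hf : Frame c s s')
    (hv : ∀ v ∈ [Var.numNodes, .tail], c.writesVar v = false)
    (hk : ∀ k ∈ [Arr.rowStart, .row, .queue false, .queue true], c.writesArr k = false) :
    Grows n s s' :=
  congr (fun v h => hf.reg v (hv v h)) fun k h => hf.arr k (hk k h)

variable {T T' : Set ℕ} {x y : ℕ}

theorem merged (h : Grows n s s') (hI : Inv D S n s) (hm : Merged n s T T') :
    Merged n s' T T' := by
  obtain ⟨i, hi, rfl, rfl⟩ := hm
  obtain ⟨w, hw⟩ := hI.queue i hi
  refine ⟨i, hi.trans_le h.tail_le, ?_, ?_⟩ <;> rw [h.queue_eq _ i hi, h.nodeSet_eq _ (hw _).1]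

theorem eqvGen (h : Grows n s s') (hI : Inv D S n s) (hm : EqvGen (Merged n s) T T') :
    EqvGen (Merged n s') T T' :=
  hm.mono fun _ _ => h.merged hI

theorem joined (h : Grows n s s') (hI : Inv D S n s) (hx : x ∈ nodes s) (hy : y ∈ nodes s)
    (hj : Joined n s x y) : Joined n s' x y := by
  rw [Joined, h.nodeSet_eq x hx, h.nodeSet_eq y hy]
  exact h.eqvGen hI hj

theorem queue (h : Grows n s s') (hI : Inv D S n s) {i : ℕ} (hi : i < s.reg .tail) :
    ∃ w, ∀ b, s'.arr (.queue b) i ∈ nodes s' ∧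
      nodeSet n s' (s'.arr (.queue b) i) = D.evalFrom (S b) w := by
  obtain ⟨w, hw⟩ := hI.queue i hi
  refine ⟨w, fun b => ?_⟩
  rw [h.queue_eq b i hi, h.nodeSet_eq _ (hw b).1]
  exact ⟨h.nodes_subset (hw b).1, (hw b).2⟩

end Grows

theorem Interned.grows {T : Set ℕ} {x : ℕ} (h : Interned n T x s s')
    (htail : s'.reg .tail = s.reg .tail)
    (hqueue : ∀ b, s'.arr (.queue b) = s.arr (.queue b)) : Grows n s s' :=
  ⟨Set.Icc_subset_Icc_right h.numNodes_le, h.nodeSet_eq, htail.ge, fun b _ _ => by rw [hqueue]⟩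

theorem Inv.intern {T : Set ℕ} {x : ℕ} (hI : Inv D S n s) (h : Interned n T x s s')
    (hT : T ∈ reached D S) (hreg : ∀ v ∈ [Var.tail, .differ], s'.reg v = s.reg v)
    (hqueue : ∀ b, s'.arr (.queue b) = s.arr (.queue b)) : Inv D S n s' := by
  have htail : s'.reg .tail = s.reg .tail := hreg _ (by decide)
  have hdiffer : s'.reg .differ = s.reg .differ := hreg _ (by decide)
  have hG := h.grows htail hqueue
  have hmerged {T T'} (hm : Merged n s' T T') : Merged n s T T' := by
    obtain ⟨i, hi, rfl, rfl⟩ := hm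
    rw [htail] at hi
    obtain ⟨w, hw⟩ := hI.queue i hi
    refine ⟨i, hi, ?_, ?_⟩ <;> rw [hqueue, hG.nodeSet_eq _ (hw _).1]
  refine ⟨h.dictionary, ?_, fun y hy => ?_, fun i hi => hG.queue hI (htail ▸ hi),
    hdiffer ▸ hI.of_differ_ne, hdiffer ▸ fun h0 _ _ hm => hI.of_differ_eq h0 _ _ (hmerged hm)⟩
  · rw [htail]
    exact h.forest _ _ (hI.forest.mono fun x hx y hy => hG.joined hI hx hy)
  · rcases h.mem_or_eq y hy with hy | rfl
    · rw [hG.nodeSet_eq y hy]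
      exact hI.nodeSet_mem y hy
    · rwa [h.nodeSet_self]

/-- The node selected for the automaton `b` stands for `T`, and the flag tells whether `T` is
accepting. -/
structure Current (D : DFA α (Set ℕ)) (n : ℕ) (b : Bool) (T : Set ℕ) (s : State) : Prop where
  mem : s.reg (.node b) ∈ nodes s
  nodeSet_eq : nodeSet n s (s.reg (.node b)) = T
  flag_eq_one : s.reg (.flag b) = 1 ↔ T ∈ D.accept
  flag_le_one : s.reg (.flag b) ≤ 1

theorem Current.of_grows {b : Bool} {T : Set ℕ} (h : Current D n b T s) (hG : Grows n s s')
    (hreg : ∀ v ∈ [Var.node b, .flag b], s'.reg v = s.reg v) : Current D n b T s' := by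
  simp only [List.forall_mem_cons, List.not_mem_nil, false_implies, implies_true, and_true] at hreg
  obtain ⟨hnode, hflag⟩ := hreg
  obtain ⟨hmem, hset, hone, hle⟩ := h
  rw [← hnode] at hmem hset
  rw [← hflag] at hone hle
  exact ⟨hG.nodes_subset hmem, (hG.nodeSet_eq _ hmem).trans hset, hone, hle⟩

/-- `s'` arises from `s` by entering the pair of `x false` and `x true` into the queue and merging
two trees of the forest, where the root `ρ b` becomes a child of the other root `ρ !b`. -/
structure Linked (b : Bool) (x ρ : Bool → ℕ) (s s' : State) : Prop where
  reg_eq : ∀ v ∈ [Var.fresh, .numNodes, .top, .differ], s'.reg v = s.reg v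
  arr_eq : ∀ k ∈ [Arr.child false, .child true, .leaf, .rowStart, .row], s'.arr k = s.arr k
  tail_eq : s'.reg .tail = s.reg .tail + 1
  queue_eq : ∀ b, s'.arr (.queue b) = Function.update (s.arr (.queue b)) (s.reg .tail) (x b)
  parent_eq : s'.arr .parent = Function.update (s.arr .parent) (ρ b) (ρ !b)
  weight_eq : s'.arr .weight = Function.update (s.arr .weight) (ρ !b)
    (s.arr .weight (ρ false) + s.arr .weight (ρ true))

namespace Linked

variable {b : Bool} {x ρ : Bool → ℕ}

theorem nodes_eq (h : Linked b x ρ s s') : nodes s' = nodes s := by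
  rw [nodes, nodes, h.reg_eq _ (by decide)]

theorem nodeSet_eq (h : Linked b x ρ s s') : nodeSet n s' = nodeSet n s := by
  funext y
  rw [nodeSet, nodeSet, h.arr_eq _ (by decide), h.arr_eq _ (by decide)]

theorem grows (h : Linked b x ρ s s') : Grows n s s' where
  nodes_subset := h.nodes_eq.ge
  nodeSet_eq _ _ := by rw [h.nodeSet_eq]
  tail_le := h.tail_eq ▸ Nat.le_succ _
  queue_eq b i hi := by rw [h.queue_eq, Function.update_of_ne hi.ne]

theorem merged_iff (h : Linked b x ρ s s') {T T' : Set ℕ} : Merged n s' T T' ↔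
    Merged n s T T' ∨ nodeSet n s (x false) = T ∧ nodeSet n s (x true) = T' := by
  simp only [Merged, h.tail_eq, Nat.exists_lt_succ_right, h.nodeSet_eq, h.queue_eq,
    Function.update_self]
  refine or_congr_left (exists_congr fun i => and_congr_right fun hi => ?_)
  rw [Function.update_of_ne hi.ne, Function.update_of_ne hi.ne]

theorem forest (h : Linked b x ρ s s') (hI : Inv D S n s) (hx : ∀ b, x b ∈ nodes s)
    (hρ : ∀ b, ρ b ∈ roots (s.reg .numNodes) (s.arr .parent) ∧ Joined n s (x b) (ρ b))
    (hne : ρ false ≠ ρ true) (hwt : s.arr .weight (ρ b) ≤ s.arr .weight (ρ !b)) :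
    Forest (Joined n s') (s'.reg .numNodes) (s'.reg .tail) (s'.arr .parent) (s'.arr .weight) := by
  have hjoined (b : Bool) : Joined n s' (x b) (ρ b) :=
    h.grows.joined hI (hx b) (mem_roots.1 (hρ b).1).1 (hρ b).2
  have hx' : Joined n s' (x false) (x true) := by
    rw [Joined, h.nodeSet_eq]
    exact .rel _ _ (h.merged_iff.2 (.inr ⟨rfl, rfl⟩))
  have hE := joined_equivalence n s'
  have hroots : Joined n s' (ρ false) (ρ true) :=
    hE.trans (hE.symm (hjoined false)) (hE.trans hx' (hjoined true))
  have hlink := (hI.forest.mono fun x hx y hy => h.grows.joined hI hx hy).link (hρ b).1 (hρ !b).1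
    (by cases b; exacts [hne, hne.symm]) hwt (by cases b; exacts [hroots, hE.symm hroots])
  rw [h.reg_eq _ (by decide), h.tail_eq, h.parent_eq, h.weight_eq]
  cases b
  · exact hlink
  · rwa [Nat.add_comm (s.arr .weight (ρ false))]

theorem inv (h : Linked b x ρ s s') (hI : Inv D S n s) (hx : ∀ b, x b ∈ nodes s)
    (hw : ∃ w, ∀ b, nodeSet n s (x b) = D.evalFrom (S b) w)
    (hacc : s.reg .differ = 0 →
      (nodeSet n s (x false) ∈ D.accept ↔ nodeSet n s (x true) ∈ D.accept))
    (hρ : ∀ b, ρ b ∈ roots (s.reg .numNodes) (s.arr .parent) ∧ Joined n s (x b) (ρ b))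
    (hne : ρ false ≠ ρ true) (hwt : s.arr .weight (ρ b) ≤ s.arr .weight (ρ !b)) :
    Inv D S n s' := by
  have hdiffer : s'.reg .differ = s.reg .differ := h.reg_eq _ (by decide)
  refine ⟨hI.dictionary.congr (fun v hv => h.reg_eq v (by revert v; decide)) h.arr_eq,
    h.forest hI hx hρ hne hwt, ?_, fun i hi => ?_, hdiffer ▸ hI.of_differ_ne,
    hdiffer ▸ fun h0 T T' hm => ?_⟩
  · rw [h.nodes_eq, h.nodeSet_eq]
    exact hI.nodeSet_mem
  · rw [h.tail_eq] at hi
    rcases Nat.lt_succ_iff_lt_or_eq.1 hi with hi | rfl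
    · exact h.grows.queue hI hi
    · obtain ⟨w, hw⟩ := hw
      refine ⟨w, fun b => ?_⟩
      rw [h.queue_eq, Function.update_self, h.nodes_eq, h.nodeSet_eq]
      exact ⟨hx b, hw b⟩
  · rcases h.merged_iff.1 hm with hm | ⟨rfl, rfl⟩
    · exact hI.of_differ_eq h0 _ _ hm
    · exact hacc h0

end Linked

end Invariant

open Relation

/-! ### The exploration -/

section Exploration

variable {σ n e B N : ℕ} {U : NFA (Fin σ) ℕ} {S : Bool → Set ℕ} {inp : ℕ → ℕ} {s : State}

theorem runs_record {b : Bool} (hI : Inv U.toDFA S n s) (hL : Loaded U n e s)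
    (hT : bufferSet n s ∈ reached U.toDFA S) :
    Runs B inp (record b) s fun s' => Inv U.toDFA S n s' ∧ Grows n s s' ∧
      Current U.toDFA n b (bufferSet n s) s' ∧ s'.tick ≤ s.tick + (22 * n + 15) := by
  rw [record, runs_seq]
  refine (runs_intern hL.zero hL.one hL.numStates hI.dictionary).mono
    fun s₁ hf ⟨hInterned, _⟩ => ?_
  have hreg (v : Var) (hv : v ∈ [Var.tail, .differ]) : s₁.reg v = s.reg v :=
    hf.reg v (by cases b <;> revert v <;> decide)
  have hqueue (b' : Bool) : s₁.arr (.queue b') = s.arr (.queue b') :=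
    hf.arr _ (by cases b <;> cases b' <;> decide)
  have hbuffer : bufferSet n s₁ = bufferSet n s := by
    rw [bufferSet, bufferSet, hf.arr .next (by cases b <;> decide)]
  have hI₁ := hI.intern hInterned hT hreg hqueue
  refine (runs_checkAccept (b := b) (hL.of_frame hf (by cases b <;> decide)
    (by cases b <;> decide))).mono fun s' hf' ⟨hflag, _⟩ => ?_
  have hG : Grows n s₁ s' := .of_frame hf' (by cases b <;> decide) (by cases b <;> decide)
  have hnode : s'.reg (.node b) = s₁.reg (.node b) := hf'.reg _ (by cases b <;> decide)
  refine ⟨hI₁.of_frame hf' (by cases b <;> decide) (by cases b <;> decide),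
    (hInterned.grows (hreg _ (by decide)) hqueue).trans hG, ⟨?_, ?_, ?_, ?_⟩, by omega⟩
  · exact hnode ▸ hG.nodes_subset hInterned.mem
  · rw [hnode, hG.nodeSet_eq _ hInterned.mem, hInterned.nodeSet_self]
  · simp [hflag, hbuffer]
  · rw [hflag]
    split_ifs <;> simp

theorem step_mem_reached {T : Set ℕ} (hT : T ∈ reached U.toDFA S) (a : Fin σ) :
    U.stepSet T a ∈ reached U.toDFA S := by
  simp only [reached, Set.mem_iUnion, Set.mem_range] at hT ⊢
  obtain ⟨b, w, rfl⟩ := hT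
  exact ⟨b, w ++ [a], DFA.evalFrom_append_singleton _ _ _ _⟩

theorem runs_successor {b : Bool} {a : Fin σ} {x : ℕ} (hI : Inv U.toDFA S n s)
    (hL : Loaded U n e s) (hN : (reached U.toDFA S).encard ≤ N) (hB : N * (n + 1) ≤ B)
    (ha : s.reg .letter = a) (hx : s.arr (.queue b) (s.reg .head) = x) (hmem : x ∈ nodes s) :
    Runs B inp (successor b) s fun s' => Inv U.toDFA S n s' ∧ Grows n s s' ∧
      Current U.toDFA n b (U.stepSet (nodeSet n s x) a) s' ∧
      s'.tick ≤ s.tick + (25 * n + 10 * e + 21) := by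
  have hrow : s.arr .rowStart x + n ≤ B := by
    have htop := hI.dictionary.row_le x hmem
    rw [hI.dictionary.top_eq] at htop
    nlinarith [hI.numNodes_le hN]
  rw [successor, runs_seq, runs_load, hx, runs_seq]
  have hL₀ : Loaded U n e (s.set .index x) :=
    hL.of_frame (Frame.set (c := .zero .index) (by decide) s x) (by decide) (by decide)
  refine (runs_expand (a := a) hL₀ (by simpa using ha) (by simpa using hrow)).mono
    fun s₁ hf ⟨hset, htick⟩ => ?_
  replace hset : bufferSet n s₁ = U.stepSet (nodeSet n s x) a := by simpa [nodeSet] using hset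
  have hf₁ : Frame (.zero .index ;; expand) s s₁ := Frame.seq (Frame.set (by decide) s x) hf
  have hG : Grows n s s₁ := .of_frame hf₁ (by decide) (by decide)
  refine (runs_record (b := b) (hI.of_frame hf₁ (by decide) (by decide))
    (hL₀.of_frame hf (by decide) (by decide)) ?_).mono fun s' _ ⟨hI', hG', hcur, _⟩ => ?_
  · exact hset ▸ step_mem_reached (hI.nodeSet_mem x hmem) a
  · simp only [St.set_tick] at htick
    exact ⟨hI', hG.trans hG', hset ▸ hcur, by omega⟩

variable {T : Bool → Set ℕ}

theorem runs_compareFlags (hI : Inv U.toDFA S n s) (hone : s.reg .one = 1)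
    (hcur : ∀ b, Current U.toDFA n b (T b) s) (hw : ∃ w, ∀ b, T b = U.toDFA.evalFrom (S b) w) :
    Runs B inp compareFlags s fun s' => Inv U.toDFA S n s' ∧
      (s'.reg .differ = 0 → (T false ∈ U.toDFA.accept ↔ T true ∈ U.toDFA.accept)) ∧
      s'.tick ≤ s.tick + 2 := by
  have hflags : s.reg (.flag false) = s.reg (.flag true) ↔
      (T false ∈ U.toDFA.accept ↔ T true ∈ U.toDFA.accept) := by
    rw [← (hcur false).flag_eq_one, ← (hcur true).flag_eq_one]
    have := (hcur false).flag_le_one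
    have := (hcur true).flag_le_one
    omega
  simp only [compareFlags, skip, runs_ite_eq, runs_zero, runs_move]
  refine ⟨fun heq => ⟨hI.congr (by simp) (by simp), fun _ => hflags.1 heq, by simp⟩,
    fun hne => ⟨?_, by simp [hone], by simp⟩⟩
  obtain ⟨w, hw⟩ := hw
  refine ⟨hI.dictionary.congr (by simp) (by simp), hI.forest, hI.nodeSet_mem, hI.queue,
    fun _ => ⟨w, ?_⟩, fun h0 => by simp [hone] at h0⟩
  rw [hw, hw] at hflags
  exact mt hflags.2 hne

theorem runs_enqueue_join (hI : Inv U.toDFA S n s) (hB : s.reg .numNodes ≤ B)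
    (hx : ∀ b, s.reg (.node b) ∈ nodes s)
    (hw : ∃ w, ∀ b, nodeSet n s (s.reg (.node b)) = U.toDFA.evalFrom (S b) w)
    (hacc : s.reg .differ = 0 → (nodeSet n s (s.reg (.node false)) ∈ U.toDFA.accept ↔
      nodeSet n s (s.reg (.node true)) ∈ U.toDFA.accept))
    (hρ : ∀ b, s.reg (.root b) ∈ roots (s.reg .numNodes) (s.arr .parent) ∧
      Joined n s (s.reg (.node b)) (s.reg (.root b)))
    (hne : s.reg (.root false) ≠ s.reg (.root true)) :
    Runs B inp (enqueue ;; join) s fun s' => Inv U.toDFA S n s' ∧ Grows n s s' ∧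
      Merged n s' (nodeSet n s (s.reg (.node false))) (nodeSet n s (s.reg (.node true))) ∧
      s'.tick ≤ s.tick + 9 := by
  have hsum := hI.forest.wt_add_wt_le (hρ false).1 (hρ true).1 hne
  have of_linked {b : Bool} {s' : State} (hwt : s.arr .weight (s.reg (.root b)) ≤
      s.arr .weight (s.reg (.root !b)))
      (h : Linked b (fun b => s.reg (.node b)) (fun b => s.reg (.root b)) s s') :
      Inv U.toDFA S n s' ∧ Grows n s s' ∧
        Merged n s' (nodeSet n s (s.reg (.node false))) (nodeSet n s (s.reg (.node true))) :=
    ⟨h.inv hI hx hw hacc hρ hne hwt, h.grows, h.merged_iff.2 (.inr ⟨rfl, rfl⟩)⟩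
  simp only [enqueue, join, link, runs_seq, runs_store, runs_inc, runs_load, runs_add, runs_ite_lt,
    St.set_reg, St.set_arr, St.set_tick, St.put_reg, St.put_arr, St.put_tick, St.tock_reg,
    St.tock_tick, reduceCtorEq, if_true, if_false, Bool.not_true, Bool.not_false, Var.weight.injEq]
  refine ⟨hsum.trans hB, fun hlt => ?_, fun hle => ?_⟩ <;> rw [← and_assoc, ← and_assoc]
  · refine ⟨and_assoc.2 (of_linked (b := false) hlt.le ?_), by omega⟩
    constructor <;> simp
  · refine ⟨and_assoc.2 (of_linked (b := true) (not_lt.1 hle) ?_), by omega⟩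
    constructor <;> simp

theorem runs_findRoots (hI : Inv U.toDFA S n s) (hzero : s.reg .zero = 0)
    (hx : ∀ b, s.reg (.node b) ∈ nodes s) :
    Runs B inp findRoots s fun s' => Inv U.toDFA S n s' ∧ Grows n s s' ∧
      (∀ b, s'.reg (.root b) ∈ roots (s'.reg .numNodes) (s'.arr .parent) ∧
        Joined n s' (s'.reg (.node b)) (s'.reg (.root b))) ∧
      s'.tick ≤ s.tick + (6 + 6 * Nat.log 2 (s.reg .numNodes)) := by
  have hE := joined_equivalence n s
  rw [findRoots, runs_seq]
  refine (runs_findRoot hzero hE hI.forest (hx false)).mono fun s₁ hf ⟨hroot, hrel, _⟩ => ?_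
  have hreg (v : Var) (hv : v ∈ [Var.zero, .numNodes, .node true]) : s₁.reg v = s.reg v :=
    hf.reg v (by revert v; decide)
  have harr (k : Arr) : s₁.arr k = s.arr k := hf.arr k (by revert k; decide)
  refine (runs_findRoot (r := Joined n s) (cnt := s.reg .numNodes)
    ((hreg _ (by decide)).trans hzero) hE (by rw [harr, harr]; exact hI.forest)
    (by rw [hreg _ (by decide)]; exact hx true)).mono
    fun s' hf' ⟨hroot', hrel', ht'⟩ => ?_
  have hf'' : Frame findRoots s s' := hf.seq hf'
  have hG : Grows n s s' := .of_frame hf'' (by decide) (by decide)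
  refine ⟨hI.of_frame hf'' (by decide) (by decide), hG, fun b => ?_, by omega⟩
  have hmem : s'.reg (.root b) ∈ roots (s.reg .numNodes) (s.arr .parent) ∧
      Joined n s (s.reg (.node b)) (s'.reg (.root b)) := by
    rw [harr] at hroot'
    rw [hreg _ (by decide)] at hrel'
    cases b
    · rw [hf'.reg _ (by decide)]
      exact ⟨hroot, hrel⟩
    · exact ⟨hroot', hrel'⟩
  rw [hf''.reg .numNodes (by decide), hf''.arr .parent (by decide),
    hf''.reg (.node b) (by cases b <;> decide)]
  exact ⟨hmem.1, hG.joined hI (hx b) (mem_roots.1 hmem.1).1 hmem.2⟩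

theorem runs_merge (hI : Inv U.toDFA S n s) (hL : Loaded U n e s)
    (hN : (reached U.toDFA S).encard ≤ N) (hB : N ≤ B)
    (hcur : ∀ b, Current U.toDFA n b (T b) s) (hw : ∃ w, ∀ b, T b = U.toDFA.evalFrom (S b) w) :
    Runs B inp merge s fun s' => Inv U.toDFA S n s' ∧ Grows n s s' ∧
      EqvGen (Merged n s') (T false) (T true) ∧ s'.tick ≤ s.tick + (6 * Nat.log 2 N + 18) := by
  rw [merge, runs_seq]
  refine (runs_compareFlags hI hL.one hcur hw).mono fun s₁ hf₁ ⟨hI₁, hacc, _⟩ => ?_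
  have hG₁ : Grows n s s₁ := .of_frame hf₁ (by decide) (by decide)
  have hcur₁ (b : Bool) : Current U.toDFA n b (T b) s₁ :=
    (hcur b).of_grows hG₁ fun v hv => hf₁.reg v (by cases b <;> revert v <;> decide)
  have hlog : Nat.log 2 (s₁.reg .numNodes) ≤ Nat.log 2 N := Nat.log_mono_right (hI₁.numNodes_le hN)
  rw [runs_seq]
  refine (runs_findRoots hI₁ ((hf₁.reg .zero (by decide)).trans hL.zero)
    fun b => (hcur₁ b).mem).mono fun s₂ hf₂ ⟨hI₂, hG₂, hroots, _⟩ => ?_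
  have hG : Grows n s s₂.tock := (hG₁.trans hG₂).trans (.congr (by simp) (by simp))
  have hcur₂ (b : Bool) : Current U.toDFA n b (T b) s₂ :=
    (hcur₁ b).of_grows hG₂ fun v hv => hf₂.reg v (by cases b <;> revert v <;> decide)
  have hset (b : Bool) : nodeSet n s₂ (s₂.reg (.node b)) = T b := (hcur₂ b).nodeSet_eq
  simp only [skip, runs_ite_eq, runs_zero]
  refine ⟨fun heq => ⟨hI₂.congr (by simp) (by simp), hG.trans (.congr (by simp) (by simp)), ?_, ?_⟩,
    fun hne => (runs_enqueue_join (s := s₂.tock) (hI₂.congr (by simp) (by simp))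
      ((hI₂.numNodes_le hN).trans hB) (fun b => (hcur₂ b).mem) ?_ ?_ hroots hne).mono
      fun s' _ ⟨hI', hG', hm, ht'⟩ => ⟨hI', hG.trans hG', ?_, ?_⟩⟩
  · have hE := joined_equivalence n s₂
    have := hE.trans (hroots false).2 (heq ▸ hE.symm (hroots true).2)
    rwa [Joined, hset, hset] at this
  · simp only [St.set_tick, St.tock_tick]
    omega
  · exact hw.imp fun w hw b => (hset b).trans (hw b)
  · change s₂.reg .differ = 0 → (nodeSet n s₂ _ ∈ _ ↔ nodeSet n s₂ _ ∈ _)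
    rw [hf₂.reg _ (by decide)]
    simpa only [St.tock_reg, hset] using hacc
  · exact .rel _ _ (hset false ▸ hset true ▸ hm)
  · simp only [St.tock_tick] at ht'
    omega

theorem runs_mergeSuccessors {a : Fin σ} {x : Bool → ℕ} (hI : Inv U.toDFA S n s)
    (hL : Loaded U n e s) (hN : (reached U.toDFA S).encard ≤ N) (hB : N * (n + 1) ≤ B)
    (ha : s.reg .letter = a) (hx : ∀ b, s.arr (.queue b) (s.reg .head) = x b)
    (hhead : s.reg .head < s.reg .tail) :
    Runs B inp mergeSuccessors s fun s' => Inv U.toDFA S n s' ∧ Grows n s s' ∧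
      EqvGen (Merged n s') (U.stepSet (nodeSet n s (x false)) a)
        (U.stepSet (nodeSet n s (x true)) a) ∧
      s'.tick ≤ s.tick + (50 * n + 20 * e + 6 * Nat.log 2 N + 60) := by
  obtain ⟨w, hw⟩ := hI.queue _ hhead
  simp only [hx] at hw
  rw [mergeSuccessors, runs_seq]
  refine (runs_successor hI hL hN hB ha (hx false) (hw false).1).mono
    fun s₁ hf₁ ⟨hI₁, hG₁, hcur₁, _⟩ => ?_
  have hL₁ := hL.of_frame hf₁ (by decide) (by decide)
  have hx₁ : s₁.arr (.queue true) (s₁.reg .head) = x true := by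
    rw [hf₁.arr _ (by decide), hf₁.reg _ (by decide), hx]
  rw [runs_seq]
  refine (runs_successor hI₁ hL₁ hN hB ((hf₁.reg _ (by decide)).trans ha) hx₁
    (hG₁.nodes_subset (hw true).1)).mono fun s₂ hf₂ ⟨hI₂, hG₂, hcur₂, _⟩ => ?_
  rw [hG₁.nodeSet_eq _ (hw true).1] at hcur₂
  refine (runs_merge (T := fun b => U.stepSet (nodeSet n s (x b)) a) hI₂
    (hL₁.of_frame hf₂ (by decide) (by decide)) hN (by nlinarith)
    (Bool.forall_bool.2 ⟨hcur₁.of_grows hG₂ fun v hv => hf₂.reg v (by revert v; decide), hcur₂⟩)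
    ⟨w ++ [a], fun b => ?_⟩).mono fun s' _ ⟨hI', hG', hm, _⟩ =>
    ⟨hI', (hG₁.trans hG₂).trans hG', hm, by omega⟩
  rw [DFA.evalFrom_append_singleton, (hw b).2]
  rfl

theorem runs_mergeLetters {x : Bool → ℕ} (hI : Inv U.toDFA S n s) (hL : Loaded U n e s)
    (hN : (reached U.toDFA S).encard ≤ N) (hB : N * (n + 1) ≤ B)
    (hx : ∀ b, s.arr (.queue b) (s.reg .head) = x b) (hhead : s.reg .head < s.reg .tail) :
    Runs B inp (.for .letter .alphabet mergeSuccessors) s fun s' =>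
      Inv U.toDFA S n s' ∧ Grows n s s' ∧
      (∀ a, EqvGen (Merged n s') (U.stepSet (nodeSet n s (x false)) a)
        (U.stepSet (nodeSet n s (x true)) a)) ∧
      s'.tick ≤ s.tick + ((50 * n + 20 * e + 6 * Nat.log 2 N + 62) * σ + 2) := by
  obtain ⟨w, hw⟩ := hI.queue _ hhead
  simp only [hx] at hw
  refine runs_for (fun k s' => Inv U.toDFA S n s' ∧ Grows n s s' ∧
      (∀ a : Fin σ, a < k → EqvGen (Merged n s') (U.stepSet (nodeSet n s (x false)) a)
        (U.stepSet (nodeSet n s (x true)) a)) ∧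
      s'.tick ≤ s.tick + ((50 * n + 20 * e + 6 * Nat.log 2 N + 62) * k + 1)) σ hL.alphabet
    (by decide) (by decide) (by decide)
    ⟨hI.congr (by simp) (by simp), .congr (by simp) (by simp), by simp, by simp⟩ ?_ ?_
  · rintro k s' hk hletter - hf ⟨hI', hG, hm, _⟩
    have hhead' : s'.reg .head = s.reg .head := hf.reg _ (by decide)
    have hnode (b : Bool) : nodeSet n s'.tock (x b) = nodeSet n s (x b) :=
      hG.nodeSet_eq _ (hw b).1
    refine (runs_mergeSuccessors (s := s'.tock) (a := ⟨k, hk⟩) (x := x)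
      (hI'.congr (by simp) (by simp)) (hL.of_frame ⟨hf.reg, hf.arr⟩ (by decide) (by decide)) hN hB
      hletter (fun b => ?_) ?_).mono fun s'' _ ⟨hI'', hG', hm', ht⟩ => ?_
    · rw [St.tock_reg, St.tock_arr, hhead', hG.queue_eq b _ hhead, hx]
    · exact hhead'.trans_lt (hhead.trans_le hG.tail_le)
    · rw [hnode, hnode] at hm'
      refine ⟨hI''.congr (by simp) (by simp), (hG.trans (.congr (by simp) (by simp))).trans
        (hG'.trans (.congr (by simp) (by simp))), fun a ha => ?_, ?_⟩
      · rcases Nat.lt_succ_iff_lt_or_eq.1 ha with ha | rfl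
        · exact hG'.eqvGen (hI'.congr (by simp) (by simp)) (hm a ha)
        · exact hm'
      · simp only [St.set_tick, St.tock_tick, mul_add_one] at ht ⊢
        omega
  · rintro s' - ⟨hI', hG, hm, _⟩
    exact ⟨hI'.congr (by simp) (by simp), hG.trans (.congr (by simp) (by simp)),
      fun a => hm a a.isLt, by simp only [St.tock_tick]; omega⟩

/-- All successors of the pairs in the first `h` places of the queue have been merged. -/
def Explored (U : NFA (Fin σ) ℕ) (n h : ℕ) (s : State) : Prop :=
  ∀ i < h, ∀ a, EqvGen (Merged n s) (U.stepSet (nodeSet n s (s.arr (.queue false) i)) a)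
    (U.stepSet (nodeSet n s (s.arr (.queue true) i)) a)

theorem Explored.of_grows {h : ℕ} {s' : State} (hE : Explored U n h s) (hI : Inv U.toDFA S n s)
    (hG : Grows n s s') (hh : h ≤ s.reg .tail) : Explored U n h s' := by
  intro i hi a
  have hi' := hi.trans_le hh
  obtain ⟨w, hw⟩ := hI.queue i hi'
  rw [hG.queue_eq _ i hi', hG.queue_eq _ i hi', hG.nodeSet_eq _ (hw _).1, hG.nodeSet_eq _ (hw _).1]
  exact hG.eqvGen hI (hE i hi a)

theorem Explored.evalFrom_mem_accept_iff (hE : Explored U n (s.reg .tail) s)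
    (hI : Inv U.toDFA S n s) (hdiffer : s.reg .differ = 0) {T T' : Set ℕ}
    (h : EqvGen (Merged n s) T T') (w : List (Fin σ)) :
    U.toDFA.evalFrom T w ∈ U.toDFA.accept ↔ U.toDFA.evalFrom T' w ∈ U.toDFA.accept := by
  refine evalFrom_mem_accept_iff_of_eqvGen (hI.of_differ_eq hdiffer) ?_ h w
  rintro _ _ ⟨i, hi, rfl, rfl⟩ a
  exact hE i hi a

theorem runs_exploreHead (hI : Inv U.toDFA S n s) (hL : Loaded U n e s)
    (hE : Explored U n (s.reg .head) s) (hN : (reached U.toDFA S).encard ≤ N)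
    (hB : N * (n + 1) ≤ B) (hhead : s.reg .head < s.reg .tail) :
    Runs B inp (.for .letter .alphabet mergeSuccessors ;; .inc .head) s fun s' =>
      Inv U.toDFA S n s' ∧ Grows n s s' ∧ Explored U n (s'.reg .head) s' ∧
      s'.reg .head = s.reg .head + 1 ∧
      s'.tick ≤ s.tick + ((50 * n + 20 * e + 6 * Nat.log 2 N + 62) * σ + 3) := by
  obtain ⟨w, hw⟩ := hI.queue _ hhead
  rw [runs_seq]
  refine (runs_mergeLetters hI hL hN hB (fun _ => rfl) hhead).mono fun s₁ hf ⟨hI₁, hG, hm, _⟩ => ?_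
  have hhead₁ : s₁.reg .head = s.reg .head := hf.reg _ (by decide)
  have hE₁ : Explored U n (s.reg .head + 1) s₁ := by
    intro i hi
    rcases Nat.lt_succ_iff_lt_or_eq.1 hi with hi | rfl
    · exact hE.of_grows hI hG hhead.le i hi
    · rwa [hG.queue_eq _ _ hhead, hG.queue_eq _ _ hhead, hG.nodeSet_eq _ (hw _).1,
        hG.nodeSet_eq _ (hw _).1]
  have hG' : Grows n s₁ (s₁.set .head (s.reg .head + 1)) := .congr (by simp) (by simp)
  rw [runs_inc, hhead₁]
  refine ⟨hI₁.congr (by simp) (by simp), hG.trans hG', ?_, by simp,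
    by simp only [St.set_tick]; omega⟩
  rw [St.set_reg, if_pos rfl]
  exact hE₁.of_grows hI₁ hG' (hhead.trans_le hG.tail_le)

theorem runs_explore (hI : Inv U.toDFA S n s) (hL : Loaded U n e s) (hhead : s.reg .head = 0)
    (hN : (reached U.toDFA S).encard ≤ N) (hB : N * (n + 1) ≤ B) :
    Runs B inp explore s fun s' => Inv U.toDFA S n s' ∧ Grows n s s' ∧
      Explored U n (s'.reg .tail) s' ∧
      s'.tick ≤ s.tick + (((50 * n + 20 * e + 6 * Nat.log 2 N + 62) * σ + 4) * N + 1) := by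
  refine runs_loop (fun s' => Inv U.toDFA S n s' ∧ Grows n s s' ∧
      Explored U n (s'.reg .head) s' ∧ s'.reg .head ≤ s'.reg .tail ∧
      s'.tick ≤ s.tick + ((50 * n + 20 * e + 6 * Nat.log 2 N + 62) * σ + 4) * s'.reg .head)
    (fun s' => N - s'.reg .head)
    ⟨hI, .congr (by simp) (by simp), by simp [hhead, Explored], by simp [hhead]⟩ ?_ ?_
  · rintro s' hf ⟨hI', hG, hE, -, _⟩ hlt
    have hlt' : s'.reg .head < N :=
      hlt.trans_le (hI'.tail_le.trans (hI'.numNodes_le hN))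
    refine (runs_exploreHead (s := s'.tock) (hI'.congr (by simp) (by simp))
      (hL.of_frame ⟨hf.reg, hf.arr⟩ (by decide) (by decide)) ?_ hN hB hlt).mono
      fun s'' _ ⟨hI'', hG', hE', hhead', ht⟩ => ?_
    · exact hE.of_grows hI' (.congr (by simp) (by simp)) hlt.le
    · refine ⟨⟨hI'', (hG.trans (.congr (by simp) (by simp))).trans hG', hE', ?_, ?_⟩, ?_⟩
      · exact hhead'.trans_le (Nat.succ_le_of_lt (hlt.trans_le hG'.tail_le))
      · simp only [St.tock_tick, St.tock_reg] at ht hhead'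
        rw [hhead', mul_add_one]
        omega
      · simp only [St.tock_reg] at hhead'
        omega
  · rintro s' - ⟨hI', hG, hE, hle, ht⟩ hb
    have hhead' : s'.reg .head = s'.reg .tail := hle.antisymm (not_lt.1 hb)
    refine ⟨hI'.congr (by simp) (by simp), hG.trans (.congr (by simp) (by simp)),
      (hhead' ▸ hE).of_grows hI' (.congr (by simp) (by simp)) le_rfl, ?_⟩
    have := Nat.mul_le_mul_left ((50 * n + 20 * e + 6 * Nat.log 2 N + 62) * σ + 4)
      (hhead'.trans_le (hI'.tail_le.trans (hI'.numNodes_le hN)))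
    simp only [St.tock_tick]
    omega

/-! ### Equivalence of two sets of states -/

/-- The state before the test for equivalence: the automaton is loaded, nothing has been
allocated, and the two automata start in `start false` and `start true`. -/
structure Ready (U : NFA (Fin σ) ℕ) (n e : ℕ) (s : State) : Prop where
  loaded : Loaded U n e s
  start_lt : ∀ b, s.reg (.start b) < n
  reg_eq_zero : ∀ v ∈ [Var.fresh, .numNodes, .top, .head, .tail, .differ], s.reg v = 0
  arr_eq_zero : ∀ k ∈ [Arr.next, .child false, .child true, .leaf, .parent], s.arr k = fun _ => 0

theorem Ready.inv (h : Ready U n e s) : Inv U.toDFA S n (s.set .fresh 1) := by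
  obtain ⟨-, -, hreg, harr⟩ := h
  simp only [List.forall_mem_cons, List.not_mem_nil, false_implies, implies_true, and_true]
    at hreg harr
  obtain ⟨-, hcnt, htop, -, htail, hdiffer⟩ := hreg
  obtain ⟨-, hchild, hchild', hleaf, hparent⟩ := harr
  have hchildren : children s = fun _ _ => 0 := funext fun b => by cases b <;> assumption
  have hnodes : nodes (s.set .fresh 1) = ∅ := by simp [nodes, hcnt]
  refine ⟨⟨?_, ?_, ?_, ?_, ?_⟩, ?_, ?_, ?_, ?_, ?_⟩
  · rw [children_set, hchildren]
    exact ⟨by simp, by simp, by simp⟩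
  · simp [hleaf]
  · simp [hnodes]
  · simp [hnodes]
  · simp [hcnt, htop]
  · simpa [hcnt, htail, hparent] using Forest.empty
  · simp [hnodes]
  · simp [htail]
  · simp [hdiffer]
  · simp [Merged, htail]

theorem runs_seed {b : Bool} (hI : Inv U.toDFA S n s) (hL : Loaded U n e s)
    (hempty : bufferSet n s = ∅) (hstart : s.reg (.start b) < n)
    (hS : S b = {s.reg (.start b)}) :
    Runs B inp (seed b) s fun s' => Inv U.toDFA S n s' ∧ Grows n s s' ∧
      bufferSet n s' = ∅ ∧ Current U.toDFA n b (S b) s' ∧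
      s'.tick ≤ s.tick + (22 * n + 17) := by
  have hone : s.reg .one ≠ 0 := by simp [hL.one]
  have hbuffer : bufferSet n (s.put .next (s.reg (.start b)) (s.reg .one)) = S b := by
    rw [bufferSet_put s hstart hone, hempty, hS, insert_empty_eq]
  rw [seed, runs_seq, runs_store, runs_seq]
  refine (runs_record (b := b) (s := s.put .next (s.reg (.start b)) (s.reg .one))
    (hI.congr (by simp) (by simp)) (hL.of_frame (c := .store .next (.start b) .one)
      (Frame.put (by cases b <;> decide) s _ _) (by cases b <;> decide) (by cases b <;> decide))
      ?_).mono
    fun s₁ hf ⟨hI₁, hG, hcur, ht⟩ => ?_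
  · rw [hbuffer]
    exact Set.mem_iUnion.2 ⟨b, [], rfl⟩
  rw [hbuffer] at hcur
  have hnext : s₁.arr .next = Function.update (s.arr .next) (s.reg (.start b)) 1 :=
    (hf.arr .next (by cases b <;> decide)).trans (by simp [hL.one])
  have hstart₁ : s₁.reg (.start b) = s.reg (.start b) := hf.reg _ (by cases b <;> decide)
  have hzero : s₁.reg .zero = 0 := (hf.reg _ (by cases b <;> decide)).trans hL.zero
  have hG' : Grows n s₁ (s₁.put .next (s₁.reg (.start b)) (s₁.reg .zero)) :=
    .congr (by simp) (by simp)
  rw [runs_store]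
  refine ⟨hI₁.congr (by simp) (by simp), .trans (.congr (by simp) (by simp)) (hG.trans hG'), ?_,
    hcur.of_grows hG' (by simp), ?_⟩
  · refine Set.eq_empty_of_forall_notMem fun j hj => ?_
    rcases eq_or_ne j (s.reg (.start b)) with rfl | hne
    · simp [bufferSet, hstart₁, hzero] at hj
    · have : j ∈ bufferSet n s := by simpa [bufferSet, hstart₁, hnext, hne] using hj
      rwa [hempty] at this
  · simp only [St.put_tick] at ht ⊢
    omega

theorem runs_seeds (h : Ready U n e s) (hS : ∀ b, S b = {s.reg (.start b)}) :
    Runs B inp seeds s fun s' => Inv U.toDFA S n s' ∧ (∀ b, Current U.toDFA n b (S b) s') ∧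
      s'.tick ≤ s.tick + (44 * n + 35) := by
  have hL : Loaded U n e (s.set .fresh 1) :=
    h.loaded.of_frame (Frame.set (c := .inc .fresh) (by decide) s 1) (by decide) (by decide)
  have hempty : bufferSet n (s.set .fresh 1) = ∅ := by
    simp [bufferSet, h.arr_eq_zero .next (by decide)]
  have hfresh : s.reg .fresh = 0 := h.reg_eq_zero _ (by decide)
  rw [seeds, runs_seq, runs_inc, hfresh, runs_seq]
  refine (runs_seed (b := false) h.inv hL hempty (h.start_lt _) (hS _)).mono
    fun s₁ hf₁ ⟨hI₁, _, hempty₁, hcur₁, _⟩ => ?_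
  have hstart : s₁.reg (.start true) = s.reg (.start true) := hf₁.reg _ (by decide)
  refine (runs_seed (b := true) hI₁ (hL.of_frame hf₁ (by decide) (by decide)) hempty₁
    (hstart ▸ h.start_lt _) (hstart ▸ hS _)).mono fun s₂ hf₂ ⟨hI₂, hG₂, _, hcur₂, _⟩ => ?_
  simp only [St.set_tick] at *
  exact ⟨hI₂, Bool.forall_bool.2
    ⟨hcur₁.of_grows hG₂ fun v hv => hf₂.reg v (by revert v; decide), hcur₂⟩, by omega⟩

theorem runs_equivalence (h : Ready U n e s) (hS : ∀ b, S b = {s.reg (.start b)})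
    (hN : (reached U.toDFA S).encard ≤ N) (hB : N * (n + 1) ≤ B) :
    Runs B inp equivalence s fun s' =>
      ((∀ w, U.toDFA.evalFrom (S false) w ∈ U.toDFA.accept ↔
        U.toDFA.evalFrom (S true) w ∈ U.toDFA.accept) → s'.reg .result = 1) ∧
      ((¬ ∀ w, U.toDFA.evalFrom (S false) w ∈ U.toDFA.accept ↔
        U.toDFA.evalFrom (S true) w ∈ U.toDFA.accept) → s'.reg .result = 0) ∧
      s'.tick ≤ s.tick + (((50 * n + 20 * e + 6 * Nat.log 2 N + 62) * σ + 4) * N + 44 * n +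
        6 * Nat.log 2 N + 60) := by
  rw [equivalence, runs_seq]
  refine (runs_seeds h hS).mono fun s₁ hf₁ ⟨hI₁, hcur, _⟩ => ?_
  have hL₁ := h.loaded.of_frame hf₁ (by decide) (by decide)
  rw [runs_seq]
  refine (runs_merge hI₁ hL₁ hN (by nlinarith) hcur ⟨[], fun _ => rfl⟩).mono
    fun s₂ hf₂ ⟨hI₂, _, hm, _⟩ => ?_
  have hL₂ := hL₁.of_frame hf₂ (by decide) (by decide)
  have hhead : s₂.reg .head = 0 := by
    rw [hf₂.reg _ (by decide), hf₁.reg _ (by decide)]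
    exact h.reg_eq_zero _ (by decide)
  rw [runs_seq]
  refine (runs_explore hI₂ hL₂ hhead hN hB).mono fun s₃ hf₃ ⟨hI₃, hG₃, hE, _⟩ => ?_
  have hL₃ := hL₂.of_frame hf₃ (by decide) (by decide)
  simp only [runs_ite_eq, runs_move, runs_zero, hL₃.zero, hL₃.one, St.set_reg, St.set_tick,
    St.tock_reg, St.tock_tick, if_true]
  refine ⟨fun h0 => ⟨fun _ => trivial, fun hne => ?_, by omega⟩,
    fun h0 => ⟨fun heq => ?_, fun _ => trivial, by omega⟩⟩
  · exact absurd (hE.evalFrom_mem_accept_iff hI₃ h0 (hG₃.eqvGen hI₂ hm)) hne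
  · obtain ⟨w, hw⟩ := hI₃.of_differ_ne h0
    exact absurd (heq w) hw

end Exploration

/-! ### Two automata in one -/

section Glue

variable {α P Q R : Type*} {M : NFA α P} {A : NFA α Q} {U : NFA α R} {ι : P → R} {κ : Q → R}

/-- `ι` is a functional bisimulation from `M` to `U`, start states aside: hence `M` from a state `u`
and `U` from `ι u` accept the same words. -/
structure IsBisim (M : NFA α P) (U : NFA α R) (ι : P → R) : Prop where
  step : ∀ u a, U.step (ι u) a = ι '' M.step u a
  accept : ∀ u, ι u ∈ U.accept ↔ u ∈ M.accept

theorem IsBisim.stepSet_image (h : IsBisim M U ι) (S : Set P) (a : α) :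
    U.stepSet (ι '' S) a = ι '' M.stepSet S a := by
  simp only [NFA.stepSet, Set.biUnion_image, Set.image_iUnion, h.step]

theorem IsBisim.evalFrom_image (h : IsBisim M U ι) (S : Set P) (w : List α) :
    U.evalFrom (ι '' S) w = ι '' M.evalFrom S w := by
  induction w generalizing S with
  | nil => rfl
  | cons a w ih => rw [NFA.evalFrom_cons, NFA.evalFrom_cons, h.stepSet_image, ih]

theorem IsBisim.evalFrom_mem_accept_iff (h : IsBisim M U ι) (w : List α) :
    U.toDFA.evalFrom (ι '' M.start) w ∈ U.toDFA.accept ↔ w ∈ M.accepts := by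
  change (∃ u ∈ U.evalFrom (ι '' M.start) w, u ∈ U.accept) ↔ _
  simp only [h.evalFrom_image, Set.exists_mem_image, h.accept]
  exact exists_congr fun u => and_comm

theorem IsBisim.encard_range_evalFrom_le (h : IsBisim M U ι) :
    (Set.range (U.toDFA.evalFrom (ι '' M.start))).encard ≤ (Set.range M.eval).encard := by
  have hrange : Set.range (U.toDFA.evalFrom (ι '' M.start)) = Set.image ι '' Set.range M.eval := by
    rw [← Set.range_comp]
    exact congrArg _ (funext fun w => h.evalFrom_image _ w)
  exact hrange ▸ Set.encard_image_le _ _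

theorem encard_reached_le {α T : Type*} (D : DFA α T) (S : Bool → T) : (reached D S).encard ≤
    (Set.range (D.evalFrom (S false))).encard + (Set.range (D.evalFrom (S true))).encard := by
  have hunion : reached D S =
      Set.range (D.evalFrom (S false)) ∪ Set.range (D.evalFrom (S true)) := by
    ext
    simp [reached]
  exact hunion ▸ Set.encard_union_le _ _

/-- The union of the images of `M` along `ι` and of `A` along `κ`. -/
def glue (ι : P → R) (κ : Q → R) (M : NFA α P) (A : NFA α Q) : NFA α R where
  step x a := {y | (∃ u v, v ∈ M.step u a ∧ ι u = x ∧ ι v = y) ∨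
    ∃ u v, v ∈ A.step u a ∧ κ u = x ∧ κ v = y}
  start := ι '' M.start ∪ κ '' A.start
  accept := ι '' M.accept ∪ κ '' A.accept

theorem isBisim_glue_left (hι : ι.Injective) (h : ∀ u v, ι u ≠ κ v) :
    IsBisim M (glue ι κ M A) ι := by
  refine ⟨fun u a => Set.ext fun y => ?_, fun u => ?_⟩
  · simp [glue, hι.eq_iff, fun v => (h u v).symm]
  · simp [glue, hι.eq_iff, fun v => (h u v).symm]

theorem glue_swap (ι : P → R) (κ : Q → R) (M : NFA α P) (A : NFA α Q) :
    glue ι κ M A = glue κ ι A M := by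
  simp only [glue, Set.union_comm, or_comm]

theorem isBisim_glue_right (hκ : κ.Injective) (h : ∀ u v, ι u ≠ κ v) :
    IsBisim A (glue ι κ M A) κ :=
  glue_swap ι κ M A ▸ isBisim_glue_left hκ fun u v => (h v u).symm

end Glue

/-! ### Reading the input -/

/-- From position `p` on, `inp` holds the list. -/
def HoldsAt (inp : ℕ → ℕ) : ℕ → List ℕ → Prop
  | _, [] => True
  | p, x :: l => inp p = x ∧ HoldsAt inp (p + 1) l

theorem holdsAt_getD (l' l : List ℕ) : HoldsAt ((l' ++ l).getD · 0) l'.length l := by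
  induction l generalizing l' with
  | nil => trivial
  | cons x l ih => exact ⟨by simp, by simpa using ih (l' ++ [x])⟩

/-- The edges in the memory, as triples of source, target and label. -/
def edgeList (s : State) : List (ℕ × ℕ × ℕ) :=
  (List.range (s.reg .numEdges)).map fun k => (s.arr .source k, s.arr .target k, s.arr .label k)

/-- The final states in the memory. -/
def finalSet (s : State) : Set ℕ := {v | s.arr .final v ≠ 0}

theorem mem_edgeList {s : State} {u v a : ℕ} : (u, v, a) ∈ edgeList s ↔
    ∃ k < s.reg .numEdges, s.arr .source k = u ∧ s.arr .target k = v ∧ s.arr .label k = a := by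
  simp [edgeList]

theorem edgeList_eq_append {s s' : State} {u v a : ℕ}
    (hnum : s'.reg .numEdges = s.reg .numEdges + 1)
    (hsource : s'.arr .source = Function.update (s.arr .source) (s.reg .numEdges) u)
    (htarget : s'.arr .target = Function.update (s.arr .target) (s.reg .numEdges) v)
    (hlabel : s'.arr .label = Function.update (s.arr .label) (s.reg .numEdges) a) :
    edgeList s' = edgeList s ++ [(u, v, a)] := by
  rw [edgeList, hnum, List.range_succ, List.map_append, List.map_singleton, hsource, htarget,
    hlabel, Function.update_self, Function.update_self, Function.update_self]
  congr 1
  refine List.map_congr_left fun k hk => ?_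
  have hne : k ≠ s.reg .numEdges := (List.mem_range.1 hk).ne
  simp only [Function.update_of_ne hne]

/-- The state `u` of an automaton in the input, if `n` states precede those of the automaton. -/
def offset {m : ℕ} (n : ℕ) (u : Fin m) : ℕ := n + u

/-- The edge `e` of an automaton in the input, if `n` states precede those of the automaton. -/
def offsetEdge {m σ : ℕ} (n : ℕ) (e : Fin m × Fin m × Fin σ) : ℕ × ℕ × ℕ :=
  (offset n e.1, offset n e.2.1, e.2.2)

theorem offset_injective {m : ℕ} (n : ℕ) : (offset n : Fin m → ℕ).Injective :=
  (add_right_injective n).comp Fin.val_injective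

theorem mem_map_offsetEdge {m σ n u v : ℕ} {a : Fin σ} {es : List (Fin m × Fin m × Fin σ)} :
    (u, v, (a : ℕ)) ∈ es.map (offsetEdge n) ↔
      ∃ x y, (x, y, a) ∈ es ∧ offset n x = u ∧ offset n y = v := by
  simp [offsetEdge, Fin.val_inj]

section Read

variable {B : ℕ} {inp : ℕ → ℕ} {s : State} {m σ : ℕ} {Q : State → Prop}

theorem runs_readNext {d : Var} {x : ℕ} {l : List ℕ} (hd : d ≠ .inputPtr)
    (h : HoldsAt inp (s.reg .inputPtr) (x :: l)) : Runs B inp (readNext d) s Q ↔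
      Q ((s.set d x).set .inputPtr (s.reg .inputPtr + 1)) := by
  simp only [readNext, runs_seq, runs_input, runs_inc, St.set_reg, hd.symm, if_false, h.1]

theorem runs_readState {d : Var} {u : Fin m} {l : List ℕ} (hd : d ≠ .inputPtr)
    (hd' : d ≠ .numStates) (hB : s.reg .numStates + m ≤ B)
    (h : HoldsAt inp (s.reg .inputPtr) (u :: l)) :
    Runs B inp (readState d) s Q ↔ Q
      (((s.set d u).set .inputPtr (s.reg .inputPtr + 1)).set d (offset (s.reg .numStates) u)) := by
  have hle : s.reg .numStates + u ≤ B := by omega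
  simp only [readState, runs_seq, runs_readNext hd h, runs_add, St.set_reg, reduceCtorEq, hd,
    hd'.symm, if_true, if_false, hle, true_and, offset]

theorem runs_readEdge {e : Fin m × Fin m × Fin σ} {l : List ℕ}
    (hB : s.reg .numStates + m ≤ B)
    (h : HoldsAt inp (s.reg .inputPtr) ([(e.1 : ℕ), (e.2.1 : ℕ), (e.2.2 : ℕ)] ++ l)) :
    Runs B inp readEdge s fun s' => HoldsAt inp (s'.reg .inputPtr) l ∧
      edgeList s' = edgeList s ++ [offsetEdge (s.reg .numStates) e] ∧
      s'.tick = s.tick + 12 := by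
  rw [readEdge, runs_seq, runs_readState (by decide) (by decide) hB h, runs_seq, runs_store,
    runs_seq, runs_readState (by decide) (by decide) (by simpa using hB) (by simpa using h.2),
    runs_seq, runs_store, runs_seq, runs_readNext (by decide) (by simpa using h.2.2), runs_seq,
    runs_store, runs_inc]
  refine ⟨by simpa using h.2.2.2, edgeList_eq_append ?_ ?_ ?_ ?_, by simp⟩ <;> simp

theorem runs_readEdges {es : List (Fin m × Fin m × Fin σ)} {l : List ℕ}
    (hB : s.reg .numStates + m ≤ B) (h : HoldsAt inp (s.reg .inputPtr) (es.length ::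
      ((es.flatMap fun e => [(e.1 : ℕ), (e.2.1 : ℕ), (e.2.2 : ℕ)]) ++ l))) :
    Runs B inp readEdges s fun s' => HoldsAt inp (s'.reg .inputPtr) l ∧
      edgeList s' = edgeList s ++ es.map (offsetEdge (s.reg .numStates)) ∧
      s'.tick ≤ s.tick + (14 * es.length + 4) := by
  rw [readEdges, runs_seq, runs_readNext (by decide) h]
  refine runs_for (fun k s' => HoldsAt inp (s'.reg .inputPtr)
      (((es.drop k).flatMap fun e => [(e.1 : ℕ), (e.2.1 : ℕ), (e.2.2 : ℕ)]) ++ l) ∧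
      edgeList s' = edgeList s ++ (es.take k).map (offsetEdge (s.reg .numStates)) ∧
      s'.tick ≤ s.tick + (14 * k + 3)) es.length (by simp) (by decide) (by decide) (by decide)
    ⟨by simpa using h.2, by simp [edgeList], by simp⟩ ?_ ?_
  · rintro k s' hk - - hf ⟨hl, hedges, ht⟩
    have hn : s'.reg .numStates = s.reg .numStates := (hf.reg _ (by decide)).trans (by simp)
    rw [List.drop_eq_getElem_cons hk, List.flatMap_cons, List.append_assoc] at hl
    refine (runs_readEdge (s := s'.tock) (by simpa [hn] using hB) hl).mono
      fun s₁ _ ⟨hl₁, hedges₁, ht₁⟩ => ⟨by simpa using hl₁, ?_, ?_⟩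
    · rw [List.take_succ_eq_append_getElem hk, List.map_append, ← List.append_assoc, ← hedges,
        ← hn]
      exact hedges₁
    · simp only [St.tock_tick, St.set_tick] at ht₁ ⊢
      omega
  · rintro s' - ⟨hl, hedges, ht⟩
    refine ⟨by simpa using hl, by simpa [edgeList] using hedges, ?_⟩
    simp only [St.tock_tick]
    omega

theorem runs_readFinal {u : Fin m} {l : List ℕ} (hB : s.reg .numStates + m ≤ B)
    (hone : s.reg .one = 1) (h : HoldsAt inp (s.reg .inputPtr) (u :: l)) :
    Runs B inp readFinal s fun s' => HoldsAt inp (s'.reg .inputPtr) l ∧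
      finalSet s' = insert (offset (s.reg .numStates) u) (finalSet s) ∧ s'.tick = s.tick + 4 := by
  rw [readFinal, runs_seq, runs_readState (by decide) (by decide) hB h, runs_store]
  refine ⟨by simpa using h.2, Set.ext fun v => ?_, by simp⟩
  rcases eq_or_ne v (offset (s.reg .numStates) u) with rfl | hv
  · simp [finalSet, hone]
  · simp [finalSet, hv]

theorem runs_readFinals {fs : List (Fin m)} {l : List ℕ} (hB : s.reg .numStates + m ≤ B)
    (hone : s.reg .one = 1)
    (h : HoldsAt inp (s.reg .inputPtr) (fs.length :: (fs.map Fin.val ++ l))) :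
    Runs B inp readFinals s fun s' => HoldsAt inp (s'.reg .inputPtr) l ∧
      finalSet s' = finalSet s ∪ offset (s.reg .numStates) '' {f | f ∈ fs} ∧
      s'.tick ≤ s.tick + (6 * fs.length + 4) := by
  rw [readFinals, runs_seq, runs_readNext (by decide) h]
  refine runs_for (fun k s' =>
      HoldsAt inp (s'.reg .inputPtr) ((fs.drop k).map Fin.val ++ l) ∧
      finalSet s' = finalSet s ∪ offset (s.reg .numStates) '' {f | f ∈ fs.take k} ∧
      s'.tick ≤ s.tick + (6 * k + 3)) fs.length (by simp) (by decide) (by decide) (by decide)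
    ⟨by simpa using h.2, by simp [finalSet], by simp⟩ ?_ ?_
  · rintro k s' hk - - hf ⟨hl, hfinals, ht⟩
    have hn : s'.reg .numStates = s.reg .numStates := (hf.reg _ (by decide)).trans (by simp)
    have hone' : s'.reg .one = 1 := (hf.reg _ (by decide)).trans (by simpa using hone)
    rw [List.drop_eq_getElem_cons hk, List.map_cons, List.cons_append] at hl
    refine (runs_readFinal (s := s'.tock) (by simpa [hn] using hB) hone' hl).mono
      fun s₁ _ ⟨hl₁, hfinals₁, ht₁⟩ => ⟨by simpa using hl₁, ?_, ?_⟩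
    · have htake : {f | f ∈ fs.take (k + 1)} = insert fs[k] {f | f ∈ fs.take k} := by
        rw [List.take_succ_eq_append_getElem hk]
        ext
        simp only [List.mem_append, List.mem_singleton, Set.mem_insert_iff, Set.mem_ofPred_eq,
          or_comm]
      rw [htake, Set.image_insert_eq, Set.union_insert, ← hfinals, ← hn]
      exact hfinals₁
    · simp only [St.tock_tick, St.set_tick] at ht₁ ⊢
      omega
  · rintro s' - ⟨hl, hfinals, ht⟩
    rw [List.drop_length, List.map_nil, List.nil_append] at hl
    rw [List.take_length] at hfinals
    refine ⟨hl, hfinals, ?_⟩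
    simp only [St.tock_tick]
    omega

theorem encodeData_eq (q : Fin m) (es : List (Fin m × Fin m × Fin σ)) (fs : List (Fin m)) :
    Colex.encodeData q es fs = m :: q :: es.length ::
      ((es.flatMap fun e => [(e.1 : ℕ), (e.2.1 : ℕ), (e.2.2 : ℕ)]) ++
        fs.length :: fs.map Fin.val) := by
  simp [Colex.encodeData, List.map_eq_flatMap]

theorem runs_readAutomaton {b : Bool} {q : Fin m} {es : List (Fin m × Fin m × Fin σ)}
    {fs : List (Fin m)} {l : List ℕ} (hB : s.reg .numStates + m ≤ B) (hone : s.reg .one = 1)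
    (h : HoldsAt inp (s.reg .inputPtr) (Colex.encodeData q es fs ++ l)) :
    Runs B inp (readAutomaton b) s fun s' => HoldsAt inp (s'.reg .inputPtr) l ∧
      s'.reg .numStates = s.reg .numStates + m ∧
      s'.reg (.start b) = offset (s.reg .numStates) q ∧
      edgeList s' = edgeList s ++ es.map (offsetEdge (s.reg .numStates)) ∧
      finalSet s' = finalSet s ∪ offset (s.reg .numStates) '' {f | f ∈ fs} ∧
      s'.tick ≤ s.tick + (14 * es.length + 6 * fs.length + 14) := by
  simp only [encodeData_eq, List.cons_append, List.append_assoc] at h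
  rw [readAutomaton, runs_seq, runs_readNext (by decide) h, runs_seq,
    runs_readState (by cases b <;> decide) (by cases b <;> decide) (by simpa using hB)
      (by simpa using h.2), runs_seq]
  refine (runs_readEdges (es := es) (l := fs.length :: (fs.map Fin.val ++ l))
    (by simpa using hB) (by simpa using h.2.2)).mono fun s₁ hf₁ ⟨hl₁, hedges₁, ht₁⟩ => ?_
  have hn₁ : s₁.reg .numStates = s.reg .numStates := (hf₁.reg _ (by decide)).trans (by simp)
  have hone₁ : s₁.reg .one = 1 := (hf₁.reg _ (by decide)).trans (by simpa using hone)
  have hfinals₁ : finalSet s₁ = finalSet s := by rw [finalSet, hf₁.arr _ (by decide)]; rfl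
  rw [runs_seq]
  refine (runs_readFinals (by rwa [hn₁]) hone₁ hl₁).mono fun s₂ hf₂ ⟨hl₂, hfinals₂, _⟩ => ?_
  have hn₂ : s₂.reg .numStates = s.reg .numStates := (hf₂.reg _ (by decide)).trans hn₁
  have hm₂ : s₂.reg .size = m :=
    (hf₂.reg _ (by decide)).trans ((hf₁.reg _ (by decide)).trans (by simp))
  have hq₂ : s₂.reg (.start b) = offset (s.reg .numStates) q :=
    (hf₂.reg _ (by cases b <;> decide)).trans ((hf₁.reg _ (by cases b <;> decide)).trans (by simp))
  have hedges₂ : edgeList s₂ = edgeList s₁ := by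
    simp only [edgeList, hf₂.reg .numEdges (by decide), hf₂.arr .source (by decide),
      hf₂.arr .target (by decide), hf₂.arr .label (by decide)]
  rw [runs_add, hn₂, hm₂]
  refine ⟨hB, by simpa using hl₂, by simp, by simpa using hq₂, ?_, ?_, ?_⟩
  · exact hedges₂.trans hedges₁
  · change finalSet s₂ = _
    rw [hfinals₂, hn₁, hfinals₁]
  · simp only [St.set_tick] at ht₁ ⊢
    omega

end Read

/-! ### The two automata in memory -/

/-- The initial state, the edges and the final states of `M`, each listed once. -/
structure IsListing {m σ : ℕ} (M : NFA (Fin σ) (Fin m)) (q : Fin m)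
    (es : List (Fin m × Fin m × Fin σ)) (fs : List (Fin m)) : Prop where
  start_eq : M.start = {q}
  nodup_edges : es.Nodup
  mem_edges : ∀ u v a, (u, v, a) ∈ es ↔ v ∈ M.step u a
  nodup_finals : fs.Nodup
  mem_finals : ∀ f, f ∈ fs ↔ f ∈ M.accept

theorem exists_isListing_of_isEncoding {m σ : ℕ} {M : NFA (Fin σ) (Fin m)} {l : List ℕ}
    (h : Colex.IsEncoding M l) : ∃ q es fs, IsListing M q es fs ∧ l = Colex.encodeData q es fs := by
  obtain ⟨q, es, fs, hstart, hes, hmem, hfs, hmem', rfl⟩ := h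
  exact ⟨q, es, fs, ⟨hstart, hes, hmem, hfs, hmem'⟩, rfl⟩

section Listing

variable {m₁ m₂ σ B : ℕ} {inp : ℕ → ℕ} {s : State} {M₁ : NFA (Fin σ) (Fin m₁)}
  {M₂ : NFA (Fin σ) (Fin m₂)} {q₁ : Fin m₁} {es₁ : List (Fin m₁ × Fin m₁ × Fin σ)}
  {fs₁ : List (Fin m₁)} {q₂ : Fin m₂} {es₂ : List (Fin m₂ × Fin m₂ × Fin σ)} {fs₂ : List (Fin m₂)}

/-- The automaton that contains both automata of the input: the states of the second one follow
those of the first one. -/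
def combined (M₁ : NFA (Fin σ) (Fin m₁)) (M₂ : NFA (Fin σ) (Fin m₂)) : NFA (Fin σ) ℕ :=
  glue (offset 0) (offset m₁) M₁ M₂

theorem offset_zero_ne_offset (u : Fin m₁) (v : Fin m₂) : offset 0 u ≠ offset m₁ v := by
  simp only [offset]
  omega

theorem isBisim_combined_left : IsBisim M₁ (combined M₁ M₂) (offset 0) :=
  isBisim_glue_left (offset_injective _) offset_zero_ne_offset

theorem isBisim_combined_right : IsBisim M₂ (combined M₁ M₂) (offset m₁) :=
  isBisim_glue_right (offset_injective _) offset_zero_ne_offset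

theorem loaded_combined (h₁ : IsListing M₁ q₁ es₁ fs₁) (h₂ : IsListing M₂ q₂ es₂ fs₂)
    (hzero : s.reg .zero = 0) (hone : s.reg .one = 1) (halphabet : s.reg .alphabet = σ)
    (hnum : s.reg .numStates = m₁ + m₂)
    (hedges : edgeList s = es₁.map (offsetEdge 0) ++ es₂.map (offsetEdge m₁))
    (hfinals : finalSet s = offset 0 '' {f | f ∈ fs₁} ∪ offset m₁ '' {f | f ∈ fs₂}) :
    Loaded (combined M₁ M₂) (m₁ + m₂) (es₁.length + es₂.length) s := by
  have hnumEdges : s.reg .numEdges = es₁.length + es₂.length := by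
    simpa [edgeList] using congrArg List.length hedges
  have hlt : ∀ e ∈ edgeList s, e.1 < m₁ + m₂ ∧ e.2.1 < m₁ + m₂ := by
    simp only [hedges, List.mem_append, List.mem_map, offsetEdge, offset]
    rintro e (⟨e, -, rfl⟩ | ⟨e, -, rfl⟩) <;> dsimp only <;> omega
  have hmem (k) (hk : k < es₁.length + es₂.length) :
      (s.arr .source k, s.arr .target k, s.arr .label k) ∈ edgeList s :=
    mem_edgeList.2 ⟨k, hnumEdges ▸ hk, rfl, rfl, rfl⟩
  refine ⟨hzero, hone, halphabet, hnum, hnumEdges, fun k hk => (hlt _ (hmem k hk)).1,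
    fun k hk => (hlt _ (hmem k hk)).2, fun u a v => ?_, fun v _ => ?_⟩
  · rw [← hnumEdges, ← mem_edgeList, hedges, List.mem_append, mem_map_offsetEdge,
      mem_map_offsetEdge]
    simp only [h₁.mem_edges, h₂.mem_edges]
    rfl
  · change _ ↔ v ∈ finalSet s
    simp only [hfinals, h₁.mem_finals, h₂.mem_finals]
    rfl

theorem runs_readInput (hB : m₁ + m₂ ≤ B)
    (h : HoldsAt inp 0 (σ :: (Colex.encodeData q₁ es₁ fs₁ ++ Colex.encodeData q₂ es₂ fs₂))) :
    Runs B inp readInput .init fun s => s.reg .one = 1 ∧ s.reg .alphabet = σ ∧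
      s.reg .numStates = m₁ + m₂ ∧
      s.reg (.start false) = offset 0 q₁ ∧ s.reg (.start true) = offset m₁ q₂ ∧
      edgeList s = es₁.map (offsetEdge 0) ++ es₂.map (offsetEdge m₁) ∧
      finalSet s = offset 0 '' {f | f ∈ fs₁} ∪ offset m₁ '' {f | f ∈ fs₂} ∧
      s.tick ≤ 14 * (es₁.length + es₂.length) + 6 * (fs₁.length + fs₂.length) + 31 := by
  rw [readInput, runs_seq, runs_inc, runs_seq, runs_readNext (by decide) h, runs_seq]
  refine (runs_readAutomaton (q := q₁) (es := es₁) (fs := fs₁)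
    (l := Colex.encodeData q₂ es₂ fs₂ ++ []) ?_ (by simp [St.init]) ?_).mono
    fun s₁ hf₁ ⟨hl, hnum₁, hstart₁, hedges₁, hfinals₁, _⟩ => ?_
  · simpa [St.init] using le_of_add_le_left hB
  · simpa [St.init] using h.2
  have hone₁ : s₁.reg .one = 1 := (hf₁.reg _ (by decide)).trans (by simp [St.init])
  have halphabet₁ : s₁.reg .alphabet = σ := (hf₁.reg _ (by decide)).trans (by simp)
  have hnum₁' : s₁.reg .numStates = m₁ := by simpa [St.init] using hnum₁
  refine (runs_readAutomaton (by rwa [hnum₁']) hone₁ hl).mono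
    fun s₂ hf₂ ⟨_, hnum₂, hstart₂, hedges₂, hfinals₂, _⟩ => ?_
  refine ⟨(hf₂.reg _ (by decide)).trans hone₁, (hf₂.reg _ (by decide)).trans halphabet₁,
    by rw [hnum₂, hnum₁'], ?_, by rw [hstart₂, hnum₁'], ?_, ?_, ?_⟩
  · rw [hf₂.reg _ (by decide), hstart₁]
    simp [St.init]
  · rw [hedges₂, hedges₁, hnum₁']
    simp [edgeList, St.init]
  · rw [hfinals₂, hfinals₁, hnum₁']
    simp [finalSet, St.init]
  · simp only [St.set_tick, St.init] at *
    omega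

theorem runs_readInput_ready (h₁ : IsListing M₁ q₁ es₁ fs₁) (h₂ : IsListing M₂ q₂ es₂ fs₂)
    (hB : m₁ + m₂ ≤ B)
    (h : HoldsAt inp 0 (σ :: (Colex.encodeData q₁ es₁ fs₁ ++ Colex.encodeData q₂ es₂ fs₂))) :
    Runs B inp readInput .init fun s =>
      Ready (combined M₁ M₂) (m₁ + m₂) (es₁.length + es₂.length) s ∧
      s.reg (.start false) = offset 0 q₁ ∧ s.reg (.start true) = offset m₁ q₂ ∧
      s.tick ≤ 14 * (es₁.length + es₂.length) + 6 * (fs₁.length + fs₂.length) + 31 := by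
  refine (runs_readInput hB h).mono
    fun s hf ⟨hone, halphabet, hnum, hstart, hstart', hedges, hfinals, ht⟩ => ⟨⟨?_, ?_, ?_, ?_⟩,
      hstart, hstart', ht⟩
  · exact loaded_combined h₁ h₂ (hf.reg _ (by decide)) hone halphabet hnum hedges hfinals
  · rw [Bool.forall_bool, hstart, hstart']
    simp only [offset]
    omega
  · exact fun v hv => hf.reg v (by revert v; decide)
  · exact fun k hk => hf.arr k (by revert k; decide)

theorem accepts_eq_iff_combined : M₁.accepts = M₂.accepts ↔
    ∀ w, (combined M₁ M₂).toDFA.evalFrom (offset 0 '' M₁.start) w ∈ (combined M₁ M₂).toDFA.accept ↔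
      (combined M₁ M₂).toDFA.evalFrom (offset m₁ '' M₂.start) w ∈
        (combined M₁ M₂).toDFA.accept := by
  simp only [isBisim_combined_left.evalFrom_mem_accept_iff,
    isBisim_combined_right.evalFrom_mem_accept_iff]
  exact Set.ext_iff

theorem runs_nfaEquivalence {N : ℕ} (h₁ : IsListing M₁ q₁ es₁ fs₁) (h₂ : IsListing M₂ q₂ es₂ fs₂)
    (hN : (Set.range M₁.eval).encard + (Set.range M₂.eval).encard ≤ N)
    (hB : N * (m₁ + m₂ + 1) ≤ B)
    (h : HoldsAt inp 0 (σ :: (Colex.encodeData q₁ es₁ fs₁ ++ Colex.encodeData q₂ es₂ fs₂))) :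
    Runs B inp nfaEquivalence .init fun s =>
      (M₁.accepts = M₂.accepts → s.reg .result = 1) ∧
      (M₁.accepts ≠ M₂.accepts → s.reg .result = 0) ∧
      s.tick ≤ ((50 * (m₁ + m₂) + 20 * (es₁.length + es₂.length) + 6 * Nat.log 2 N + 62) * σ + 4) *
        N + 44 * (m₁ + m₂) + 14 * (es₁.length + es₂.length) + 6 * (fs₁.length + fs₂.length) +
        6 * Nat.log 2 N + 91 := by
  set S : Bool → Set ℕ := fun b => cond b (offset m₁ '' M₂.start) (offset 0 '' M₁.start)
  have hreached : (reached (combined M₁ M₂).toDFA S).encard ≤ N :=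
    (encard_reached_le _ S).trans <|
      (add_le_add isBisim_combined_left.encard_range_evalFrom_le
        isBisim_combined_right.encard_range_evalFrom_le).trans hN
  have hpos : 1 ≤ N := by
    exact_mod_cast (Set.one_le_encard_iff_nonempty.2 (Set.range_nonempty M₁.eval)).trans
      (le_self_add.trans hN)
  rw [nfaEquivalence, runs_seq]
  refine (runs_readInput_ready h₁ h₂ (by nlinarith) h).mono
    fun s _ ⟨hready, hstart, hstart', _⟩ => ?_
  refine (runs_equivalence (S := S) hready ?_ hreached hB).mono
    fun s' _ ⟨htrue, hfalse, _⟩ => ⟨?_, ?_, ?_⟩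
  · rw [Bool.forall_bool, hstart, hstart']
    simp [S, h₁.start_eq, h₂.start_eq]
  · exact fun heq => htrue (accepts_eq_iff_combined.1 heq)
  · exact fun hne => hfalse (mt accepts_eq_iff_combined.2 hne)
  · omega

end Listing

open Colex

/-! ### Sizes -/

section Size

theorem card_alphabet_le {α Q : Type*} [Fintype α] [Fintype Q] {M : NFA α Q}
    (hM : IsAutomaton M) : Fintype.card α ≤ Fintype.card Q := by
  choose u v h using hM.effective
  exact Fintype.card_le_of_injective v fun a b hab =>
    hM.input_consistent (u a) (u b) (v a) a b (h a) (hab ▸ h b)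

variable {m σ : ℕ} {M : NFA (Fin σ) (Fin m)} {q : Fin m} {es : List (Fin m × Fin m × Fin σ)}
  {fs : List (Fin m)}

theorem IsListing.length_edges_le (h : IsListing M q es fs) (hM : IsAutomaton M) :
    es.length ≤ m ^ 2 := by
  have hnodup : (es.map fun e => (e.1, e.2.1)).Nodup := by
    refine List.Nodup.map_on ?_ h.nodup_edges
    rintro ⟨u, v, a⟩ ha ⟨u', v', b⟩ hb heq
    obtain ⟨rfl, rfl⟩ := Prod.mk.inj heq
    rw [hM.input_consistent u u v a b ((h.mem_edges _ _ _).1 ha) ((h.mem_edges _ _ _).1 hb)]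
  simpa [sq] using hnodup.length_le_card

theorem IsListing.length_finals_le (h : IsListing M q es fs) : fs.length ≤ m := by
  simpa using h.nodup_finals.length_le_card

theorem IsListing.card_states_le (h : IsListing M q es fs) (hM : IsAutomaton M) :
    m ≤ es.length + 1 := by
  have hsub : Finset.univ ⊆ (q :: es.map fun e => e.2.1).toFinset := by
    intro v _
    obtain ⟨x, hx⟩ := hM.reachable v
    rw [List.mem_toFinset]
    rcases List.eq_nil_or_concat x with rfl | ⟨y, a, rfl⟩
    · have hstart : v ∈ M.start := hx
      rw [h.start_eq, Set.mem_singleton_iff] at hstart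
      exact hstart ▸ List.mem_cons_self
    · rw [List.concat_eq_append, NFA.eval_append_singleton, NFA.mem_stepSet] at hx
      obtain ⟨u, -, hu⟩ := hx
      exact List.mem_cons_of_mem _ (List.mem_map.2 ⟨(u, v, a), (h.mem_edges _ _ _).2 hu, rfl⟩)
  simpa using (Finset.card_le_card hsub).trans (List.toFinset_card_le _)

theorem length_encodeData :
    (encodeData q es fs).length = 4 + 3 * es.length + fs.length := by
  simp [encodeData]
  omega

theorem encodeData_le {n : ℕ} (hm : m ≤ n) (hσ : σ ≤ n) (hes : es.length ≤ n)
    (hfs : fs.length ≤ n) : ∀ x ∈ encodeData q es fs, x ≤ n := by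
  intro x hx
  simp only [encodeData_eq, List.mem_append, List.mem_cons, List.mem_flatMap, List.mem_map,
    List.not_mem_nil, or_false] at hx
  rcases hx with rfl | rfl | rfl | ⟨⟨u, v, a⟩, -, rfl | rfl | rfl⟩ | rfl | ⟨f, -, rfl⟩ <;> omega

theorem card_states_le_length {m₁ m₂ : ℕ} {A : NFA (Fin σ) (Fin m₁)} {B : NFA (Fin σ) (Fin m₂)}
    {input : List ℕ} (hA : IsAutomaton A) (hB : IsAutomaton B) (h : IsPairEncoding A B input) :
    max m₁ m₂ ≤ input.length := by
  obtain ⟨_, _, henc₁, henc₂, rfl⟩ := h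
  obtain ⟨q₁, es₁, fs₁, h₁, rfl⟩ := exists_isListing_of_isEncoding henc₁
  obtain ⟨q₂, es₂, fs₂, h₂, rfl⟩ := exists_isListing_of_isEncoding henc₂
  have := h₁.card_states_le hA
  have := h₂.card_states_le hB
  simp only [List.length_cons, List.length_append, length_encodeData]
  omega

end Size

open Colex ColexWidth

/-! ### The running time -/

section Time

variable {σ n X p w : ℕ}

theorem log_four_mul_le (hX : X ≤ 2 ^ (2 * n)) : Nat.log 2 (4 * X) ≤ 2 * n + 2 :=
  calc Nat.log 2 (4 * X) ≤ Nat.log 2 (2 ^ (2 * n + 2)) :=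
        Nat.log_mono_right (by rw [pow_add]; omega)
    _ = 2 * n + 2 := Nat.log_pow one_lt_two _

theorem tick_le {m e f : ℕ} (hσ : 0 < σ) (hn : 0 < n) (hX : 0 < X) (hX' : X ≤ 2 ^ (2 * n))
    (hm : m ≤ 2 * n) (he : e ≤ 2 * n ^ 2) (hf : f ≤ 2 * n) :
    ((50 * m + 20 * e + 6 * Nat.log 2 (4 * X) + 62) * σ + 4) * (4 * X) + 44 * m + 14 * e + 6 * f +
      6 * Nat.log 2 (4 * X) + 91 ≤ 1200 * (X * n ^ 2 * σ) := by
  have hlog := log_four_mul_le hX'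
  have hnn : n ≤ n ^ 2 := Nat.le_self_pow two_ne_zero n
  have hXn : n ^ 2 ≤ X * n ^ 2 := Nat.le_mul_of_pos_left _ hX
  have hX_le : X ≤ X * n ^ 2 := Nat.le_mul_of_pos_right _ (by positivity)
  have hXσ : X * n ^ 2 ≤ X * n ^ 2 * σ := Nat.le_mul_of_pos_right _ hσ
  have hcost : 50 * m + 20 * e + 6 * Nat.log 2 (4 * X) + 62 ≤ 230 * n ^ 2 := by omega
  have hloop : ((50 * m + 20 * e + 6 * Nat.log 2 (4 * X) + 62) * σ + 4) * (4 * X) ≤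
      920 * (X * n ^ 2 * σ) + 16 * X :=
    calc _ ≤ (230 * n ^ 2 * σ + 4) * (4 * X) := by gcongr
      _ = _ := by ring
  omega

theorem two_pow_mul_le_two_pow (hX : X ≤ 2 ^ p * n) (hp : 0 < p)
    (hw : 24 * (p + Nat.log 2 n) ≤ w) : 2 ^ 16 * (X * n ^ 3) ≤ 2 ^ w := by
  have hn : n ≤ 2 ^ (Nat.log 2 n + 1) := (Nat.lt_pow_succ_log_self one_lt_two n).le
  calc 2 ^ 16 * (X * n ^ 3) ≤ 2 ^ 16 * (2 ^ p * n * n ^ 3) := by gcongr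
    _ = 2 ^ 16 * (2 ^ p * n ^ 4) := by ring
    _ ≤ 2 ^ 16 * (2 ^ p * (2 ^ (Nat.log 2 n + 1)) ^ 4) := by gcongr
    _ = 2 ^ (16 + (p + (Nat.log 2 n + 1) * 4)) := by rw [pow_add _ 16, pow_add _ p, pow_mul]
    _ ≤ 2 ^ w := Nat.pow_le_pow_right two_pos (by omega)

theorem le_two_pow_two_mul (hX : X ≤ 2 ^ p * n) (hp : p ≤ n) : X ≤ 2 ^ (2 * n) :=
  calc X ≤ 2 ^ p * n := hX
    _ ≤ 2 ^ n * 2 ^ n :=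
      Nat.mul_le_mul (Nat.pow_le_pow_right two_pos hp) Nat.lt_two_pow_self.le
    _ = 2 ^ (2 * n) := by rw [two_mul, pow_add]

theorem decidesWithin_mono {c : WordRAM.Cmd} {input : List ℕ} {P : Prop} {T T' : ℕ}
    (h : c.DecidesWithin w input P T) (hT : T ≤ T') : c.DecidesWithin w input P T' := by
  obtain ⟨s, t, hexec, ht, hres⟩ := h
  exact ⟨s, t, hexec, ht.trans hT, hres⟩

end Time

section Main

/-- The compiled program, with its answer moved to register `0`. -/
noncomputable def machineProgram : WordRAM.Cmd :=
  .seq nfaEquivalence.compile (.move 0 (regIdx Var.result))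

variable {m₁ m₂ σ n p w : ℕ} {A : NFA (Fin σ) (Fin m₁)} {B : NFA (Fin σ) (Fin m₂)}
  {input : List ℕ}

theorem runs_nfaEquivalence_of_ncard_le {X : ℕ} {inp : ℕ → ℕ} {q₁ : Fin m₁} {q₂ : Fin m₂}
    {es₁ : List (Fin m₁ × Fin m₁ × Fin σ)} {es₂ : List (Fin m₂ × Fin m₂ × Fin σ)}
    {fs₁ : List (Fin m₁)} {fs₂ : List (Fin m₂)} (h₁ : IsListing A q₁ es₁ fs₁)
    (h₂ : IsListing B q₂ es₂ fs₂)
    (hinp : HoldsAt inp 0 (σ :: (encodeData q₁ es₁ fs₁ ++ encodeData q₂ es₂ fs₂)))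
    (hA : IsAutomaton A) (hB : IsAutomaton B) (hσ : 0 < σ) (hm₁ : m₁ ≤ n) (hm₂ : m₂ ≤ n)
    (hXA : (Set.range A.eval).ncard ≤ 2 * X) (hXB : (Set.range B.eval).ncard ≤ 2 * X)
    (hX : 0 < X) (hX' : X ≤ 2 ^ (2 * n)) :
    Runs (20 * (X * n ^ 2)) inp nfaEquivalence .init fun s => s.tick ≤ 1200 * (X * n ^ 2 * σ) ∧
      (A.accepts = B.accepts → s.reg .result = 1) ∧
      (A.accepts ≠ B.accepts → s.reg .result = 0) := by
  have hn : 0 < n := (Nat.zero_le _).trans_lt (q₁.isLt.trans_le hm₁)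
  have hes₁ := (h₁.length_edges_le hA).trans (Nat.pow_le_pow_left hm₁ 2)
  have hes₂ := (h₂.length_edges_le hB).trans (Nat.pow_le_pow_left hm₂ 2)
  have hfs₁ := h₁.length_finals_le
  have hfs₂ := h₂.length_finals_le
  have hN : (Set.range A.eval).encard + (Set.range B.eval).encard ≤ (4 * X : ℕ) := by
    rw [← (Set.toFinite _).cast_ncard_eq, ← (Set.toFinite _).cast_ncard_eq, ← Nat.cast_add,
      Nat.cast_le]
    omega
  have hspace : 4 * X * (m₁ + m₂ + 1) ≤ 20 * (X * n ^ 2) := by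
    have hnn : n ≤ n ^ 2 := Nat.le_self_pow two_ne_zero n
    calc _ ≤ 4 * X * (5 * n ^ 2) := Nat.mul_le_mul_left _ (by omega)
      _ = _ := by ring
  exact (runs_nfaEquivalence h₁ h₂ hN hspace hinp).mono fun s _ ⟨heq, hne, htick⟩ =>
    ⟨htick.trans (tick_le hσ hn hX hX' (by omega) (by omega) (by omega)), heq, hne⟩

theorem decidesWithin_machineProgram_of_ncard_le {X : ℕ} (hσ : 0 < σ) (hA : IsAutomaton A)
    (hB : IsAutomaton B) (h : IsPairEncoding A B input) (hm₁ : m₁ ≤ n) (hm₂ : m₂ ≤ n)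
    (hXA : (Set.range A.eval).ncard ≤ 2 * X) (hXB : (Set.range B.eval).ncard ≤ 2 * X)
    (hX : X ≤ 2 ^ (2 * n)) (hw : 2 ^ 16 * (X * n ^ 3) ≤ 2 ^ w) :
    machineProgram.DecidesWithin w input (A.accepts = B.accepts) (8401 * (X * n ^ 2 * σ)) := by
  have hσm : σ ≤ m₁ := by simpa using card_alphabet_le hA
  have hXpos : 0 < X := by
    have := (Set.ncard_pos (Set.toFinite _)).2 (Set.range_nonempty A.eval)
    omega
  obtain ⟨_, _, henc₁, henc₂, rfl⟩ := h
  obtain ⟨q₁, es₁, fs₁, h₁, rfl⟩ := exists_isListing_of_isEncoding henc₁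
  obtain ⟨q₂, es₂, fs₂, h₂, rfl⟩ := exists_isListing_of_isEncoding henc₂
  have hes₁ := (h₁.length_edges_le hA).trans (Nat.pow_le_pow_left hm₁ 2)
  have hes₂ := (h₂.length_edges_le hB).trans (Nat.pow_le_pow_left hm₂ 2)
  have hfs₁ := h₁.length_finals_le
  have hfs₂ := h₂.length_finals_le
  have hnn : n ≤ n ^ 2 := Nat.le_self_pow two_ne_zero n
  have hXn : n ^ 2 ≤ X * n ^ 2 := Nat.le_mul_of_pos_left _ hXpos
  have hXσ : X * n ^ 2 ≤ X * n ^ 2 * σ := Nat.le_mul_of_pos_right _ hσ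
  have hσ_le : X * n ^ 2 * σ ≤ X * n ^ 3 := by
    rw [pow_succ n 2, ← mul_assoc]
    exact Nat.mul_le_mul_left _ (hσm.trans hm₁)
  have hruns := runs_nfaEquivalence_of_ncard_le h₁ h₂ (holdsAt_getD [] _) hA hB hσ hm₁ hm₂ hXA hXB
    hXpos hX
  refine decidesWithin_mono (decidesWithin_compile hruns (List.forall_mem_cons.2
    ⟨by omega, List.forall_mem_append.2 ⟨encodeData_le ?_ ?_ ?_ ?_, encodeData_le ?_ ?_ ?_ ?_⟩⟩)
    ?_ ?_) ?_
  case refine_9 =>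
    simp only [List.length_cons, List.length_append, length_encodeData]
    omega
  case refine_10 =>
    rw [show Fintype.card Arr = 14 from rfl]
    omega
  all_goals omega

theorem decidesWithin_machineProgram_of_sortable (hσ : 0 < σ) (hm₁ : m₁ ≤ n) (hm₂ : m₂ ≤ n)
    (hA : IsAutomaton A) (hB : IsAutomaton B) (hpA : Sortable A p) (hpB : Sortable B p)
    (h : IsPairEncoding A B input) (hw : 24 * (p + Nat.log 2 n) ≤ w) :
    machineProgram.DecidesWithin w input (A.accepts = B.accepts)
      (8401 * (2 ^ p * (n - p + 1) * n ^ 2 * σ)) := by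
  have hp := pos_of_sortable hA hpA
  have hpn : p ≤ n := (le_card_of_sortable hpA).trans (by simpa using hm₁)
  have hX : 2 ^ p * (n - p + 1) ≤ 2 ^ p * n := Nat.mul_le_mul_left _ (by omega)
  have hcard {m : ℕ} (hm : m ≤ n) {M : NFA (Fin σ) (Fin m)} (hM : IsAutomaton M)
      (hpM : Sortable M p) : (Set.range M.eval).ncard ≤ 2 * (2 ^ p * (n - p + 1)) := by
    refine (ncard_range_eval_le hM hpM).trans ?_
    rw [Fintype.card_fin, mul_left_comm]
    exact Nat.mul_le_mul_left _ (by omega)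
  exact decidesWithin_machineProgram_of_ncard_le hσ hA hB h hm₁ hm₂ (hcard hm₁ hA hpA)
    (hcard hm₂ hB hpB) (le_two_pow_two_mul hX hpn) (two_pow_mul_le_two_pow hX hp hw)

theorem decidesWithin_machineProgram_of_width (hσ : 0 < σ) (hA : IsAutomaton A)
    (hB : IsAutomaton B) (hp : p = max (width A) (width B)) (h : IsPairEncoding A B input)
    (hw : 24 * (p + Nat.log 2 (max m₁ m₂)) ≤ w) :
    machineProgram.DecidesWithin w input (A.accepts = B.accepts)
      (8401 * 2 ^ p * input.length ^ 4) := by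
  have hcard {m : ℕ} {M : NFA (Fin σ) (Fin m)} (hm : m ≤ max m₁ m₂) (hM : IsAutomaton M)
      (hpM : width M ≤ p) : 0 < width M ∧ width M ≤ m ∧
        (Set.range M.eval).ncard ≤ 2 * (2 ^ p * max m₁ m₂) := by
    have hpos := pos_of_sortable hM (sortable_width M)
    have hle : width M ≤ m := by simpa using le_card_of_sortable (sortable_width M)
    refine ⟨hpos, hle, (ncard_range_eval_le hM (sortable_width M)).trans ?_⟩
    rw [Fintype.card_fin, mul_left_comm]
    exact Nat.mul_le_mul (Nat.pow_le_pow_right two_pos hpM) (by omega)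
  obtain ⟨hposA, hleA, hcardA⟩ := hcard (le_max_left _ _) hA (hp ▸ le_max_left _ _)
  obtain ⟨-, hleB, hcardB⟩ := hcard (le_max_right _ _) hB (hp ▸ le_max_right _ _)
  have hL : max m₁ m₂ ≤ input.length := card_states_le_length hA hB h
  have hσL : σ ≤ input.length := by
    have : σ ≤ m₁ := by simpa using card_alphabet_le hA
    omega
  refine decidesWithin_mono (decidesWithin_machineProgram_of_ncard_le hσ hA hB h (le_max_left _ _)
    (le_max_right _ _) hcardA hcardB (le_two_pow_two_mul le_rfl (by omega))
    (two_pow_mul_le_two_pow le_rfl (by omega) hw)) ?_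
  calc 8401 * (2 ^ p * max m₁ m₂ * max m₁ m₂ ^ 2 * σ)
      ≤ 8401 * (2 ^ p * input.length * input.length ^ 2 * input.length) := by gcongr
    _ = 8401 * 2 ^ p * input.length ^ 4 := by ring

end Main

end EquivProg

theorem mainTheorem9 :
    ∃ (prog : WordRAM.Cmd) (c : ℕ),
      (∃ C : ℕ, ∀ (p n σ m₁ m₂ w : ℕ) (A : NFA (Fin σ) (Fin m₁)) (B : NFA (Fin σ) (Fin m₂))
        (input : List ℕ),
        0 < σ → m₁ ≤ n → m₂ ≤ n →
        Colex.IsAutomaton A → Colex.IsAutomaton B →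
        Colex.Sortable A p → Colex.Sortable B p →
        Colex.IsPairEncoding A B input →
        c * (p + Nat.log 2 n) ≤ w →
        prog.DecidesWithin w input (A.accepts = B.accepts)
          (C * (2 ^ p * (n - p + 1) * n ^ 2 * σ))) ∧
      (∃ K k : ℕ, ∀ (p σ m₁ m₂ w : ℕ) (A : NFA (Fin σ) (Fin m₁)) (B : NFA (Fin σ) (Fin m₂))
        (input : List ℕ),
        0 < σ →
        Colex.IsAutomaton A → Colex.IsAutomaton B →
        p = max (Colex.width A) (Colex.width B) →
        Colex.IsPairEncoding A B input →
        c * (p + Nat.log 2 (max m₁ m₂)) ≤ w →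
        prog.DecidesWithin w input (A.accepts = B.accepts) (K * 2 ^ p * input.length ^ k)) := by
  refine ⟨EquivProg.machineProgram, 24, ⟨8401, ?_⟩, 8401, 4, ?_⟩
  · intro p n σ m₁ m₂ w A B input
    exact EquivProg.decidesWithin_machineProgram_of_sortable
  · intro p σ m₁ m₂ w A B input
    exact EquivProg.decidesWithin_machineProgram_of_width
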